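/- Let $X$ be a smooth projective surface over $\mathbb{C}$ (an integral scheme), let $Z=\{p_1,\dots,p_k\}\subset X$ be a finite set of closed points, let $\eta:\widetilde X\to X$ be the blow-up of $X$ along $Z$ (with its reduced structure), and let $E_j=\eta^{-1}(p_j)$ be the exceptional curves, $E=E_1+\dots+E_k$. Let $\mathcal D=\{C_1,\dots,C_m\}$ be an arrangement of smooth irreducible curves on $X$ with simple normal crossings, let $\widetilde C_i$ be the strict transform of $C_i$, i.e. the closure of $\eta^{-1}(C_i\setminus Z)$, and put $\widetilde{\mathcal D}^E=\{\widetilde C_1,\dots,\widetilde C_m\}\cup\{E_1,\dots,E_k\}$. For a finite family $\mathcal A$ of reduced divisors on a smooth integral $\mathbb{C}$-scheme $Y$, let $\Omega^1_Y(\log\mathcal A)$ be the sheaf of $\mathcal O_Y$-modules of those rational $1$-forms which at every point $y$ can be written as $\omega+\sum_i u_i\,\frac{dz_i}{z_i}$, with $\omega$ a $1$-form regular at $y$, $u_i\in\mathcal O_{Y,y}$, and $z_i\in\mathcal O_{Y,y}$ local equations at $y$ of members of $\mathcal A$. If $Z\cap C_i=\emptyset$ for every $i$, then $\widetilde X$ is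 integral and there is an isomorphism of $\mathcal O_{\widetilde X}$-modules $$\eta^{*}\Omega^1_X(\log\mathcal D)\;\cong\;\Omega^1_{\widetilde X}(\log\widetilde{\mathcal D}^{E})(-E),$$ where $\mathcal F(-E)=\mathcal F\otimes_{\mathcal O_{\widetilde X}}\mathcal O_{\widetilde X}(-E)$. -/

import Mathlib

open CategoryTheory AlgebraicGeometry TopologicalSpace Opposite

namespace LogBlowUp

noncomputable section

/-! ### Sheaves of modules given by lattices in a rational module -/

section Lattice

variable (X : Scheme.{0}) [IsIntegral X]

/-- The local ring `𝒪_{X,x}`, viewed as a subring of the function field of `X`. -/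
def localRing (x : X) : Subring X.functionField :=
  (algebraMap (X.presheaf.stalk x) X.functionField).range

variable {X} {M : Type} [AddCommGroup M] [Module X.functionField M]

/-- Given an `𝒪_{X,x}`-submodule `L x` of the `K(X)`-vector space `M` for every `x`, the functions
`U → M` which are constant (so an element of `M` if `U ≠ ∅`, and nothing but `0` if `U = ∅`),
with value in `L x` at every `x ∈ U`. -/
def latticePredicate (L : ∀ x : X, Submodule (localRing X x) M) :
    TopCat.LocalPredicate (X := X.toTopCat) (fun _ : X => M) where
  pred {U} s := (∀ x : U, s x ∈ L x.1) ∧ ∀ x y : U, s x = s y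
  res {U V} i f h := ⟨fun x => h.1 (i x), fun x y => h.2 (i x) (i y)⟩
  locality {U} f h := by
    have key : ∀ (x : U) (hU : genericPoint X ∈ U), f x = f ⟨genericPoint X, hU⟩ := by
      intro x hU
      obtain ⟨V, hxV, i, hV⟩ := h x
      have hg : genericPoint X ∈ V :=
        ((genericPoint_spec X).mem_open_set_iff V.isOpen).mpr (by simpa using ⟨x.1, hxV⟩)
      exact hV.2 ⟨x.1, hxV⟩ ⟨genericPoint X, hg⟩
    refine ⟨fun x => ?_, fun x y => ?_⟩
    · obtain ⟨V, hxV, i, hV⟩ := h x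
      exact hV.1 ⟨x.1, hxV⟩
    · have hU : genericPoint X ∈ U :=
        ((genericPoint_spec X).mem_open_set_iff U.isOpen).mpr (by simpa using ⟨x.1, x.2⟩)
      rw [key x hU, key y hU]

/-- Sections over `U`: the elements of `M` lying in `L x` for all `x ∈ U`. -/
def latticeSections (L : ∀ x : X, Submodule (localRing X x) M) (U : X.Opens) :
    AddSubgroup (U → M) where
  carrier := {s | (latticePredicate L).pred s}
  zero_mem' := ⟨fun _ => zero_mem _, fun _ _ => rfl⟩
  add_mem' ha hb := ⟨fun x => add_mem (ha.1 x) (hb.1 x), fun x y =>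
    congrArg₂ (· + ·) (ha.2 x y) (hb.2 x y)⟩
  neg_mem' ha := ⟨fun x => neg_mem (ha.1 x), fun x y => congrArg Neg.neg (ha.2 x y)⟩

/-- The value in the function field of a function `f ∈ 𝒪_X(U)`, through its germ at `x ∈ U`. -/
def rationalValue {U : X.Opens} (x : U) : Γ(X, U) →+* X.functionField :=
  (algebraMap (X.presheaf.stalk x.1) X.functionField).comp (X.presheaf.germ U x.1 x.2).hom

lemma rationalValue_eq {U : X.Opens} (x y : U) (f : Γ(X, U)) :
    rationalValue x f = rationalValue y f := by
  have : Nonempty U := ⟨x⟩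
  simp only [rationalValue, RingHom.comp_apply]
  erw [Scheme.algebraMap_germ_eq_germToFunctionField, Scheme.algebraMap_germ_eq_germToFunctionField]

lemma rationalValue_mem {U : X.Opens} (x : U) (f : Γ(X, U)) :
    rationalValue x f ∈ localRing X x.1 := ⟨_, rfl⟩

lemma rationalValue_map {U V : X.Opens} (i : V ⟶ U) (x : V) (f : Γ(X, U)) :
    rationalValue x (X.presheaf.map i.op f) = rationalValue (i x : U) f := by
  simp only [rationalValue, RingHom.comp_apply]
  congr 1
  exact TopCat.Presheaf.germ_res_apply X.presheaf i x.1 x.2 f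

instance latticeModule (L : ∀ x : X, Submodule (localRing X x) M) (U : X.Opens) :
    Module Γ(X, U) (latticeSections L U) where
  smul f s := ⟨fun x => rationalValue x f • s.1 x,
    fun x => (L x.1).smul_mem ⟨_, rationalValue_mem x f⟩ (s.2.1 x),
    fun x y => congrArg₂ (· • ·) (rationalValue_eq x y f) (s.2.2 x y)⟩
  one_smul s := Subtype.ext (funext fun x => by
    change rationalValue x 1 • s.1 x = s.1 x
    rw [map_one, one_smul])
  mul_smul f g s := Subtype.ext (funext fun x => by
    change rationalValue x (f * g) • s.1 x = rationalValue x f • rationalValue x g • s.1 x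
    rw [map_mul, mul_smul])
  smul_zero f := Subtype.ext (funext fun x => smul_zero (rationalValue x f))
  smul_add f s t := Subtype.ext (funext fun x => smul_add (rationalValue x f) (s.1 x) (t.1 x))
  add_smul f g s := Subtype.ext (funext fun x => by
    change rationalValue x (f + g) • s.1 x = rationalValue x f • s.1 x + rationalValue x g • s.1 x
    rw [map_add, add_smul])
  zero_smul s := Subtype.ext (funext fun x => by
    change rationalValue x 0 • s.1 x = 0
    rw [map_zero, zero_smul])

/-- The presheaf of abelian groups `U ↦ latticeSections L U`, with the obvious restrictions. -/
def latticePresheaf (L : ∀ x : X, Submodule (localRing X x) M) :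
    TopCat.Presheaf AddCommGrpCat.{0} X.toTopCat where
  obj U := AddCommGrpCat.of (latticeSections L U.unop)
  map {U V} i := AddCommGrpCat.ofHom
    { toFun := fun s => ⟨fun x => s.1 (i.unop x), (latticePredicate L).res i.unop s.1 s.2⟩
      map_zero' := rfl
      map_add' := fun _ _ => rfl }

instance (L : ∀ x : X, Submodule (localRing X x) M) (U : X.Opensᵒᵖ) :
    Module (X.ringCatSheaf.obj.obj U) ((latticePresheaf L).obj U) :=
  latticeModule L U.unop

/-- The sheaf of `𝒪_X`-modules whose sections over a nonempty open `U` are the elements of `M`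
lying in `L x` for all `x ∈ U`. -/
def latticeSheaf (L : ∀ x : X, Submodule (localRing X x) M) : X.Modules where
  val := PresheafOfModules.ofPresheaf (R := X.ringCatSheaf.obj) (latticePresheaf L)
    (fun _ _ i f s => Subtype.ext (funext fun x =>
      (congrArg (· • s.1 (i.unop x)) (rationalValue_map i.unop x f)).symm))
  isSheaf := (TopCat.Presheaf.isSheaf_iff_isSheaf_comp (forget AddCommGrpCat) _).2
    (TopCat.subsheafToTypes (latticePredicate L)).2

end Lattice

/-! ### Ideal sheaves, divisors and twists -/

/-- The stalk at `x` of an ideal sheaf, an ideal of `𝒪_{X,x}`. -/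
def stalkIdeal {X : Scheme.{0}} (I : X.IdealSheafData) (x : X) : Ideal (X.presheaf.stalk x) :=
  ⨆ (U : X.affineOpens) (hx : x ∈ U.1), (I.ideal U).map (X.presheaf.germ U.1 x hx).hom

/-- The ideal sheaf `I ⊆ 𝒪_X` as a sheaf of modules, realized inside the function field. For the
ideal sheaf `I` of an effective Cartier divisor `D` this is the line bundle `𝒪_X(-D)`. -/
def idealModule {X : Scheme.{0}} [IsIntegral X] (I : X.IdealSheafData) : X.Modules :=
  latticeSheaf (M := X.functionField) fun x => Submodule.span (localRing X x)
    (algebraMap (X.presheaf.stalk x) X.functionField '' (stalkIdeal I x : Set _))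

/-- The tensor product of two sheaves of `𝒪_X`-modules: the sheaf associated with
`U ↦ F(U) ⊗_{𝒪_X(U)} G(U)`. -/
def tensorProduct {X : Scheme.{0}} (F G : X.Modules) : X.Modules :=
  (PresheafOfModules.sheafification (𝟙 X.ringCatSheaf.obj)).obj
    (PresheafOfModules.Monoidal.tensorObj (R := X.presheaf) F.val G.val)

/-- The ideal sheaf of the effective divisor `∑ j, D j`, where the `D j` are
closed subsets with their reduced structure: the product of the ideal sheaves of the `D j`. -/
def divisorIdeal {X : Scheme.{0}} {κ : Type} [Fintype κ] (D : κ → Closeds X) : X.IdealSheafData :=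
  ∏ j, Scheme.IdealSheafData.vanishingIdeal (D j)

/-- The twist `F(-∑ j, D j) = F ⊗ 𝒪_X(-∑ j, D j)`. -/
def twistNeg {X : Scheme.{0}} [IsIntegral X] (F : X.Modules) {κ : Type} [Fintype κ]
    (D : κ → Closeds X) : X.Modules :=
  tensorProduct F (idealModule (divisorIdeal D))

/-! ### Logarithmic differentials -/

/-- The base scheme `Spec ℂ`. -/
abbrev SpecC : Scheme.{0} := Spec (CommRingCat.of ℂ)

section Log

variable {X : Scheme.{0}} [IsIntegral X] (s : X ⟶ SpecC)

/-- The function field of a `ℂ`-scheme is a `ℂ`-algebra. -/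
@[reducible] def functionFieldAlgebra : Algebra ℂ X.functionField :=
  ((X.presheaf.germ ⊤ (genericPoint X) trivial).hom.comp
    (s.appTop.hom.comp (Scheme.ΓSpecIso (CommRingCat.of ℂ)).inv.hom)).toAlgebra

/-- The `K(X)`-vector space of rational (meromorphic) `1`-forms, `Ω_{K(X)/ℂ}`. -/
abbrev RationalForms : Type :=
  @KaehlerDifferential ℂ X.functionField _ _ (functionFieldAlgebra s)

/-- The exterior derivative `d : K(X) → Ω_{K(X)/ℂ}`. -/
def d (f : X.functionField) : RationalForms s :=
  letI := functionFieldAlgebra s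
  KaehlerDifferential.D ℂ X.functionField f

/-- The logarithmic differential `dlog f = df / f`. -/
def dlog (f : X.functionField) : RationalForms s := f⁻¹ • d s f

/-- The rational `1`-forms with at most logarithmic poles along the `D i` at the point `x`: those
of the form `ω + ∑ u_i dlog z_i` with `ω` a regular `1`-form at `x` (an `𝒪_{X,x}`-combination of
forms `df`, `f ∈ 𝒪_{X,x}`), `u_i ∈ 𝒪_{X,x}`, and `z_i ∈ 𝒪_{X,x}` a local equation of `D i` at `x`.
(If `x ∉ D i`, then `z_i` is a unit and `dlog z_i` is regular.) -/
def logForms {ι : Type} (D : ι → Closeds X) (x : X) :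
    Submodule (localRing X x) (RationalForms s) :=
  Submodule.span (localRing X x)
    ({ω | ∃ f : X.presheaf.stalk x, ω = d s (algebraMap _ X.functionField f)} ∪
     {ω | ∃ (i : ι) (z : X.presheaf.stalk x),
        Ideal.span {z} = stalkIdeal (Scheme.IdealSheafData.vanishingIdeal (D i)) x ∧
        ω = dlog s (algebraMap _ X.functionField z)})

/-- The logarithmic sheaf `Ω¹_X(log D)` of a family `D` of reduced divisors on a smooth integral
`ℂ`-scheme: its sections over `U` are the rational `1`-forms which have at most logarithmic poles
along `D` at every point of `U`. -/
def logSheaf {ι : Type} (D : ι → Closeds X) : X.Modules := latticeSheaf (logForms s D)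

end Log

/-! ### Smooth projective surfaces and arrangements -/

instance homogeneousGrading (n : ℕ) :
    GradedAlgebra (MvPolynomial.homogeneousSubmodule (Fin (n + 1)) ℂ) :=
  MvPolynomial.gradedAlgebra

/-- Projective space `ℙⁿ = Proj ℂ[x₀, …, xₙ]` over `ℂ`. -/
abbrev projectiveSpace (n : ℕ) : Scheme.{0} :=
  Proj (MvPolynomial.homogeneousSubmodule (Fin (n + 1)) ℂ)

/-- The structure morphism `ℙⁿ ⟶ Spec ℂ`. -/
def projectiveSpaceToSpecC (n : ℕ) : projectiveSpace n ⟶ SpecC :=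
  Proj.toSpecZero (MvPolynomial.homogeneousSubmodule (Fin (n + 1)) ℂ) ≫
    Spec.map (CommRingCat.ofHom
      (algebraMap ℂ (MvPolynomial.homogeneousSubmodule (Fin (n + 1)) ℂ 0)))

/-- `X` is projective over `ℂ`: it has a closed immersion over `ℂ` into some `ℙⁿ`. -/
def IsProjective {X : Scheme.{0}} (s : X ⟶ SpecC) : Prop :=
  ∃ (n : ℕ) (i : X ⟶ projectiveSpace n), IsClosedImmersion i ∧ i ≫ projectiveSpaceToSpecC n = s

/-- The integral `ℂ`-scheme `X` is a smooth projective surface. -/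
structure IsSmoothProjectiveSurface {X : Scheme.{0}} [IsIntegral X] (s : X ⟶ SpecC) : Prop where
  projective : IsProjective s
  smooth : SmoothOfRelativeDimension 2 s

/-- An arrangement of smooth irreducible curves with simple normal crossings: the `C i` are
smooth irreducible curves, and at every point `x` the curves through `x` have local equations
which are part of a system of local coordinates, i.e. whose classes in the cotangent space
`𝔪_x / 𝔪_x²` are linearly independent. (In particular the curves are distinct.) -/
structure IsSNCArrangement {X : Scheme.{0}} (s : X ⟶ SpecC) {ι : Type}
    (C : ι → Closeds X) : Prop where
  irreducible : ∀ i, IsIrreducible (C i : Set X)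
  smooth : ∀ i, SmoothOfRelativeDimension 1
    ((Scheme.IdealSheafData.vanishingIdeal (C i)).subschemeι ≫ s)
  normal_crossings : ∀ x : X,
    ∃ z : {i : ι // x ∈ C i} → IsLocalRing.maximalIdeal (X.presheaf.stalk x),
      (∀ i, Ideal.span {(z i : X.presheaf.stalk x)} =
        stalkIdeal (Scheme.IdealSheafData.vanishingIdeal (C i.1)) x) ∧
      LinearIndependent (IsLocalRing.ResidueField (X.presheaf.stalk x))
        (fun i => (IsLocalRing.maximalIdeal (X.presheaf.stalk x)).toCotangent (z i))

/-! ### Blow-ups -/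

/-- An ideal sheaf is invertible (the ideal of an effective Cartier divisor) if locally it is
generated by one nonzerodivisor. -/
def IsInvertibleIdeal {X : Scheme.{0}} (I : X.IdealSheafData) : Prop :=
  ∀ x : X, ∃ U : X.affineOpens, x ∈ U.1 ∧ ∃ f ∈ nonZeroDivisors Γ(X, U.1),
    I.ideal U = Ideal.span {f}

/-- `η : Y ⟶ X` is the blow-up of `X` along the closed subscheme with ideal sheaf `I`: the inverse
image ideal sheaf `η⁻¹I · 𝒪_Y` is invertible, and `η` is universal with this property. -/
structure IsBlowUp {X Y : Scheme.{0}} (η : Y ⟶ X) (I : X.IdealSheafData) : Prop where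
  invertible : IsInvertibleIdeal (I.comap η)
  universal : ∀ {T : Scheme.{0}} (g : T ⟶ X), IsInvertibleIdeal (I.comap g) →
    ∃! h : T ⟶ Y, h ≫ η = g

section Transforms

variable {X Y : Scheme.{0}} (η : Y ⟶ X) (Z : Finset X)

/-- A finite set of closed points as a closed subset. -/
def pointsClosed (hZ : ∀ p ∈ Z, IsClosed ({p} : Set X)) : Closeds X :=
  ⟨(Z : Set X), by
    rw [← Set.biUnion_of_singleton (Z : Set X)]
    exact Z.finite_toSet.isClosed_biUnion hZ⟩

/-- The strict transform of `C`: the closure of `η⁻¹(C ∖ Z)`. -/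
def strictTransform (C : Closeds X) : Closeds Y :=
  Closeds.closure (η ⁻¹' ((C : Set X) \ (Z : Set X)))

/-- The exceptional curves `E_p = η⁻¹(p)`, for `p ∈ Z`. -/
def exceptional (hZ : ∀ p ∈ Z, IsClosed ({p} : Set X)) (p : {p // p ∈ Z}) : Closeds Y :=
  ⟨η ⁻¹' {p.1}, (hZ p.1 p.2).preimage η.continuous⟩

/-- The arrangement on the blow-up consisting of the strict transforms of
the `C i` together with the exceptional curves. -/
def totalArrangement {ι : Type} (C : ι → Closeds X) (hZ : ∀ p ∈ Z, IsClosed ({p} : Set X)) :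
    ι ⊕ {p // p ∈ Z} → Closeds Y :=
  Sum.elim (fun i => strictTransform η Z (C i)) (exceptional η Z hZ)

end Transforms

end

end LogBlowUp

/-! Both sheaves are given by lattices of rational 1-forms, so the theorem reduces to comparing
stalks inside one vector space. The blow-up `η` is birational, hence pulling back forms is a
semilinear bijection (`formsMap`) from the rational forms of `X` to those of the blow-up. Tensoring
with the ideal of `E` multiplies a lattice by a local equation of `E`
(`nonempty_tensorProduct_iso`).

Away from `Z`, `η` is a local isomorphism and the two lattices correspond. Over `p ∈ Z` no curve of
the arrangement is present, so the lattice on `X` is free on `dx₁, dx₂` for local coordinates `x₁,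
x₂` at `p`. At a point `y` over `p`, one coordinate, say `x₁`, generates `𝔪_p 𝒪_y`, and `x₂ = x₁ v`.
The logarithmic forms at `y` are generated by `dx₁/x₁` and the `df`; after multiplication by `x₁`
they become `dx₁` and the `x₁ df`. The ring `𝒪_y` is obtained from `𝒪_p` by adjoining `v` and
inverses of units, so everything reduces to `x₁ dv = dx₂ - v dx₁`. Hence the twisted lattice is
again spanned by `dx₁, dx₂`: this is `twistedLattice_eq_of_mem`.

No explicit model of the blow-up enters. Its universal property, tested on spectra of local rings,
gives the description of `𝒪_y` (`IsBlowUp.surjective_of_stalkMap_eq`, `IsBlowUp.subring_eq_top`).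
That `x₁` is an equation of the reduced curve `E` means that `(x₁)` is radical; it is even prime,
because `x₁, x₂` is a regular sequence (`isPrime_span_of_fractions`).

Equality of lattices becomes an isomorphism with `η^*` through a criterion
(`nonempty_pullback_iso`): a map `F ⟶ η_* N` exhibits `N` as `η^* F` if `N` is locally generated by
images of sections of `F` and the relations among these images in `N` hold under every `F ⟶ η_* G`.
Corresponding bases, or a local isomorphism, guarantee both. -/

namespace LogBlowUp

noncomputable section

/-! ### Recognizing a pullback of sheaves of modules -/

section PullbackCriterion

open Scheme.Modules

variable {X Y : Scheme.{0}}

/-- Restriction of sections of a sheaf of modules. -/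
abbrev res (M : X.Modules) {W V : X.Opens} (h : W ≤ V) (s : Γ(M, V)) : Γ(M, W) :=
  M.presheaf.map (homOfLE h).op s

lemma res_res (M : X.Modules) {W V U : X.Opens} (h : W ≤ V) (h' : V ≤ U) (s : Γ(M, U)) :
    res M h (res M h' s) = res M (h.trans h') s := by
  simp only [res, ← ConcreteCategory.comp_apply, ← Functor.map_comp]
  rfl

lemma res_self (M : X.Modules) {U : X.Opens} (h : U ≤ U) (s : Γ(M, U)) :
    res M h s = s := by
  have : (homOfLE h).op = 𝟙 (op U) := rfl
  simp only [res, this, CategoryTheory.Functor.map_id]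
  rfl

lemma res_smul (M : X.Modules) {W V : X.Opens} (h : W ≤ V) (r : Γ(X, V)) (s : Γ(M, V)) :
    res M h (r • s) = X.presheaf.map (homOfLE h).op r • res M h s :=
  map_smul M _ r s

lemma app_res {M N : X.Modules} (φ : M ⟶ N) {W V : X.Opens} (h : W ≤ V) (s : Γ(M, V)) :
    φ.app W (res M h s) = res N h (φ.app V s) :=
  ConcreteCategory.congr_hom (φ.mapPresheaf.naturality (homOfLE h).op) s

lemma eq_of_locally_eq (M : X.Modules) {V : X.Opens} (s t : Γ(M, V))
    (h : ∀ y ∈ V, ∃ (W : X.Opens) (hW : W ≤ V), y ∈ W ∧ res M hW s = res M hW t) : s = t := by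
  choose W hW hy hst using h
  refine TopCat.Sheaf.eq_of_locally_eq' (⟨M.presheaf, M.isSheaf⟩ : TopCat.Sheaf Ab X)
    (fun y : V => W y.1 y.2) V (fun y => homOfLE (hW y.1 y.2)) ?_ s t fun y => hst y.1 y.2
  exact fun y hyV => Opens.mem_iSup.2 ⟨⟨y, hyV⟩, hy y hyV⟩

lemma exists_gluing (M : X.Modules) {V : X.Opens} (W : V → X.Opens) (hW : ∀ y, W y ≤ V)
    (hy : ∀ y : V, y.1 ∈ W y) (g : ∀ y, Γ(M, W y))
    (hg : ∀ x y, res M (inf_le_left : W x ⊓ W y ≤ W x) (g x) =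
      res M (inf_le_right : W x ⊓ W y ≤ W y) (g y)) :
    ∃ s : Γ(M, V), ∀ y, res M (hW y) s = g y := by
  obtain ⟨s, hs, -⟩ := TopCat.Sheaf.existsUnique_gluing'
    (⟨M.presheaf, M.isSheaf⟩ : TopCat.Sheaf Ab X) W V (fun y => homOfLE (hW y))
    (fun y hyV => Opens.mem_iSup.2 ⟨⟨y, hyV⟩, hy ⟨y, hyV⟩⟩) g (fun x y => hg x y)
  exact ⟨s, hs⟩

/-- Restriction to `W ⊆ η⁻¹(U)` of the image of a section over `U` under `φ : F ⟶ η_* G`. -/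
def pull (η : Y ⟶ X) {F : X.Modules} {G : Y.Modules} (φ : F ⟶ (pushforward η).obj G)
    {U : X.Opens} {W : Y.Opens} (h : W ≤ η ⁻¹ᵁ U) (σ : Γ(F, U)) : Γ(G, W) :=
  res G h (φ.app U σ)

variable (η : Y ⟶ X) {F : X.Modules} {N G : Y.Modules}
    (u : F ⟶ (pushforward η).obj N) (φ : F ⟶ (pushforward η).obj G)

lemma res_pull {U : X.Opens} {W W' : Y.Opens} (h : W ≤ η ⁻¹ᵁ U) (h' : W' ≤ W) (σ : Γ(F, U)) :
    res G h' (pull η φ h σ) = pull η φ (h'.trans h) σ :=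
  res_res ..

lemma pull_res {U U' : X.Opens} {W : Y.Opens} (h : W ≤ η ⁻¹ᵁ U) (h' : U ≤ U') (σ : Γ(F, U')) :
    pull η φ h (res F h' σ) = pull η φ (h.trans (η.preimage_mono h')) σ := by
  rw [pull, app_res, pull]
  exact res_res G h (η.preimage_mono h') (φ.app U' σ)

lemma pull_add {U : X.Opens} {W : Y.Opens} (h : W ≤ η ⁻¹ᵁ U) (σ τ : Γ(F, U)) :
    pull η φ h (σ + τ) = pull η φ h σ + pull η φ h τ := by
  exact (congrArg (res G h) ((φ.app U).hom.map_add σ τ)).trans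
    ((G.presheaf.map (homOfLE h).op).hom.map_add _ _)

lemma pull_smul {U : X.Opens} {W : Y.Opens} (h : W ≤ η ⁻¹ᵁ U) (c : Γ(X, U)) (σ : Γ(F, U)) :
    pull η φ h (c • σ) = (η.appLE U W h c) • pull η φ h σ := by
  have h1 : φ.app U (c • σ) =
      HSMul.hSMul (β := Γ(G, η ⁻¹ᵁ U)) (η.app U c : Γ(Y, η ⁻¹ᵁ U)) (φ.app U σ) :=
    φ.app_smul c σ
  rw [pull, h1]
  exact res_smul G h _ _

/-- The span of the pairs of images of sections of `F`. -/
def pairSpan (W : Y.Opens) : Submodule Γ(Y, W) (Γ(N, W) × Γ(G, W)) :=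
  Submodule.span _ {p | ∃ (U : X.Opens) (h : W ≤ η ⁻¹ᵁ U) (σ : Γ(F, U)),
    p = (pull η u h σ, pull η φ h σ)}

/-- The span of the images of sections of `F`. -/
def imageSpan (W : Y.Opens) : Submodule Γ(Y, W) Γ(N, W) :=
  Submodule.span _ {p | ∃ (U : X.Opens) (h : W ≤ η ⁻¹ᵁ U) (σ : Γ(F, U)), p = pull η u h σ}

lemma pairSpan_res {W W' : Y.Opens} (h : W' ≤ W) {p : Γ(N, W) × Γ(G, W)}
    (hp : p ∈ pairSpan η u φ W) : (res N h p.1, res G h p.2) ∈ pairSpan η u φ W' := by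
  induction hp using Submodule.span_induction with
  | mem p hp =>
    obtain ⟨U, h', σ, rfl⟩ := hp
    exact Submodule.subset_span ⟨U, h.trans h', σ, by simp only [res_pull]⟩
  | zero =>
    have : (0 : Γ(N, W') × Γ(G, W')) ∈ pairSpan η u φ W' := zero_mem _
    simp only [Prod.fst_zero, Prod.snd_zero, res, map_zero]
    exact this
  | add p q _ _ hp hq =>
    have := add_mem hp hq
    simpa [res] using this
  | smul c p _ hp =>
    have := Submodule.smul_mem _ (Y.presheaf.map (homOfLE h).op c) hp
    simpa only [Prod.smul_fst, Prod.smul_snd, res_smul, Prod.smul_mk] using this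

lemma exists_pair {W : Y.Opens} {ω : Γ(N, W)} (h : ω ∈ imageSpan η u W) :
    ∃ g, (ω, g) ∈ pairSpan η u φ W := by
  induction h using Submodule.span_induction with
  | mem p hp =>
    obtain ⟨U, h', σ, rfl⟩ := hp
    exact ⟨_, Submodule.subset_span ⟨U, h', σ, rfl⟩⟩
  | zero => exact ⟨0, zero_mem _⟩
  | add p q _ _ hp hq =>
    obtain ⟨g, hg⟩ := hp
    obtain ⟨g', hg'⟩ := hq
    exact ⟨g + g', add_mem hg hg'⟩
  | smul c p _ hp =>
    obtain ⟨g, hg⟩ := hp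
    exact ⟨c • g, Submodule.smul_mem _ c hg⟩

/-- Pairs of sections which are locally in the `pairSpan`. -/
def LocallyPaired {V : Y.Opens} (ω : Γ(N, V)) (g : Γ(G, V)) : Prop :=
  ∀ y ∈ V, ∃ (W : Y.Opens) (h : W ≤ V), y ∈ W ∧ (res N h ω, res G h g) ∈ pairSpan η u φ W

variable {η u φ}

lemma LocallyPaired.res {V V' : Y.Opens} (h : V' ≤ V) {ω : Γ(N, V)} {g : Γ(G, V)}
    (H : LocallyPaired η u φ ω g) :
    LocallyPaired η u φ (LogBlowUp.res N h ω) (LogBlowUp.res G h g) := by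
  intro y hy
  obtain ⟨W, hW, hyW, hp⟩ := H y (h hy)
  refine ⟨W ⊓ V', inf_le_right, ⟨hyW, hy⟩, ?_⟩
  have := pairSpan_res η u φ (inf_le_left : W ⊓ V' ≤ W) hp
  simpa only [res_res] using this

lemma LocallyPaired.add {V : Y.Opens} {ω ω' : Γ(N, V)} {g g' : Γ(G, V)}
    (H : LocallyPaired η u φ ω g) (H' : LocallyPaired η u φ ω' g') :
    LocallyPaired η u φ (ω + ω') (g + g') := by
  intro y hy
  obtain ⟨W, hW, hyW, hp⟩ := H y hy
  obtain ⟨W', hW', hyW', hp'⟩ := H' y hy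
  refine ⟨W ⊓ W', inf_le_left.trans hW, ⟨hyW, hyW'⟩, ?_⟩
  have := add_mem (pairSpan_res η u φ (inf_le_left : W ⊓ W' ≤ W) hp)
    (pairSpan_res η u φ (inf_le_right : W ⊓ W' ≤ W') hp')
  simpa only [res_res, Prod.mk_add_mk, map_add] using this

lemma LocallyPaired.smul {V : Y.Opens} {ω : Γ(N, V)} {g : Γ(G, V)}
    (H : LocallyPaired η u φ ω g) (c : Γ(Y, V)) :
    LocallyPaired η u φ (c • ω) (c • g) := by
  intro y hy
  obtain ⟨W, hW, hyW, hp⟩ := H y hy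
  refine ⟨W, hW, hyW, ?_⟩
  have := Submodule.smul_mem _ (Y.presheaf.map (homOfLE hW).op c) hp
  simpa only [res_smul, Prod.smul_mk] using this

variable (η u φ)

/-- Locally there are no more relations between images of sections in `N` than in `G`. -/
def RelationsLocallyLift : Prop :=
  ∀ y : Y, ∃ W₀ : Y.Opens, y ∈ W₀ ∧ ∀ W ≤ W₀, ∀ g : Γ(G, W), (0, g) ∈ pairSpan η u φ W → g = 0

/-- `N` is locally generated by the images of the sections of `F`. -/
def LocallyGenerated : Prop :=
  ∀ (V : Y.Opens) (ω : Γ(N, V)), ∀ y ∈ V, ∃ (W : Y.Opens) (h : W ≤ V), y ∈ W ∧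
    res N h ω ∈ imageSpan η u W

variable {η u φ}

lemma LocallyPaired.eq_zero (h3 : RelationsLocallyLift η u φ) {V : Y.Opens} {g : Γ(G, V)}
    (H : LocallyPaired η u φ 0 g) : g = 0 := by
  refine LogBlowUp.eq_of_locally_eq G _ _ fun y hy => ?_
  obtain ⟨W, hW, hyW, hp⟩ := H y hy
  obtain ⟨W₀, hyW₀, h₀⟩ := h3 y
  refine ⟨W ⊓ W₀, inf_le_left.trans hW, ⟨hyW, hyW₀⟩, ?_⟩
  have := pairSpan_res η u φ (inf_le_left : W ⊓ W₀ ≤ W) hp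
  simp only [res_res, map_zero] at this
  simpa [LogBlowUp.res] using h₀ _ inf_le_right _ this

lemma LocallyPaired.unique (h3 : RelationsLocallyLift η u φ) {V : Y.Opens} {ω : Γ(N, V)}
    {g g' : Γ(G, V)} (H : LocallyPaired η u φ ω g) (H' : LocallyPaired η u φ ω g') : g = g' := by
  rw [← sub_eq_zero]
  refine LocallyPaired.eq_zero (u := u) (φ := φ) h3 ?_
  have := H.add (H'.smul (-1))
  simpa [← sub_eq_add_neg] using this

/-- Local partners exist by generation, and they glue because lifting of relations makes partners
unique on overlaps. -/
lemma LocallyGenerated.exists_paired (h2 : LocallyGenerated η u) (h3 : RelationsLocallyLift η u φ)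
    {V : Y.Opens} (ω : Γ(N, V)) : ∃ g : Γ(G, V), LocallyPaired η u φ ω g := by
  have h (y : V) := h2 V ω y.1 y.2
  choose W hW hy hs using h
  choose g hg using fun y => exists_pair η u φ (hs y)
  have key (y) : LocallyPaired η u φ (res N (hW y) ω) (g y) := fun z hz =>
    ⟨W y, le_rfl, hz, by simpa only [res_self] using hg y⟩
  obtain ⟨s, hs⟩ := exists_gluing G W hW hy g fun x y => by
    have h1 := (key x).res (inf_le_left : W x ⊓ W y ≤ W x)
    have h2 := (key y).res (inf_le_right : W x ⊓ W y ≤ W y)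
    rw [res_res] at h1 h2
    exact h1.unique h3 h2
  refine ⟨s, fun y hyV => ⟨W ⟨y, hyV⟩, hW _, hy _, ?_⟩⟩
  rw [hs]
  exact hg _

/-- A morphism of sheaves of modules from its action on sections. -/
def homMk (f : ∀ V : Y.Opens, Γ(N, V) → Γ(G, V)) (hadd : ∀ V x y, f V (x + y) = f V x + f V y)
    (hsmul : ∀ V (c : Γ(Y, V)) x, f V (c • x) = c • f V x)
    (hres : ∀ (W V : Y.Opens) (h : W ≤ V) x, f W (res N h x) = res G h (f V x)) : N ⟶ G where
  val := PresheafOfModules.homMk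
    { app V := AddCommGrpCat.ofHom (AddMonoidHom.mk' (f V.unop) (hadd V.unop))
      naturality V W i := by
        ext x
        exact hres W.unop V.unop i.unop.le x }
    (fun V r m => hsmul V.unop r m)

lemma hom_ext_of_locallyGenerated (h2 : LocallyGenerated η u) {ψ ψ' : N ⟶ G}
    (h : u ≫ (pushforward η).map ψ = u ≫ (pushforward η).map ψ') : ψ = ψ' := by
  refine Scheme.Modules.hom_ext _ _ fun V => ?_
  ext ω
  refine LogBlowUp.eq_of_locally_eq G _ _ fun y hy => ?_
  obtain ⟨W, hW, hyW, hs⟩ := h2 V ω y hy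
  refine ⟨W, hW, hyW, ?_⟩
  rw [← app_res, ← app_res]
  generalize res N hW ω = ω' at hs
  induction hs using Submodule.span_induction with
  | mem p hp =>
    obtain ⟨U, h', σ, rfl⟩ := hp
    have h1 := congr($(h).app U σ)
    exact (app_res ψ h' _).trans ((congrArg (res G h') h1).trans (app_res ψ' h' _).symm)
  | zero => simp
  | add p q _ _ hp hq => rw [map_add, map_add, hp, hq]
  | smul c p _ hp => rw [Hom.app_smul, Hom.app_smul, hp]

/-- `LocallyPaired` is the graph of the desired morphism: generation makes it total, lifting of
relations makes it single-valued. Additivity, linearity and compatibility with restriction then all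
follow from uniqueness. -/
lemma exists_factorization (h2 : LocallyGenerated η u) (h3 : RelationsLocallyLift η u φ) :
    ∃ ψ : N ⟶ G, u ≫ (pushforward η).map ψ = φ := by
  choose f hf using fun (V : Y.Opens) (ω : Γ(N, V)) => h2.exists_paired h3 ω
  refine ⟨homMk f (fun V x y => (hf V _).unique h3 ((hf V x).add (hf V y)))
    (fun V c x => (hf V _).unique h3 ((hf V x).smul c))
    (fun W V h x => (hf W _).unique h3 ((hf V x).res h)), ?_⟩
  refine Scheme.Modules.hom_ext _ _ fun U => ?_
  ext σ
  refine (hf (η ⁻¹ᵁ U) (u.app U σ)).unique h3 fun y hy => ⟨η ⁻¹ᵁ U, le_rfl, hy, ?_⟩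
  exact Submodule.subset_span ⟨U, le_rfl, σ, rfl⟩

/-- A criterion for a morphism `F ⟶ η_* N` to exhibit `N` as the pullback `η^* F`. -/
theorem nonempty_pullback_iso (h2 : LocallyGenerated η u)
    (h3 : ∀ (G : Y.Modules) (φ : F ⟶ (pushforward η).obj G), RelationsLocallyLift η u φ) :
    Nonempty ((pullback η).obj F ≅ N) := by
  let adj := pullbackPushforwardAdjunction η
  let c : (pullback η).obj F ⟶ N := (adj.homEquiv F N).symm u
  have hc : adj.unit.app F ≫ (pushforward η).map c = u := by
    exact (adj.homEquiv_unit _ _ c).symm.trans ((adj.homEquiv F N).apply_symm_apply u)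
  -- Factoring the unit of the adjunction through `u` yields the candidate inverse of `c`.
  obtain ⟨e, he⟩ := exists_factorization h2 (h3 _ (adj.unit.app F))
  refine ⟨c, e, ?_, ?_⟩
  · apply (adj.homEquiv F _).injective
    rw [adj.homEquiv_unit, adj.homEquiv_unit, Functor.map_comp, ← Category.assoc, hc, he]
    exact ((congrArg (adj.unit.app F ≫ ·) ((pushforward η).map_id _)).trans
      (Category.comp_id _)).symm
  · apply hom_ext_of_locallyGenerated (η := η) h2
    rw [Functor.map_comp, ← Category.assoc, he, hc]
    exact ((congrArg (u ≫ ·) ((pushforward η).map_id _)).trans (Category.comp_id _)).symm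

end PullbackCriterion

/-! ### Sections of lattice sheaves -/

section LatticeSections

variable {X : Scheme.{0}} [IsIntegral X] {M : Type} [AddCommGroup M] [Module X.functionField M]
  {L : ∀ x : X, Submodule (localRing X x) M}

/-- The value of a section of a lattice sheaf. -/
def val {U : X.Opens} (s : Γ(latticeSheaf L, U)) (x : U) : M :=
  (show latticeSections L U from s).1 x

lemma val_mem {U : X.Opens} (s : Γ(latticeSheaf L, U)) (x : U) : val s x ∈ L x.1 :=
  (show latticeSections L U from s).2.1 x

lemma val_eq {U : X.Opens} (s : Γ(latticeSheaf L, U)) (x y : U) : val s x = val s y :=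
  (show latticeSections L U from s).2.2 x y

/-- The section of a lattice sheaf given by an element of all the lattices. -/
def const (L : ∀ x : X, Submodule (localRing X x) M) (U : X.Opens) (m : M)
    (h : ∀ x ∈ U, m ∈ L x) : Γ(latticeSheaf L, U) :=
  show latticeSections L U from ⟨fun _ => m, fun x => h x.1 x.2, fun _ _ => rfl⟩

@[simp] lemma val_const (U : X.Opens) (m : M) (h : ∀ x ∈ U, m ∈ L x) (x : U) :
    val (const L U m h) x = m := rfl

lemma val_ext {U : X.Opens} {s t : Γ(latticeSheaf L, U)} (h : ∀ x, val s x = val t x) : s = t :=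
  Subtype.ext (funext h)

lemma val_ext_of_mem {U : X.Opens} {s t : Γ(latticeSheaf L, U)} (x : U) (h : val s x = val t x) :
    s = t :=
  val_ext fun y => by rw [val_eq s y x, val_eq t y x, h]

@[simp] lemma val_zero {U : X.Opens} (x : U) : val (0 : Γ(latticeSheaf L, U)) x = 0 := rfl

@[simp] lemma val_add {U : X.Opens} (s t : Γ(latticeSheaf L, U)) (x : U) :
    val (s + t) x = val s x + val t x := rfl

@[simp] lemma val_smul {U : X.Opens} (f : Γ(X, U)) (s : Γ(latticeSheaf L, U)) (x : U) :
    val (f • s) x = rationalValue x f • val s x := rfl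

@[simp] lemma val_res {U V : X.Opens} (h : V ≤ U) (s : Γ(latticeSheaf L, U)) (x : V) :
    val (res _ h s) x = val s ⟨x.1, h x.2⟩ := rfl

lemma rationalValue_res {U V : X.Opens} (h : V ≤ U) (x : V) (f : Γ(X, U)) :
    rationalValue x (X.presheaf.map (homOfLE h).op f) = rationalValue ⟨x.1, h x.2⟩ f :=
  rationalValue_map (homOfLE h) x f

lemma rationalValue_injective {U : X.Opens} (x : U) :
    Function.Injective (rationalValue (X := X) x) := by
  have : Nonempty U := ⟨x⟩
  intro f g h
  apply Scheme.germToFunctionField_injective X U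
  simp only [rationalValue, RingHom.comp_apply] at h
  erw [Scheme.algebraMap_germ_eq_germToFunctionField,
    Scheme.algebraMap_germ_eq_germToFunctionField] at h
  exact h

/-- A rational function which is regular at all points of `U` is a section of `𝒪_X` over `U`. -/
lemma exists_rationalValue_eq (U : X.Opens) (k : X.functionField)
    (h : ∀ x ∈ U, k ∈ localRing X x) : ∃ f : Γ(X, U), ∀ x : U, rationalValue x f = k := by
  have key (x : U) : ∃ (W : X.Opens) (hW : W ≤ U) (hx : x.1 ∈ W) (f : Γ(X, W)),
      rationalValue ⟨x.1, hx⟩ f = k := by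
    obtain ⟨a, ha⟩ := h x.1 x.2
    obtain ⟨W, hxW, f, rfl⟩ := X.presheaf.exists_germ_eq a
    refine ⟨W ⊓ U, inf_le_right, ⟨hxW, x.2⟩, X.presheaf.map (homOfLE inf_le_left).op f, ?_⟩
    rw [rationalValue_res]
    exact ha
  choose W hW hx f hf using key
  obtain ⟨s, hs, -⟩ := X.sheaf.existsUnique_gluing' W U (fun x => homOfLE (hW x))
    (fun y hy => Opens.mem_iSup.2 ⟨⟨y, hy⟩, hx ⟨y, hy⟩⟩) f (fun x y => by
      -- Both opens contain the generic point, so the local functions can be compared inside the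
      -- function field.
      have hg : genericPoint X ∈ W x ⊓ W y := by
        have := fun z : U => ((genericPoint_spec X).mem_open_set_iff (W z).isOpen).mpr
          (by simpa using ⟨z.1, hx z⟩)
        exact ⟨this x, this y⟩
      apply rationalValue_injective ⟨_, hg⟩
      exact (rationalValue_res inf_le_left ⟨_, hg⟩ (f x)).trans
        (((rationalValue_eq _ _ _).trans ((hf x).trans (hf y).symm)).trans
          ((rationalValue_eq _ _ _).trans (rationalValue_res inf_le_right ⟨_, hg⟩ (f y)).symm)))
  refine ⟨s, fun x => ?_⟩
  rw [← hf x, ← hs x]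
  exact (rationalValue_res (hW x) ⟨x.1, hx x⟩ s).symm

end LatticeSections

/-! ### Maps to a sheaf that become isomorphisms after sheafification -/

section Sheafification

universe v u v' u'

/-- The adjoint of `g` is the sheafification of `g` followed by the counit; the former is invertible
by `hg`, the latter because `F` is a sheaf. -/
lemma isIso_sheafificationAdjunction_homEquiv_symm {C : Type u'} [Category.{v'} C]
    {J : GrothendieckTopology C} [HasWeakSheafify J AddCommGrpCat.{v}] {P : Cᵒᵖ ⥤ AddCommGrpCat.{v}}
    {F : Sheaf J AddCommGrpCat.{v}} (g : P ⟶ F.obj) (hg : J.W g) :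
    IsIso (((sheafificationAdjunction J AddCommGrpCat.{v}).homEquiv P F).symm g) := by
  have := (GrothendieckTopology.W_iff _ _).1 hg
  have h : ((sheafificationAdjunction J AddCommGrpCat.{v}).homEquiv P F).symm g =
      (presheafToSheaf J _).map g ≫ (sheafificationAdjunction J AddCommGrpCat.{v}).counit.app F :=
    (sheafificationAdjunction J AddCommGrpCat.{v}).homEquiv_counit P F g
  rw [h]
  infer_instance

variable {C : Type u'} [Category.{v'} C] {J : GrothendieckTopology C}
  {R₀ : Cᵒᵖ ⥤ RingCat.{u}} {R : Sheaf J RingCat.{u}} (α : R₀ ⟶ R.obj)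
  [Presheaf.IsLocallyInjective J α] [Presheaf.IsLocallySurjective J α]
  [J.WEqualsLocallyBijective AddCommGrpCat.{v}] [HasWeakSheafify J AddCommGrpCat.{v}]

lemma isIso_sheafificationHomEquiv_symm {P : PresheafOfModules.{v} R₀}
    {F : SheafOfModules.{v} R}
    (g : P ⟶ (PresheafOfModules.restrictScalars α).obj ((SheafOfModules.forget _).obj F))
    (hg : J.W ((PresheafOfModules.toPresheaf R₀).map g)) :
    IsIso ((PresheafOfModules.sheafificationHomEquiv α).symm g) := by
  have h1 : IsIso ((SheafOfModules.toSheaf _).map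
      ((PresheafOfModules.sheafificationHomEquiv α).symm g)) := by
    rw [PresheafOfModules.toSheaf_map_sheafificationHomEquiv_symm]
    exact isIso_sheafificationAdjunction_homEquiv_symm (F := (SheafOfModules.toSheaf R).obj F) _ hg
  exact isIso_of_reflects_iso _ (SheafOfModules.toSheaf _)

end Sheafification

/-! ### Tensor product with an invertible fractional ideal -/

section Tensor

open Scheme.Modules MonoidalCategory

variable {X : Scheme.{0}} [IsIntegral X] {M : Type} [AddCommGroup M] [Module X.functionField M]
  (L : ∀ x : X, Submodule (localRing X x) M)
  (J : ∀ x : X, Submodule (localRing X x) X.functionField)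

/-- The product of a lattice and a fractional ideal. -/
def mulLattice (x : X) : Submodule (localRing X x) M :=
  Submodule.span _ {m | ∃ j ∈ J x, ∃ ω ∈ L x, m = j • ω}

variable {L J}

/-- The product of sections of a lattice sheaf and of a fractional ideal. -/
def mulSection {U : X.Opens} (s : Γ(latticeSheaf L, U)) (f : Γ(latticeSheaf J, U)) :
    Γ(latticeSheaf (mulLattice L J), U) :=
  show latticeSections (mulLattice L J) U from
    ⟨fun x => val f x • val s x,
      fun x => Submodule.subset_span ⟨_, val_mem f x, _, val_mem s x, rfl⟩,
      fun x y => congrArg₂ (· • ·) (val_eq f x y) (val_eq s x y)⟩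

@[simp] lemma val_mulSection {U : X.Opens} (s : Γ(latticeSheaf L, U)) (f : Γ(latticeSheaf J, U))
    (x : U) : val (mulSection s f) x = val f x • val s x := rfl

/-- Multiplication as a linear map on the tensor product of sections. -/
def mulLinear (U : X.Opens) :
    TensorProduct Γ(X, U) Γ(latticeSheaf L, U) Γ(latticeSheaf J, U) →ₗ[Γ(X, U)]
      Γ(latticeSheaf (mulLattice L J), U) :=
  TensorProduct.lift (LinearMap.mk₂ _ mulSection
    (fun s t f => val_ext fun x => smul_add ..)
    (fun a s f => val_ext fun x => by
      simp only [val_mulSection, val_smul]; rw [smul_comm])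
    (fun s f g => val_ext fun x => by simp [add_smul])
    (fun a s f => val_ext fun x => by simp [mul_smul]))

lemma mulLinear_tmul (U : X.Opens) (s : Γ(latticeSheaf L, U)) (f : Γ(latticeSheaf J, U)) :
    mulLinear U (s ⊗ₜ[Γ(X, U)] f) = mulSection s f := rfl

variable (L J) in
/-- The presheaf tensor product. -/
abbrev preTensor : PresheafOfModules X.ringCatSheaf.obj :=
  PresheafOfModules.Monoidal.tensorObj (R := X.presheaf) (latticeSheaf L).val (latticeSheaf J).val

lemma preTensor_map_tmul {U V : X.Opens} (h : V ≤ U) (s : Γ(latticeSheaf L, U))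
    (f : Γ(latticeSheaf J, U)) :
    ((preTensor L J).presheaf.map (homOfLE h).op
      (show TensorProduct Γ(X, U) Γ(latticeSheaf L, U) Γ(latticeSheaf J, U) from
        s ⊗ₜ[Γ(X, U)] f) : TensorProduct Γ(X, V) Γ(latticeSheaf L, V) Γ(latticeSheaf J, V)) =
      res _ h s ⊗ₜ[Γ(X, V)] res _ h f := rfl

variable (L J) in
/-- Multiplication as a morphism of presheaves of modules. -/
def mulHom : preTensor L J ⟶
    (PresheafOfModules.restrictScalars (𝟙 X.ringCatSheaf.obj)).obj
      (latticeSheaf (mulLattice L J)).val :=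
  PresheafOfModules.homMk
    { app U := AddCommGrpCat.ofHom (mulLinear (L := L) (J := J) U.unop).toAddMonoidHom
      naturality U V i := by
        refine AddCommGrpCat.hom_ext (AddMonoidHom.ext fun t => ?_)
        induction t using TensorProduct.induction_on with
        | zero => exact (AddMonoidHom.map_zero _).trans (AddMonoidHom.map_zero _).symm
        | add a b ha hb =>
          exact ((AddMonoidHom.map_add _ a b).trans (congrArg₂ (· + ·) ha hb)).trans
            (AddMonoidHom.map_add _ a b).symm
        | tmul s f => rfl }
    (fun U r m => (mulLinear U.unop).map_smul r m)

lemma mulHom_app (U : X.Opens)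
    (t : TensorProduct Γ(X, U) Γ(latticeSheaf L, U) Γ(latticeSheaf J, U)) :
    ((PresheafOfModules.toPresheaf _).map (mulHom L J)).app (op U) t = mulLinear U t := rfl

/-- The fractional ideal `J` is generated by one nonzero element near every point. -/
def IsLocallyPrincipal (J : ∀ x : X, Submodule (localRing X x) X.functionField) : Prop :=
  ∀ x : X, ∃ W : X.Opens, x ∈ W ∧ ∃ e : X.functionField, e ≠ 0 ∧
    ∀ x' ∈ W, J x' = Submodule.span _ {e}

/-- A section `f` of `J` over `W` is `c • e` with `c = f / e` regular, so `c` can be moved to the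
other factor. Every tensor thus becomes pure, with second factor `e`, once restricted to `W`. -/
lemma exists_tmul_eq {U W : X.Opens} (h : W ≤ U) (e : X.functionField) (he : e ≠ 0)
    (hJ : ∀ x ∈ W, J x = Submodule.span _ {e}) (he' : ∀ x ∈ W, e ∈ J x)
    (t : TensorProduct Γ(X, U) Γ(latticeSheaf L, U) Γ(latticeSheaf J, U)) :
    ∃ s : Γ(latticeSheaf L, W),
      ((preTensor L J).presheaf.map (homOfLE h).op t :
        TensorProduct Γ(X, W) Γ(latticeSheaf L, W) Γ(latticeSheaf J, W)) =
      s ⊗ₜ[Γ(X, W)] const J W e he' := by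
  induction t using TensorProduct.induction_on with
  | zero =>
    exact ⟨0, (AddMonoidHom.map_zero _).trans (TensorProduct.zero_tmul _ _).symm⟩
  | add a b ha hb =>
    obtain ⟨s, hs⟩ := ha
    obtain ⟨s', hs'⟩ := hb
    exact ⟨s + s', (AddMonoidHom.map_add _ a b).trans
      ((congrArg₂ (· + ·) hs hs').trans (TensorProduct.add_tmul _ _ _).symm)⟩
  | tmul s f =>
    obtain ⟨c, hc⟩ : ∃ c : Γ(X, W), res _ h f = c • const J W e he' := by
      by_cases hW : Nonempty W
      · obtain ⟨x₀⟩ := hW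
        obtain ⟨c, hc⟩ := exists_rationalValue_eq W (e⁻¹ * val f ⟨x₀.1, h x₀.2⟩) fun x hx => by
          have h1 := val_mem f ⟨x, h hx⟩
          rw [hJ x hx, Submodule.mem_span_singleton] at h1
          obtain ⟨a, ha⟩ := h1
          rw [val_eq f ⟨x₀.1, h x₀.2⟩ ⟨x, h hx⟩, ← ha]
          have : e⁻¹ * (a • e) = a.1 := by
            rw [Subring.smul_def, smul_eq_mul]
            field_simp
          rw [this]
          exact a.2
        refine ⟨c, val_ext_of_mem x₀ ?_⟩
        have : val f ⟨x₀.1, h x₀.2⟩ = (e⁻¹ * val f ⟨x₀.1, h x₀.2⟩) * e := by field_simp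
        exact this.trans (congrArg (· * e) (hc x₀).symm)
      · exact ⟨0, val_ext fun x => (hW ⟨x⟩).elim⟩
    refine ⟨c • res _ h s, (preTensor_map_tmul h s f).trans ?_⟩
    rw [hc, TensorProduct.tmul_smul, TensorProduct.smul_tmul']

/-- Where `e` generates `J`, tensors have the form `s ⊗ e` and multiplication sends them to `e • s`.
This is injective because `e ≠ 0`, and surjective because `e⁻¹ • ω` lies in `L` whenever `ω` lies in
the product lattice. -/
lemma mulHom_W (hJ : IsLocallyPrincipal J) :
    (Opens.grothendieckTopology X).W ((PresheafOfModules.toPresheaf _).map (mulHom L J)) := by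
  rw [GrothendieckTopology.W_iff_isLocallyBijective]
  constructor
  · refine ⟨fun {U} t t' htt' x hx => ?_⟩
    obtain ⟨W, hxW, e, he, hW⟩ := hJ x
    have hW' : ∀ y ∈ W ⊓ U.unop, J y = Submodule.span _ {e} := fun y hy => hW y hy.1
    have he' : ∀ y ∈ W ⊓ U.unop, e ∈ J y := fun y hy => by
      rw [hW' y hy]; exact Submodule.mem_span_singleton_self e
    refine ⟨W ⊓ U.unop, homOfLE inf_le_right, ?_, ⟨hxW, hx⟩⟩
    obtain ⟨s, hs⟩ := exists_tmul_eq (L := L) inf_le_right e he hW' he' t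
    obtain ⟨s', hs'⟩ := exists_tmul_eq (L := L) inf_le_right e he hW' he' t'
    refine hs.trans (Eq.trans ?_ hs'.symm)
    congr 1
    have h1 : mulLinear _ (s ⊗ₜ[Γ(X, W ⊓ U.unop)] const J _ e he') =
        mulLinear _ (s' ⊗ₜ[Γ(X, W ⊓ U.unop)] const J _ e he') := by
      rw [← hs, ← hs']
      have n := fun t => NatTrans.naturality_apply
        ((PresheafOfModules.toPresheaf _).map (mulHom L J))
        (homOfLE (inf_le_right : W ⊓ U.unop ≤ U.unop)).op t
      exact (n t).trans ((congrArg _ htt').trans (n t').symm)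
    refine val_ext fun y => ?_
    have h2 := congrArg (val · y) h1
    simp only [mulLinear_tmul, val_mulSection, val_const] at h2
    exact smul_right_injective _ he h2
  · refine ⟨fun {U} ω x hx => ?_⟩
    obtain ⟨W, hxW, e, he, hW⟩ := hJ x
    have hW' : ∀ y ∈ W ⊓ U, J y = Submodule.span _ {e} := fun y hy => hW y hy.1
    have he' : ∀ y ∈ W ⊓ U, e ∈ J y := fun y hy => by
      rw [hW' y hy]; exact Submodule.mem_span_singleton_self e
    let ω' : Γ(latticeSheaf (mulLattice L J), U) := ω
    have hmem : ∀ y ∈ W ⊓ U, e⁻¹ • val ω' ⟨x, hx⟩ ∈ L y := fun y hy => by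
      have h1 := val_mem ω' ⟨y, hy.2⟩
      rw [val_eq ω' ⟨y, hy.2⟩ ⟨x, hx⟩, mulLattice] at h1
      generalize val ω' ⟨x, hx⟩ = m₀ at h1 ⊢
      induction h1 using Submodule.span_induction with
      | mem m hm =>
        obtain ⟨j, hj, m, hm, rfl⟩ := hm
        rw [hW' y hy, Submodule.mem_span_singleton] at hj
        obtain ⟨a, rfl⟩ := hj
        have : e⁻¹ • (a • e) • m = a • m := by
          rw [Subring.smul_def, smul_smul, smul_eq_mul, mul_comm, mul_assoc, mul_inv_cancel₀ he,
            mul_one, Subring.smul_def]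
        rw [this]
        exact (L y).smul_mem a hm
      | zero => rw [smul_zero]; exact zero_mem _
      | add m m' _ _ hm hm' => rw [smul_add]; exact add_mem hm hm'
      | smul a m _ hm =>
        rw [Subring.smul_def, smul_comm, ← Subring.smul_def]; exact (L y).smul_mem a hm
    refine ⟨W ⊓ U, homOfLE inf_le_right, ?_, ⟨hxW, hx⟩⟩
    refine ⟨(const L _ _ hmem) ⊗ₜ[Γ(X, W ⊓ U)] const J _ e he', ?_⟩
    refine (mulHom_app (L := L) (J := J) (W ⊓ U) _).trans (val_ext (L := mulLattice L J) fun y => ?_)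
    have : val (mulLinear (L := L) (W ⊓ U)
      ((const L _ _ hmem) ⊗ₜ[Γ(X, W ⊓ U)] const J _ e he')) y = e • e⁻¹ • val ω' ⟨x, hx⟩ := rfl
    refine this.trans ?_
    rw [smul_smul, mul_inv_cancel₀ he, one_smul]
    exact val_eq ω' _ _

/-- The tensor product with an invertible fractional ideal is given by the product lattice. -/
theorem nonempty_tensorProduct_iso (hJ : IsLocallyPrincipal J) :
    Nonempty (tensorProduct (latticeSheaf L) (latticeSheaf J) ≅
      latticeSheaf (mulLattice L J)) := by
  have := isIso_sheafificationHomEquiv_symm (R := X.ringCatSheaf) (𝟙 X.ringCatSheaf.obj)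
    (P := preTensor L J) (F := latticeSheaf (mulLattice L J)) (mulHom L J) (mulHom_W hJ)
  have e := @asIso (SheafOfModules X.ringCatSheaf) _ _ _ _ this
  exact ⟨e.hom, e.inv, e.hom_inv_id, e.inv_hom_id⟩

end Tensor

/-! ### Stalks and inverse images of ideal sheaves -/

section IdealSheaves

variable {X Y : Scheme.{0}}

lemma map_germ_ideal_eq_of_le (I : X.IdealSheafData) (x : X) {U V : X.affineOpens} (h : U ≤ V)
    (hx : x ∈ U.1) : (I.ideal V).map (X.presheaf.germ V.1 x (h hx)).hom =
      (I.ideal U).map (X.presheaf.germ U.1 x hx).hom := by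
  rw [← I.map_ideal h, Ideal.map_map, ← CommRingCat.hom_comp]
  exact congrArg (fun φ => Ideal.map φ (I.ideal V))
    (congrArg CommRingCat.Hom.hom (X.presheaf.germ_res (homOfLE h) x hx).symm)

lemma exists_affineOpens_le {x : X} {U : X.Opens} (hx : x ∈ U) :
    ∃ V : X.affineOpens, V.1 ≤ U ∧ x ∈ V.1 := by
  obtain ⟨_, ⟨V, hV, rfl⟩, hxV, hVU⟩ :=
    X.isBasis_affineOpens.exists_subset_of_mem_open hx U.2
  exact ⟨⟨V, hV⟩, hVU, hxV⟩

/-- Passing to a smaller affine neighbourhood extends the ideal, so all terms of the supremum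
coincide. -/
lemma stalkIdeal_eq (I : X.IdealSheafData) (x : X) (U : X.affineOpens) (hx : x ∈ U.1) :
    stalkIdeal I x = (I.ideal U).map (X.presheaf.germ U.1 x hx).hom := by
  refine le_antisymm (iSup₂_le fun V hV => ?_) ?_
  · obtain ⟨W, hW, hxW⟩ := exists_affineOpens_le (show x ∈ U.1 ⊓ V.1 from ⟨hx, hV⟩)
    rw [map_germ_ideal_eq_of_le I x (show W ≤ V from hW.trans inf_le_right) hxW,
      map_germ_ideal_eq_of_le I x (show W ≤ U from hW.trans inf_le_left) hxW]
  · exact le_iSup₂_of_le (f := fun (U : X.affineOpens) (hx : x ∈ U.1) =>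
      (I.ideal U).map (X.presheaf.germ U.1 x hx).hom) U hx le_rfl

lemma eq_zero_of_germ_eq_zero {U : X.Opens} (a : Γ(X, U))
    (h : ∀ (x : X) (hx : x ∈ U), X.presheaf.germ U x hx a = 0) : a = 0 :=
  TopCat.Presheaf.section_ext X.sheaf U a 0 fun x hx => by
    erw [map_zero]; exact h x hx

lemma SpecMap_fromSpec_appLE {W : X.Opens} (hW : IsAffineOpen W) {R : CommRingCat.{0}}
    (q : Γ(X, W) ⟶ R) (h : ⊤ ≤ (Spec.map q ≫ hW.fromSpec) ⁻¹ᵁ W) :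
    (Spec.map q ≫ hW.fromSpec).appLE W ⊤ h = q ≫ (Scheme.ΓSpecIso R).inv := by
  rw [Scheme.Hom.comp_appLE, hW.fromSpec_app_self, Category.assoc,
    Scheme.ΓSpecIso_inv_naturality]
  exact congrArg (_ ≫ ·) ((Spec.map q).map_appLE (U' := ⊤) (V := ⊤)
    (show ⊤ ≤ Spec.map q ⁻¹ᵁ (hW.fromSpec ⁻¹ᵁ W) from h)
    (eqToHom hW.fromSpec_preimage_self).op)

/-- The inclusion `≥` holds since sections of `I` die on the subscheme cut out by `I.comap f`. For
`≤`, the test object is the spectrum of `Γ(X, W) ⧸ 𝔞`: its map `j` to `X` satisfies `I.comap f ≤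
j.ker` by adjunction, and a section over `W` killed by `j` lies in `𝔞`. -/
lemma ideal_comap (I : Y.IdealSheafData) (f : X ⟶ Y) (U : Y.affineOpens) (W : X.affineOpens)
    (e : W.1 ≤ f ⁻¹ᵁ U.1) :
    (I.comap f).ideal W = (I.ideal U).map (f.appLE U.1 W.1 e).hom := by
  set 𝔞 := (I.ideal U).map (f.appLE U.1 W.1 e).hom with h𝔞
  refine le_antisymm ?_ (Ideal.map_le_iff_le_comap.2 fun a ha => ?_)
  · let q : Γ(X, W.1) ⟶ CommRingCat.of (Γ(X, W.1) ⧸ 𝔞) := CommRingCat.ofHom (Ideal.Quotient.mk 𝔞)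
    let j := Spec.map q ≫ W.2.fromSpec
    have htop : (⊤ : (Spec _).Opens) ≤ j ⁻¹ᵁ W.1 := fun s _ => by
      have := W.2.range_fromSpec
      rw [Set.ext_iff] at this
      exact (this _).1 ⟨Spec.map q s, rfl⟩
    have hjW : j.appLE W.1 ⊤ htop = q ≫ (Scheme.ΓSpecIso _).inv := SpecMap_fromSpec_appLE W.2 q htop
    have hj : I.comap f ≤ j.ker := by
      rw [← Scheme.IdealSheafData.le_map_iff_comap_le, Scheme.IdealSheafData.map_ker]
      refine Scheme.IdealSheafData.le_ofIdeals_iff.2 fun V a ha => ?_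
      rw [RingHom.mem_ker]
      -- The affine open `V` need not be related to `U`; at the stalks both give the same ideal,
      -- generated by sections over `U`.
      refine eq_zero_of_germ_eq_zero _ fun s hs => ?_
      have hsU : (j ≫ f) s ∈ U.1 := e (htop trivial)
      erw [← Scheme.Hom.germ_stalkMap_apply]
      have h1 : Y.presheaf.germ V.1 ((j ≫ f) s) hs a ∈ stalkIdeal I ((j ≫ f) s) := by
        rw [stalkIdeal_eq I _ V hs]
        exact Ideal.mem_map_of_mem _ ha
      rw [stalkIdeal_eq I _ U hsU] at h1
      suffices h2 : (I.ideal U).map (Y.presheaf.germ U.1 ((j ≫ f) s) hsU).hom ≤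
          RingHom.ker ((j ≫ f).stalkMap s).hom from h2 h1
      rw [Ideal.map_le_iff_le_comap]
      intro b hb
      rw [Ideal.mem_comap, RingHom.mem_ker]
      erw [Scheme.Hom.germ_stalkMap_apply]
      have h3 : (j ≫ f).appLE U.1 ⊤ (fun s _ => e (htop trivial)) b = 0 := by
        rw [← Scheme.Hom.appLE_comp_appLE _ _ _ W.1 _ e htop, hjW]
        have : q (f.appLE U.1 W.1 e b) = 0 :=
          Ideal.Quotient.eq_zero_iff_mem.2 (Ideal.mem_map_of_mem _ hb)
        simp only [CommRingCat.comp_apply, this, map_zero]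
      have h4 : (Spec _).presheaf.germ ⊤ s trivial ((Spec _).presheaf.map (homOfLE _).op
          ((j ≫ f).app U.1 b)) = 0 := (congrArg _ h3).trans (map_zero _)
      exact (TopCat.Presheaf.germ_res_apply _ _ _ _ _).symm.trans h4
    refine fun a ha => ?_
    have h1 := Scheme.Hom.ideal_ker_le j W (hj W ha)
    rw [RingHom.mem_ker] at h1
    have h2 : j.appLE W.1 ⊤ htop a = 0 := by
      rw [Scheme.Hom.appLE, CommRingCat.comp_apply]
      erw [h1]
      exact map_zero _
    rw [hjW, CommRingCat.comp_apply] at h2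
    have h3 := congrArg (Scheme.ΓSpecIso _).hom h2
    rw [map_zero, ← CommRingCat.comp_apply, Iso.inv_hom_id] at h3
    exact Ideal.Quotient.eq_zero_iff_mem.1 h3
  · rw [Ideal.mem_comap, ← Scheme.IdealSheafData.ker_subschemeι_app, RingHom.mem_ker]
    have h1 := Scheme.Hom.ideal_ker_le _ U
      (Scheme.IdealSheafData.le_map_iff_comap_le.2 (le_refl (I.comap f)) U ha)
    rw [RingHom.mem_ker] at h1
    set ι := (I.comap f).subschemeι
    have h2 : (ι ≫ f).appLE U.1 (ι ⁻¹ᵁ W.1) (ι.preimage_mono e) a = 0 :=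
      (congrArg ((I.comap f).subscheme.presheaf.map (homOfLE _).op) h1).trans (map_zero _)
    rw [← Scheme.Hom.appLE_comp_appLE _ _ _ W.1 _ e le_rfl, CommRingCat.comp_apply] at h2
    rwa [Scheme.Hom.app_eq_appLE]

lemma stalkIdeal_comap (I : Y.IdealSheafData) (f : X ⟶ Y) (x : X) :
    stalkIdeal (I.comap f) x = (stalkIdeal I (f x)).map (f.stalkMap x).hom := by
  obtain ⟨U, -, hU⟩ := exists_affineOpens_le (show f x ∈ (⊤ : Y.Opens) from trivial)
  obtain ⟨W, hW, hxW⟩ := exists_affineOpens_le (show x ∈ f ⁻¹ᵁ U.1 from hU)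
  rw [stalkIdeal_eq _ x W hxW, stalkIdeal_eq _ (f x) U hU, ideal_comap I f U W hW, Ideal.map_map,
    Ideal.map_map, ← CommRingCat.hom_comp, ← CommRingCat.hom_comp, Scheme.Hom.germ_stalkMap,
    Scheme.Hom.appLE, Category.assoc, X.presheaf.germ_res]

lemma IsInvertibleIdeal.exists_stalkIdeal_eq {I : X.IdealSheafData} (hI : IsInvertibleIdeal I)
    (x : X) : ∃ f ∈ nonZeroDivisors (X.presheaf.stalk x), stalkIdeal I x = Ideal.span {f} := by
  obtain ⟨U, hx, f, hf, h⟩ := hI x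
  let := TopCat.Presheaf.algebra_section_stalk X.presheaf (U := U.1) ⟨x, hx⟩
  have : IsLocalization.AtPrime (X.presheaf.stalk x) (U.2.primeIdealOf ⟨x, hx⟩).asIdeal :=
    U.2.isLocalization_stalk ⟨x, hx⟩
  refine ⟨X.presheaf.germ U.1 x hx f, ?_, ?_⟩
  · exact IsLocalization.map_nonZeroDivisors_le (U.2.primeIdealOf ⟨x, hx⟩).asIdeal.primeCompl
      (X.presheaf.stalk x)
      (Submonoid.mem_map_of_mem (algebraMap Γ(X, U.1) (X.presheaf.stalk x)) hf)
  · rw [stalkIdeal_eq I x U hx, h, Ideal.map_span, Set.image_singleton]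

lemma isInvertibleIdeal_top : IsInvertibleIdeal (⊤ : X.IdealSheafData) := fun x => by
  obtain ⟨U, -, hU⟩ := exists_affineOpens_le (show x ∈ (⊤ : X.Opens) from trivial)
  exact ⟨U, hU, 1, one_mem _, by simp [Scheme.IdealSheafData.ideal_top]⟩

lemma comap_eq_top {I : Y.IdealSheafData} (f : X ⟶ Y) (h : ∀ x, f x ∉ I.support) :
    I.comap f = ⊤ := by
  rw [← Scheme.IdealSheafData.support_eq_bot_iff, Scheme.IdealSheafData.support_comap]
  ext x
  simpa using! h x

lemma fromSpecStalk_appLE {x : X} {U : X.Opens} (hx : x ∈ U)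
    (h : ⊤ ≤ (X.fromSpecStalk x) ⁻¹ᵁ U) :
    (X.fromSpecStalk x).appLE U ⊤ h =
      X.presheaf.germ U x hx ≫ (Scheme.ΓSpecIso (X.presheaf.stalk x)).inv := by
  rw [Scheme.Hom.appLE, Scheme.fromSpecStalk_app hx, Category.assoc, Category.assoc,
    ← Functor.map_comp]
  have : (homOfLE (le_top : (X.fromSpecStalk x) ⁻¹ᵁ U ≤ ⊤)).op ≫ (homOfLE h).op = 𝟙 (op ⊤) := rfl
  rw [this, CategoryTheory.Functor.map_id, Category.comp_id]

lemma top_le_fromSpecStalk_preimage {x : X} {U : X.Opens} (hx : x ∈ U) :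
    ⊤ ≤ (X.fromSpecStalk x) ⁻¹ᵁ U := fun s _ => by
  have : X.fromSpecStalk x s ∈ Set.range (X.fromSpecStalk x) := ⟨s, rfl⟩
  rw [Scheme.range_fromSpecStalk] at this
  exact (this : _ ⤳ x).mem_open U.2 hx

/-- Supplies the test schemes for the universal property of the blow-up: spectra of rings over a
local ring in which the center becomes principal. -/
lemma isInvertibleIdeal_comap_fromSpecStalk (I : X.IdealSheafData) (x : X) {R : CommRingCat.{0}}
    (α : X.presheaf.stalk x ⟶ R) {r : R} (hr : r ∈ nonZeroDivisors R)
    (h : (stalkIdeal I x).map α.hom = Ideal.span {r}) :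
    IsInvertibleIdeal (I.comap (Spec.map α ≫ X.fromSpecStalk x)) := fun s => by
  obtain ⟨U, -, hU⟩ := exists_affineOpens_le (show x ∈ (⊤ : X.Opens) from trivial)
  have e : (⊤ : (Spec R).Opens) ≤ (Spec.map α ≫ X.fromSpecStalk x) ⁻¹ᵁ U.1 :=
    fun s _ => top_le_fromSpecStalk_preimage hU trivial
  refine ⟨⟨⊤, isAffineOpen_top _⟩, trivial, (Scheme.ΓSpecIso R).inv r, ?_, ?_⟩
  · have := (MulEquivClass.map_nonZeroDivisors
      (Scheme.ΓSpecIso R).symm.commRingCatIsoToRingEquiv : _ = nonZeroDivisors Γ(Spec R, ⊤))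
    rw [← this]
    exact Submonoid.mem_map_of_mem _ hr
  · rw [ideal_comap I _ U _ e]
    have : (Spec.map α ≫ X.fromSpecStalk x).appLE U.1 ⊤ e =
        X.presheaf.germ U.1 x hU ≫ α ≫ (Scheme.ΓSpecIso R).inv := by
      rw [← Scheme.Hom.appLE_comp_appLE _ _ _ ⊤ _ (top_le_fromSpecStalk_preimage hU) le_top,
        fromSpecStalk_appLE hU, Category.assoc, Scheme.ΓSpecIso_inv_naturality]
      rw [Scheme.Hom.appTop, Scheme.Hom.app_eq_appLE]
      rfl
    rw [this, CommRingCat.hom_comp, CommRingCat.hom_comp, ← Ideal.map_map, ← Ideal.map_map,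
      ← stalkIdeal_eq I x U hU, h, Ideal.map_span, Set.image_singleton]

end IdealSheaves

/-! ### Consequences of the universal property of the blow-up -/

section BlowUp

variable {X Y : Scheme.{0}} {η : Y ⟶ X} {I : X.IdealSheafData}

/-- Off the center the ideal becomes the unit ideal, which is invertible, so the inclusion of `U`
lifts to `Y`. The uniqueness clause makes this lift a two-sided inverse. -/
lemma IsBlowUp.isIso_morphismRestrict (hη : IsBlowUp η I) (U : X.Opens)
    (hU : ∀ x ∈ U, x ∉ I.support) : IsIso (η ∣_ U) := by
  obtain ⟨h, hh, -⟩ := hη.universal U.ι (by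
    rw [comap_eq_top _ fun x => hU _ (Subtype.prop x)]; exact isInvertibleIdeal_top)
  have hr : Set.range h ⊆ Set.range (η ⁻¹ᵁ U).ι := by
    rintro _ ⟨x, rfl⟩
    rw [Scheme.Opens.range_ι]
    change η (h x) ∈ U
    rw [← Scheme.Hom.comp_apply, hh]
    exact x.2
  let h' : U.toScheme ⟶ (η ⁻¹ᵁ U).toScheme := IsOpenImmersion.lift (η ⁻¹ᵁ U).ι h hr
  have hh' : h' ≫ (η ⁻¹ᵁ U).ι = h := IsOpenImmersion.lift_fac _ _ _
  refine ⟨h', ?_, ?_⟩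
  · rw [← cancel_mono (η ⁻¹ᵁ U).ι, Category.assoc, hh', Category.id_comp]
    refine (hη.universal ((η ⁻¹ᵁ U).ι ≫ η) ?_).unique ?_ rfl
    · rw [comap_eq_top _ fun x => hU _ (Subtype.prop x)]; exact isInvertibleIdeal_top
    · rw [Category.assoc, hh, morphismRestrict_ι]
  · rw [← cancel_mono U.ι, Category.assoc, morphismRestrict_ι, ← Category.assoc, hh', hh,
      Category.id_comp]

/-- The universal property lifts `Spec R ⟶ X` to some `g : Spec R ⟶ Y`, and by uniqueness `Spec β`
followed by `g` is the canonical map from the spectrum of the stalk at `y`. As `β` is local, `g`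
sends the closed point to `y`; hence germs at `y` pull back to `R`, and `β` returns them unchanged.
-/
lemma IsBlowUp.surjective_of_stalkMap_eq (hη : IsBlowUp η I) (y : Y) {R : CommRingCat.{0}}
    [IsLocalRing R] (α : X.presheaf.stalk (η y) ⟶ R) (β : R ⟶ Y.presheaf.stalk y)
    [IsLocalHom β.hom] (h : α ≫ β = η.stalkMap y) {r : R} (hr : r ∈ nonZeroDivisors R)
    (hI : (stalkIdeal I (η y)).map α.hom = Ideal.span {r}) : Function.Surjective β := by
  obtain ⟨g, hg, -⟩ := hη.universal _ (isInvertibleIdeal_comap_fromSpecStalk I (η y) α hr hI)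
  obtain ⟨f, hf, hfI⟩ := hη.invertible.exists_stalkIdeal_eq y
  rw [stalkIdeal_comap] at hfI
  have hgβ : Spec.map β ≫ g = Y.fromSpecStalk y := by
    refine (hη.universal _ (isInvertibleIdeal_comap_fromSpecStalk I (η y) _ hf hfI)).unique ?_ ?_
    · rw [Category.assoc, hg, ← Category.assoc, ← Spec.map_comp, h]
    · rw [Scheme.SpecMap_stalkMap_fromSpecStalk]
  have hy : g (IsLocalRing.closedPoint R) = y := by
    have h1 : Spec.map β (IsLocalRing.closedPoint (Y.presheaf.stalk y)) =
        IsLocalRing.closedPoint R := IsLocalRing.comap_closedPoint β.hom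
    rw [← h1]
    change (Spec.map β ≫ g) _ = y
    rw [hgβ, Scheme.fromSpecStalk_closedPoint]
  intro t
  obtain ⟨V, hyV, s, rfl⟩ := Y.presheaf.exists_germ_eq t
  have hV : (⊤ : (Spec R).Opens) ≤ g ⁻¹ᵁ V :=
    (Scheme.preimage_eq_top_of_closedPoint_mem g (hy ▸ hyV)).ge
  refine ⟨(Scheme.ΓSpecIso R).hom (g.appLE V ⊤ hV s), ?_⟩
  have h1 : g.appLE V ⊤ hV ≫ (Spec.map β).appTop =
      Y.presheaf.germ V y hyV ≫ (Scheme.ΓSpecIso _).inv := by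
    rw [← fromSpecStalk_appLE hyV (top_le_fromSpecStalk_preimage hyV)]
    simp only [← hgβ]
    rw [← Scheme.Hom.appLE_comp_appLE _ _ _ ⊤ _ hV le_top, Scheme.Hom.appTop,
      Scheme.Hom.app_eq_appLE]
    rfl
  have h2 : g.appLE V ⊤ hV ≫ (Scheme.ΓSpecIso R).hom ≫ β = Y.presheaf.germ V y hyV := by
    rw [← Scheme.ΓSpecIso_naturality, ← Category.assoc, h1, Category.assoc, Iso.inv_hom_id,
      Category.comp_id]
  exact congr($h2 s)

end BlowUp

/-! ### Étale coordinates on smooth algebras -/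

section EtaleCoordinates

open MvPolynomial KaehlerDifferential

variable {k A : Type} [Field k] [CommRing A] [Algebra k A] {n : ℕ}

/-- The differentials of étale coordinates form a basis of the differentials. -/
lemma exists_basis_differentials [Algebra (MvPolynomial (Fin n) k) A]
    [IsScalarTower k (MvPolynomial (Fin n) k) A] [Algebra.FormallyEtale (MvPolynomial (Fin n) k) A]
    (T : Type) [CommRing T] [Algebra k T] [Algebra A T] [IsScalarTower k A T]
    [Algebra.FormallyEtale A T] :
    ∃ b : Module.Basis (Fin n) T (Ω[T⁄k]), ∀ i, b i =
      D k T (algebraMap A T (algebraMap (MvPolynomial (Fin n) k) A (X i))) := by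
  let : Algebra (MvPolynomial (Fin n) k) T :=
    ((algebraMap A T).comp (algebraMap (MvPolynomial (Fin n) k) A)).toAlgebra
  have : IsScalarTower (MvPolynomial (Fin n) k) A T := .of_algebraMap_eq fun _ => rfl
  have : IsScalarTower k (MvPolynomial (Fin n) k) T := .of_algebraMap_eq fun x => by
    rw [IsScalarTower.algebraMap_apply k A T,
      IsScalarTower.algebraMap_apply k (MvPolynomial (Fin n) k) A]
    rfl
  have : Algebra.FormallyEtale (MvPolynomial (Fin n) k) T := .comp _ A _
  refine ⟨((mvPolynomialBasis k (Fin n)).baseChange T).map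
    (tensorKaehlerEquivOfFormallyEtale k (MvPolynomial (Fin n) k) T), fun i => ?_⟩
  rw [Module.Basis.map_apply, Module.Basis.baseChange_apply]
  have : mvPolynomialBasis k (Fin n) i = D k _ (X i) := by
    have := mvPolynomialBasis_repr_symm_single k (Fin n) i 1
    rwa [one_smul] at this
  rw [this, tensorKaehlerEquivOfFormallyEtale_apply, mapBaseChange_tmul, one_smul, map_D]
  rfl

/-- Étale coordinates vanishing at a point generate its maximal ideal. -/
lemma span_coordinates_eq_maximalIdeal [Algebra (MvPolynomial (Fin n) k) A]
    [IsScalarTower k (MvPolynomial (Fin n) k) A] [Algebra.Etale (MvPolynomial (Fin n) k) A]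
    (m : Ideal A) [m.IsMaximal]
    (ht : ∀ i, algebraMap (MvPolynomial (Fin n) k) A (X i) ∈ m)
    (O : Type) [CommRing O] [Algebra A O] [IsLocalization.AtPrime O m] [IsLocalRing O] :
    Ideal.span (Set.range fun i =>
      algebraMap A O (algebraMap (MvPolynomial (Fin n) k) A (X i))) =
      IsLocalRing.maximalIdeal O := by
  -- The contraction of `m` contains all variables and, being proper, no nonzero constant, so it is
  -- the ideal of the origin.
  have hp : idealOfVars (Fin n) k = m.comap (algebraMap (MvPolynomial (Fin n) k) A) := by
    have hle : idealOfVars (Fin n) k ≤ m.comap (algebraMap (MvPolynomial (Fin n) k) A) := by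
      rw [idealOfVars, Ideal.span_le]
      rintro _ ⟨i, rfl⟩
      exact ht i
    refine hle.antisymm fun f hf => ?_
    have hf' : f - C (coeff 0 f) ∈ idealOfVars (Fin n) k := by
      rw [← pow_one (idealOfVars (Fin n) k), mem_pow_idealOfVars_iff']
      intro x hx
      rw [(Finsupp.degree_eq_zero_iff x).1 (by omega)]
      simp
    have h0 : C (coeff 0 f) ∈ m.comap (algebraMap (MvPolynomial (Fin n) k) A) := by
      have := sub_mem hf (hle hf')
      rwa [sub_sub_cancel] at this
    have h1 : coeff 0 f = 0 := by
      by_contra h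
      refine Ideal.IsPrime.ne_top (I := m.comap (algebraMap (MvPolynomial (Fin n) k) A))
        inferInstance (Ideal.eq_top_of_isUnit_mem _ h0 ?_)
      exact (isUnit_iff_ne_zero.2 h).map C
    rwa [h1, C_0, sub_zero] at hf'
  let p := m.comap (algebraMap (MvPolynomial (Fin n) k) A)
  have : m.LiesOver p := ⟨rfl⟩
  let := Localization.AtPrime.algebraOfLiesOver p m
  -- Unramifiedness: the maximal ideal of the origin generates the maximal ideal of the localization
  -- at `m`.
  have h1 := ((Algebra.isUnramifiedAt_iff_map_eq (MvPolynomial (Fin n) k) p m).1 inferInstance).2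
  let e : Localization.AtPrime m ≃ₐ[A] O := IsLocalization.algEquiv m.primeCompl _ _
  have h2 := congrArg (Ideal.map (e : Localization.AtPrime m →+* O)) h1
  have h3 : (Ideal.map (e : Localization.AtPrime m →+* O) (IsLocalRing.maximalIdeal _)).IsMaximal :=
    Ideal.map_isMaximal_of_equiv e
  rw [← IsLocalRing.eq_maximalIdeal h3, ← h2, Ideal.map_map, show p = _ from hp.symm, idealOfVars,
    Ideal.map_span, ← Set.range_comp]
  congr 2
  ext i
  change _ = e (algebraMap _ _ _)
  rw [IsScalarTower.algebraMap_apply (MvPolynomial (Fin n) k) A (Localization.AtPrime m),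
    e.commutes]

/-- In the polynomial ring, relations between the two variables are multiples of the Koszul
relation, because the variables are non-associated primes. By the equational criterion of flatness,
relations over `O` are combinations of these. -/
lemma koszul_of_flat (O : Type) [CommRing O] [Algebra (MvPolynomial (Fin 2) k) O]
    [Module.Flat (MvPolynomial (Fin 2) k) O] (u v : O)
    (h : u * algebraMap (MvPolynomial (Fin 2) k) O (X 0) =
      v * algebraMap (MvPolynomial (Fin 2) k) O (X 1)) :
    ∃ c : O, u = c * algebraMap (MvPolynomial (Fin 2) k) O (X 1) ∧
      v = c * algebraMap (MvPolynomial (Fin 2) k) O (X 0) := by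
  have h1 : ∑ i, (![X 0, - X 1] : Fin 2 → MvPolynomial (Fin 2) k) i • (![u, v] : Fin 2 → O) i
      = 0 := by
    simp [Fin.sum_univ_two, Algebra.smul_def]
    linear_combination h
  obtain ⟨l, a, y, h2, h3⟩ := Module.Flat.isTrivialRelation_of_sum_smul_eq_zero
    (f := (![X 0, - X 1] : Fin 2 → MvPolynomial (Fin 2) k)) (x := (![u, v] : Fin 2 → O)) h1
  have h4 (j) : ∃ c : MvPolynomial (Fin 2) k, a 0 j = c * X 1 ∧ a 1 j = c * X 0 := by
    have h5 := h3 j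
    simp only [Fin.sum_univ_two, Matrix.cons_val_zero, Matrix.cons_val_one] at h5
    have h6 : X 0 * a 0 j = X 1 * a 1 j := by linear_combination h5
    have h7 : (X 1 : MvPolynomial (Fin 2) k) ∣ a 0 j := by
      refine ((X_prime (R := k) (i := (1 : Fin 2))).dvd_or_dvd ⟨_, h6⟩).resolve_left fun h => ?_
      simp [X_dvd_X] at h
    obtain ⟨c, hc⟩ := h7
    refine ⟨c, by rw [hc, mul_comm], mul_left_cancel₀ (X_ne_zero 1) ?_⟩
    rw [← h6, hc]; ring
  choose c hc0 hc1 using h4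
  refine ⟨∑ j, c j • y j, ?_, ?_⟩
  · have : u = _ := h2 0
    rw [this, Finset.sum_mul]
    refine Finset.sum_congr rfl fun j _ => ?_
    rw [hc0, Algebra.smul_def, Algebra.smul_def, map_mul]; ring
  · have : v = _ := h2 1
    rw [this, Finset.sum_mul]
    refine Finset.sum_congr rfl fun j _ => ?_
    rw [hc1, Algebra.smul_def, Algebra.smul_def, map_mul]; ring

/-- A standard smooth algebra has étale coordinates centered at a given closed point. -/
lemma exists_etale_coordinates [IsAlgClosed k]
    [Algebra.IsStandardSmoothOfRelativeDimension n k A] (m : Ideal A) [m.IsMaximal] :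
    ∃ g : MvPolynomial (Fin n) k →ₐ[k] A, g.Etale ∧ ∀ i, g (X i) ∈ m := by
  obtain ⟨g, hg⟩ := Algebra.IsStandardSmoothOfRelativeDimension.exists_etale_mvPolynomial n k A
  have hft : Algebra.FiniteType k A := by
    have : Algebra.IsStandardSmooth k A :=
      Algebra.IsStandardSmoothOfRelativeDimension.isStandardSmooth n
    infer_instance
  let := Ideal.Quotient.field m
  have : Module.Finite k (A ⧸ m) := finite_of_finite_type_of_isJacobsonRing _ _
  have hb : Function.Bijective (algebraMap k (A ⧸ m)) :=
    IsAlgClosed.algebraMap_bijective_of_isIntegral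
  choose a ha using fun i => hb.2 (Ideal.Quotient.mk m (g (X i)))
  -- By the Nullstellensatz the residue field at `m` is `k`; translating by the values `a i` of the
  -- coordinates centers them at `m`.
  let e : MvPolynomial (Fin n) k ≃ₐ[k] MvPolynomial (Fin n) k :=
    AlgEquiv.ofAlgHom (aeval fun i => X i - C (a i)) (aeval fun i => X i + C (a i))
      (by ext i; simp) (by ext i; simp)
  refine ⟨g.comp e.toAlgHom, ?_, fun i => ?_⟩
  · have he : RingHom.Etale (e.toAlgHom : MvPolynomial (Fin n) k →+* MvPolynomial (Fin n) k) :=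
      RingHom.Etale.of_bijective (show Function.Bijective e from e.bijective)
    have hg' : RingHom.Etale (g : MvPolynomial (Fin n) k →+* A) := hg
    exact RingHom.Etale.stableUnderComposition _ _ he hg'
  · have h1 : g (e (X i)) = g (X i) - algebraMap k A (a i) := by
      simp [e, AlgEquiv.ofAlgHom, ← MvPolynomial.algebraMap_eq]
    change g (e (X i)) ∈ m
    rw [h1, ← Ideal.Quotient.eq, ← ha]
    rfl

end EtaleCoordinates

/-! ### Local coordinates on a smooth scheme -/

section Chart

open scoped KaehlerDifferential

section Structure

variable {X : Scheme.{0}}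

/-- The structure of `ℂ`-algebra on the sections of the structure sheaf of a `ℂ`-scheme. -/
def structureMap (s : X ⟶ SpecC) (U : X.Opens) : ℂ →+* Γ(X, U) :=
  (s.appLE ⊤ U le_top).hom.comp (Scheme.ΓSpecIso (CommRingCat.of ℂ)).inv.hom

lemma isStandardSmooth_structureMap (s : X ⟶ SpecC) {n : ℕ} (hs : SmoothOfRelativeDimension n s) (p : X) :
    ∃ V : X.Opens, p ∈ V ∧ IsAffineOpen V ∧
      (structureMap s V).IsStandardSmoothOfRelativeDimension n := by
  obtain ⟨U, hU, V, hV, hp, e, h⟩ := hs.exists_isStandardSmoothOfRelativeDimension p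
  have : Subsingleton SpecC := inferInstanceAs (Subsingleton (PrimeSpectrum ℂ))
  -- `Spec ℂ` is a single point, so its only nonempty open subset is everything.
  obtain rfl : U = ⊤ := by
    ext x
    simpa [Subsingleton.elim x (s p)] using e hp
  refine ⟨V, hp, hV, ?_⟩
  have h0 : (Scheme.ΓSpecIso (CommRingCat.of ℂ)).inv.hom.IsStandardSmoothOfRelativeDimension 0 :=
    .equiv (Scheme.ΓSpecIso (CommRingCat.of ℂ)).symm.commRingCatIsoToRingEquiv
  have := RingHom.IsStandardSmoothOfRelativeDimension.comp h h0
  rwa [add_zero] at this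

lemma exists_basis_stalk (s : X ⟶ SpecC) {n : ℕ} {V : X.Opens} (hV : IsAffineOpen V)
    (g : MvPolynomial (Fin n) ℂ →+* Γ(X, V)) (hg : g.comp MvPolynomial.C = structureMap s V)
    (hge : g.Etale) (x : V) [Algebra ℂ (X.presheaf.stalk x.1)]
    (hx : algebraMap ℂ (X.presheaf.stalk x.1) =
      (X.presheaf.germ V x.1 x.2).hom.comp (structureMap s V)) :
    ∃ b : Module.Basis (Fin n) (X.presheaf.stalk x.1) (Ω[X.presheaf.stalk x.1⁄ℂ]), ∀ i, b i =
      KaehlerDifferential.D ℂ _ (X.presheaf.germ V x.1 x.2 (g (.X i))) := by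
  let : Algebra ℂ Γ(X, V) := (structureMap s V).toAlgebra
  let : Algebra (MvPolynomial (Fin n) ℂ) Γ(X, V) := g.toAlgebra
  have : IsScalarTower ℂ (MvPolynomial (Fin n) ℂ) Γ(X, V) := .of_algebraMap_eq' hg.symm
  let := TopCat.Presheaf.algebra_section_stalk X.presheaf (U := V) x
  have : IsScalarTower ℂ Γ(X, V) (X.presheaf.stalk x.1) := .of_algebraMap_eq' hx
  have : Algebra.Etale (MvPolynomial (Fin n) ℂ) Γ(X, V) := hge
  have : IsLocalization.AtPrime (X.presheaf.stalk x.1) (hV.primeIdealOf x).asIdeal :=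
    hV.isLocalization_stalk x
  have : Algebra.FormallyEtale Γ(X, V) (X.presheaf.stalk x.1) :=
    .of_isLocalization (hV.primeIdealOf x).asIdeal.primeCompl
  exact exists_basis_differentials (k := ℂ) (A := Γ(X, V)) (X.presheaf.stalk x.1)

end Structure

variable {X : Scheme.{0}} [IsIntegral X] (s : X ⟶ SpecC)

lemma algebraMap_functionField_germ {U : X.Opens} (x : U) (f : Γ(X, U)) :
    algebraMap (X.presheaf.stalk x.1) X.functionField (X.presheaf.germ U x.1 x.2 f) =
      rationalValue x f := rfl

lemma rationalValue_genericPoint {U : X.Opens} (h : genericPoint X ∈ U) (x : U) (f : Γ(X, U)) :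
    rationalValue x f = X.presheaf.germ U (genericPoint X) h f := by
  have : Nonempty U := ⟨x⟩
  simp only [rationalValue, RingHom.comp_apply]
  erw [Scheme.algebraMap_germ_eq_germToFunctionField]

lemma genericPoint_mem {U : X.Opens} {x : X} (hx : x ∈ U) : genericPoint X ∈ U :=
  ((genericPoint_spec X).mem_open_set_iff U.isOpen).mpr (by simpa using ⟨x, hx⟩)

lemma algebraMap_functionField_eq {U : X.Opens} (x : U) (c : ℂ) :
    (functionFieldAlgebra s).algebraMap c = rationalValue x (structureMap s U c) := by
  rw [rationalValue_genericPoint (genericPoint_mem x.2)]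
  exact (X.presheaf.germ_res_apply (homOfLE (le_top : U ≤ ⊤)) _ (genericPoint_mem x.2) _).symm

/-- Local coordinates centered at `p`. -/
structure IsChart {n : ℕ} (p : X) (V : X.Opens) (t : Fin n → Γ(X, V)) : Prop where
  mem : p ∈ V
  span_eq : Ideal.span (Set.range fun i => X.presheaf.germ V p mem (t i)) =
    IsLocalRing.maximalIdeal (X.presheaf.stalk p)
  exists_d_eq : ∀ (x : V) (f : X.presheaf.stalk x.1), ∃ a : Fin n → X.presheaf.stalk x.1,
    d s (algebraMap _ X.functionField f) =
      ∑ i, algebraMap _ X.functionField (a i) • d s (rationalValue x (t i))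
  linearIndependent : ∀ x : V, LinearIndependent X.functionField fun i => d s (rationalValue x (t i))

lemma isChart_of_etale {n : ℕ} {V : X.Opens} (hV : IsAffineOpen V)
    (g : MvPolynomial (Fin n) ℂ →+* Γ(X, V)) (hg : g.comp MvPolynomial.C = structureMap s V)
    (hge : g.Etale) (p : V) [hp : (hV.primeIdealOf p).asIdeal.IsMaximal]
    (ht : ∀ i, g (.X i) ∈ (hV.primeIdealOf p).asIdeal) :
    IsChart s p.1 V fun i => g (.X i) := by
  have key (x : V) : ∀ f : X.presheaf.stalk x.1, ∃ a : Fin n → X.presheaf.stalk x.1,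
      d s (algebraMap _ X.functionField f) = ∑ i, algebraMap _ X.functionField (a i) •
        d s (rationalValue x (g (.X i))) := fun f => by
    let : Algebra ℂ (X.presheaf.stalk x.1) :=
      ((X.presheaf.germ V x.1 x.2).hom.comp (structureMap s V)).toAlgebra
    obtain ⟨b, hb⟩ := exists_basis_stalk s hV g hg hge x rfl
    let : Algebra ℂ X.functionField := functionFieldAlgebra s
    have : IsScalarTower ℂ (X.presheaf.stalk x.1) X.functionField :=
      .of_algebraMap_eq fun c => algebraMap_functionField_eq s x c
    refine ⟨b.repr (KaehlerDifferential.D ℂ _ f), ?_⟩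
    have h1 := congrArg (KaehlerDifferential.map ℂ ℂ (X.presheaf.stalk x.1) X.functionField)
      (b.sum_repr (KaehlerDifferential.D ℂ _ f))
    rw [KaehlerDifferential.map_D, map_sum] at h1
    refine h1.symm.trans (Finset.sum_congr rfl fun i _ => ?_)
    rw [map_smul, hb, KaehlerDifferential.map_D, ← algebraMap_smul X.functionField]
    rfl
  have hgen (x : V) (i) : rationalValue x (g (.X i)) =
      X.presheaf.germ V (genericPoint X) (genericPoint_mem p.2) (g (.X i)) :=
    rationalValue_genericPoint _ x _
  -- The function field is the stalk at the generic point, so the basis of differentials of stalks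
  -- applies there too.
  obtain ⟨b, hb⟩ : ∃ b : Module.Basis (Fin n) X.functionField (RationalForms s), ∀ i, b i =
      d s (X.presheaf.germ V (genericPoint X) (genericPoint_mem p.2) (g (.X i))) := by
    let : Algebra ℂ X.functionField := functionFieldAlgebra s
    exact exists_basis_stalk s hV g hg hge ⟨_, genericPoint_mem p.2⟩ (RingHom.ext fun c =>
      (algebraMap_functionField_eq s p c).trans
        (rationalValue_genericPoint (genericPoint_mem p.2) p _))
  have hb' (x : V) : (fun i => d s (rationalValue x (g (.X i)))) = b := by
    ext i
    rw [hgen, hb]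
  refine ⟨p.2, ?_, key, fun x => ?_⟩
  · let : Algebra ℂ Γ(X, V) := (structureMap s V).toAlgebra
    let : Algebra (MvPolynomial (Fin n) ℂ) Γ(X, V) := g.toAlgebra
    have : IsScalarTower ℂ (MvPolynomial (Fin n) ℂ) Γ(X, V) := .of_algebraMap_eq' hg.symm
    let := TopCat.Presheaf.algebra_section_stalk X.presheaf (U := V) p
    have : Algebra.Etale (MvPolynomial (Fin n) ℂ) Γ(X, V) := hge
    have : IsLocalization.AtPrime (X.presheaf.stalk p.1) (hV.primeIdealOf p).asIdeal :=
      hV.isLocalization_stalk p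
    exact span_coordinates_eq_maximalIdeal (k := ℂ) (hV.primeIdealOf p).asIdeal ht
      (X.presheaf.stalk p.1)
  · rw [hb']; exact b.linearIndependent

/-- Two local coordinates at `p` form a regular sequence. -/
def IsKoszulExact {R : Type} [CommRing R] (x y : R) : Prop :=
  ∀ u v : R, u * x = v * y → ∃ c, u = c * y ∧ v = c * x

/-- The local ring at `p` is flat over the polynomial ring through étale coordinates centered at
`p`, and Koszul exactness descends from the two variables. -/
lemma exists_chart (hs : SmoothOfRelativeDimension 2 s) (p : X) (hp : IsClosed {p}) :
    ∃ (V : X.Opens) (t : Fin 2 → Γ(X, V)) (h : IsChart s p V t),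
      IsKoszulExact (X.presheaf.germ V p h.mem (t 0)) (X.presheaf.germ V p h.mem (t 1)) := by
  obtain ⟨V, hp', hV, hVs⟩ := isStandardSmooth_structureMap s hs p
  let : Algebra ℂ Γ(X, V) := (structureMap s V).toAlgebra
  have : Algebra.IsStandardSmoothOfRelativeDimension 2 ℂ Γ(X, V) := hVs
  have hm : (hV.primeIdealOf ⟨p, hp'⟩).asIdeal.IsMaximal :=
    hV.primeIdealOf_isMaximal_of_isClosed ⟨p, hp'⟩ hp
  obtain ⟨g, hg, hgm⟩ := exists_etale_coordinates (k := ℂ) (n := 2)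
    (hV.primeIdealOf ⟨p, hp'⟩).asIdeal
  have hgC : (g : MvPolynomial (Fin 2) ℂ →+* Γ(X, V)).comp MvPolynomial.C = structureMap s V :=
    g.comp_algebraMap
  refine ⟨V, _, isChart_of_etale s hV (g : MvPolynomial (Fin 2) ℂ →+* Γ(X, V)) hgC hg ⟨p, hp'⟩ hgm,
    ?_⟩
  let : Algebra (MvPolynomial (Fin 2) ℂ) Γ(X, V) := RingHom.toAlgebra g
  let := TopCat.Presheaf.algebra_section_stalk X.presheaf (U := V) ⟨p, hp'⟩
  have : Algebra.Etale (MvPolynomial (Fin 2) ℂ) Γ(X, V) := hg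
  have : IsLocalization.AtPrime (X.presheaf.stalk p) (hV.primeIdealOf ⟨p, hp'⟩).asIdeal :=
    hV.isLocalization_stalk ⟨p, hp'⟩
  let : Algebra (MvPolynomial (Fin 2) ℂ) (X.presheaf.stalk p) :=
    ((algebraMap Γ(X, V) (X.presheaf.stalk p)).comp (algebraMap _ _)).toAlgebra
  have : IsScalarTower (MvPolynomial (Fin 2) ℂ) Γ(X, V) (X.presheaf.stalk p) :=
    .of_algebraMap_eq' rfl
  have : Module.Flat Γ(X, V) (X.presheaf.stalk p) :=
    IsLocalization.flat _ (hV.primeIdealOf ⟨p, hp'⟩).asIdeal.primeCompl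
  have : Module.Flat (MvPolynomial (Fin 2) ℂ) (X.presheaf.stalk p) :=
    .trans _ Γ(X, V) _
  exact fun u v h => koszul_of_flat (k := ℂ) (X.presheaf.stalk p) u v h

end Chart

/-! ### The blow-up is integral and birational -/

section Integral

variable {X Y : Scheme.{0}} {η : Y ⟶ X} {I : X.IdealSheafData}

lemma IsBlowUp.isIso_stalkMap (hη : IsBlowUp η I) (y : Y) (hy : η y ∉ I.support) :
    IsIso (η.stalkMap y) := by
  let U : X.Opens := I.support.compl
  have : IsIso (η ∣_ U) := hη.isIso_morphismRestrict U fun x hx => hx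
  have h (z : (η ⁻¹ᵁ U).toScheme) : IsIso ((η ∣_ U).stalkMap z) := inferInstance
  have e := morphismRestrictStalkMap η U ⟨y, hy⟩
  exact ((MorphismProperty.isomorphisms _).arrow_mk_iso_iff e).1
    (h ⟨y, hy⟩)

/-- On an affine neighbourhood, a section vanishing where the local equation `f` is invertible is
killed by a power of `f`, and `f` is a nonzerodivisor in the stalk. -/
lemma IsInvertibleIdeal.germ_eq_zero {I : Y.IdealSheafData} (hI : IsInvertibleIdeal I)
    {V : Y.Opens} (b : Γ(Y, V)) (y : Y) (hy : y ∈ V)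
    (hb : Y.presheaf.map (homOfLE (inf_le_left : V ⊓ I.support.compl ≤ V)).op b = 0) :
    Y.presheaf.germ V y hy b = 0 := by
  obtain ⟨U, hyU, f, hf, hfU⟩ := hI y
  have hgf : Y.presheaf.germ U.1 y hyU f ∈ nonZeroDivisors (Y.presheaf.stalk y) := by
    let := TopCat.Presheaf.algebra_section_stalk Y.presheaf (U := U.1) ⟨y, hyU⟩
    have : IsLocalization.AtPrime (Y.presheaf.stalk y) (U.2.primeIdealOf ⟨y, hyU⟩).asIdeal :=
      U.2.isLocalization_stalk ⟨y, hyU⟩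
    exact IsLocalization.map_nonZeroDivisors_le (U.2.primeIdealOf ⟨y, hyU⟩).asIdeal.primeCompl
      (Y.presheaf.stalk y)
      (Submonoid.mem_map_of_mem (algebraMap Γ(Y, U.1) (Y.presheaf.stalk y)) hf)
  obtain ⟨W, hW, hyW⟩ := exists_affineOpens_le (show y ∈ V ⊓ U.1 from ⟨hy, hyU⟩)
  let f' := Y.presheaf.map (homOfLE (hW.trans inf_le_right)).op f
  let b' := Y.presheaf.map (homOfLE (hW.trans inf_le_left)).op b
  have hf' : f' ∈ I.ideal W := by
    rw [← I.map_ideal (show W ≤ U from hW.trans inf_le_right)]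
    refine Ideal.mem_map_of_mem _ ?_
    rw [hfU]
    exact Ideal.mem_span_singleton_self f
  have hle : Y.basicOpen f' ≤ V ⊓ I.support.compl := fun z hz =>
    ⟨(hW (Y.basicOpen_le _ hz)).1, fun h => by
      have := (I.mem_support_iff_of_mem (Y.basicOpen_le _ hz)).1 h
      exact (Scheme.mem_zeroLocus_iff _ _ _).1 this f' hf' hz⟩
  obtain ⟨n, hn⟩ := exists_pow_mul_eq_zero_of_res_basicOpen_eq_zero_of_isAffineOpen Y W.2 b' f' (by
    have h1 := congrArg (Y.presheaf.map (homOfLE hle).op) hb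
    rw [map_zero, ← ConcreteCategory.comp_apply, ← Functor.map_comp] at h1
    change Y.presheaf.map (homOfLE _).op (Y.presheaf.map (homOfLE _).op b) = 0
    rw [← ConcreteCategory.comp_apply, ← Functor.map_comp]
    exact h1)
  have h2 := congrArg (Y.presheaf.germ W.1 y hyW) hn
  rw [map_mul, map_pow, map_zero] at h2
  have h3 : Y.presheaf.germ W.1 y hyW f' = Y.presheaf.germ U.1 y hyU f :=
    TopCat.Presheaf.germ_res_apply _ _ _ _ _
  have h4 : Y.presheaf.germ W.1 y hyW b' = Y.presheaf.germ V y hy b :=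
    TopCat.Presheaf.germ_res_apply _ _ _ _ _
  rw [h3, h4] at h2
  exact (mul_right_mem_nonZeroDivisors_eq_zero_iff (pow_mem hgf n)).1 ((mul_comm _ _).trans h2)

/-- Otherwise `1` would restrict to zero off the support, hence have zero germ at `y`. The
complement of the support is therefore dense. -/
lemma IsInvertibleIdeal.exists_mem_compl_support {I : Y.IdealSheafData} (hI : IsInvertibleIdeal I)
    {V : Y.Opens} (y : Y) (hy : y ∈ V) : ∃ z ∈ V, z ∉ I.support := by
  by_contra! h
  have h1 := hI.germ_eq_zero (1 : Γ(Y, V)) y hy (eq_zero_of_germ_eq_zero _ fun z hz =>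
    (hz.2 (h z hz.1)).elim)
  rw [map_one] at h1
  exact one_ne_zero h1

theorem IsBlowUp.isIntegral [IsIntegral X] (hη : IsBlowUp η I)
    (hI : genericPoint X ∉ I.support) : IsIntegral Y := by
  let U : X.Opens := I.support.compl
  have hU : genericPoint X ∈ U := hI
  have hsupp (y : Y) : y ∉ (I.comap η).support ↔ η y ∈ U := by
    rw [Scheme.IdealSheafData.support_comap]; rfl
  have := hη.isIso_morphismRestrict U fun x hx => hx
  have : Nonempty U.toScheme := ⟨⟨_, hU⟩⟩
  have : IsIntegral U.toScheme := isIntegral_of_isOpenImmersion U.ι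
  have : Nonempty (η ⁻¹ᵁ U).toScheme := ⟨inv (η ∣_ U) ⟨_, hU⟩⟩
  have hint : IsIntegral (η ⁻¹ᵁ U).toScheme := isIntegral_of_isOpenImmersion (η ∣_ U)
  -- A nilpotent section vanishes over `U`, where `η` is an isomorphism, and then everywhere since
  -- the exceptional ideal is invertible.
  have hred : IsReduced Y := by
    have (y : Y) : _root_.IsReduced (Y.presheaf.stalk y) := by
      refine ⟨fun a ha => ?_⟩
      obtain ⟨V, hy, b, rfl⟩ := Y.presheaf.exists_germ_eq a
      obtain ⟨n, hn⟩ := ha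
      rw [← map_pow, ← map_zero (Y.presheaf.germ V y hy).hom] at hn
      obtain ⟨W, hyW, i, j, hW⟩ := Y.presheaf.germ_eq y hy hy _ _ hn
      rw [map_zero, map_pow] at hW
      have h1 := hη.invertible.germ_eq_zero (Y.presheaf.map i.op b) y hyW
        (eq_zero_of_germ_eq_zero _ fun z hz => by
          have : _root_.IsReduced (Y.presheaf.stalk z) := by
            have := hη.isIso_stalkMap z ((hsupp z).1 hz.2)
            exact isReduced_of_injective (inv (η.stalkMap z)).hom
              (ConcreteCategory.bijective_of_isIso (inv (η.stalkMap z))).1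
          refine IsNilpotent.eq_zero ⟨n, ?_⟩
          rw [← map_pow, ← map_pow, hW, map_zero, map_zero])
      rw [← h1]
      exact (TopCat.Presheaf.germ_res_apply _ _ _ _ _).symm
    exact isReduced_of_isReduced_stalk Y
  have hirr : IrreducibleSpace Y := by
    have h1 : IsIrreducible (Set.range (η ⁻¹ᵁ U).ι) := by
      rw [← Set.image_univ]
      exact (irreducibleSpace_def _).1 inferInstance |>.image _ (η ⁻¹ᵁ U).ι.continuous.continuousOn
    rw [Scheme.Opens.range_ι] at h1
    -- The preimage of `U` is irreducible, being isomorphic to `U`, and dense.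
    have h2 : closure ((η ⁻¹ᵁ U : Y.Opens) : Set Y) = Set.univ := by
      refine Dense.closure_eq (dense_iff_inter_open.2 fun V hV hne => ?_)
      obtain ⟨y, hy⟩ := hne
      obtain ⟨z, hz, hz'⟩ := hη.invertible.exists_mem_compl_support (V := ⟨V, hV⟩) y hy
      exact ⟨z, hz, (hsupp z).1 hz'⟩
    exact (irreducibleSpace_def _).2 (show IsIrreducible Set.univ from h2 ▸ h1.closure)
  exact isIntegral_of_irreducibleSpace_of_isReduced Y

lemma IsBlowUp.map_genericPoint [IsIntegral X] [IsIntegral Y] (hη : IsBlowUp η I)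
    (hI : genericPoint X ∉ I.support) : η (genericPoint Y) = genericPoint X := by
  let U : X.Opens := I.support.compl
  have hU : genericPoint X ∈ U := hI
  have := hη.isIso_morphismRestrict U fun x hx => hx
  have : Nonempty U.toScheme := ⟨⟨_, hU⟩⟩
  have : IsIntegral U.toScheme := isIntegral_of_isOpenImmersion U.ι
  have : Nonempty (η ⁻¹ᵁ U).toScheme := ⟨inv (η ∣_ U) ⟨_, hU⟩⟩
  have hint : IsIntegral (η ⁻¹ᵁ U).toScheme := isIntegral_of_isOpenImmersion (η ∣_ U)
  rw [← genericPoint_eq_of_isOpenImmersion (η ⁻¹ᵁ U).ι, ← Scheme.Hom.comp_apply,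
    ← morphismRestrict_ι, Scheme.Hom.comp_apply, genericPoint_eq_of_isOpenImmersion,
    genericPoint_eq_of_isOpenImmersion]

end Integral

/-! ### The induced map of function fields -/

section FunctionField

variable {X Y : Scheme.{0}} [IsIntegral X] [IsIntegral Y] (η : Y ⟶ X)
  (hgen : η (genericPoint Y) = genericPoint X)

/-- The map of function fields induced by a dominant morphism. -/
def functionFieldMap : X.functionField →+* Y.functionField :=
  (X.presheaf.stalkSpecializes (specializes_of_eq hgen) ≫ η.stalkMap (genericPoint Y)).hom

lemma functionFieldMap_algebraMap (y : Y) (f : X.presheaf.stalk (η y)) :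
    functionFieldMap η hgen (algebraMap _ X.functionField f) =
      algebraMap _ Y.functionField (η.stalkMap y f) := by
  have h1 := η.stalkSpecializes_stalkMap _ _ ((genericPoint_spec Y).specializes (y := y) trivial)
  refine Eq.trans ?_ (congr($h1 f))
  exact congr($(X.presheaf.stalkSpecializes_comp (specializes_of_eq hgen)
    ((genericPoint_spec X).specializes (y := η y) trivial) =≫ η.stalkMap (genericPoint Y)) f)

lemma functionFieldMap_rationalValue {U : X.Opens} {W : Y.Opens} (h : W ≤ η ⁻¹ᵁ U) (y : W)
    (f : Γ(X, U)) : functionFieldMap η hgen (rationalValue ⟨η y.1, h y.2⟩ f) =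
      rationalValue y (η.appLE U W h f) := by
  refine (functionFieldMap_algebraMap η hgen y.1 _).trans ?_
  refine congrArg (algebraMap _ Y.functionField) ?_
  rw [η.germ_stalkMap_apply]
  exact (TopCat.Presheaf.germ_res_apply _ _ _ _ _).symm

lemma functionFieldMap_functionFieldAlgebra (s : X ⟶ SpecC) (c : ℂ) :
    functionFieldMap η hgen ((functionFieldAlgebra s).algebraMap c) =
      (functionFieldAlgebra (η ≫ s)).algebraMap c := by
  rw [algebraMap_functionField_eq s (U := ⊤) ⟨η (genericPoint Y), trivial⟩,
    algebraMap_functionField_eq (η ≫ s) (U := ⊤) ⟨genericPoint Y, trivial⟩]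
  refine (functionFieldMap_rationalValue η hgen (W := ⊤) le_top ⟨genericPoint Y, trivial⟩ _).trans ?_
  congr 1
  exact congr($(Scheme.Hom.appLE_comp_appLE η s ⊤ ⊤ ⊤ le_top le_top) _)

lemma IsBlowUp.bijective_functionFieldMap {I : X.IdealSheafData} (hη : IsBlowUp η I)
    (hI : genericPoint X ∉ I.support) : Function.Bijective (functionFieldMap η hgen) := by
  have := hη.isIso_stalkMap (genericPoint Y) (hgen ▸ hI)
  have : IsIso (X.presheaf.stalkSpecializes (specializes_of_eq hgen)) :=
    (X.presheaf.stalkCongr (Inseparable.of_eq hgen)).isIso_inv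
  exact ConcreteCategory.bijective_of_isIso
    (X.presheaf.stalkSpecializes (specializes_of_eq hgen) ≫ η.stalkMap (genericPoint Y))

end FunctionField

/-! ### Algebra of a local ring of the blow-up: the exceptional ideal is prime -/

section StalkAlgebra

open Polynomial

/-- In a local ring, one of two generators of a principal ideal generates it. -/
lemma span_pair_eq_span_singleton {S : Type} [CommRing S] [IsDomain S] [IsLocalRing S] {x y f : S}
    (hf : f ≠ 0) (h : Ideal.span {x, y} = Ideal.span {f}) :
    Ideal.span {x} = Ideal.span {f} ∨ Ideal.span {y} = Ideal.span {f} := by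
  obtain ⟨c, rfl⟩ := Ideal.mem_span_singleton.1 (h ▸ Ideal.subset_span (by simp) :
    x ∈ Ideal.span {f})
  obtain ⟨e, rfl⟩ := Ideal.mem_span_singleton.1 (h ▸ Ideal.subset_span (by simp) :
    y ∈ Ideal.span {f})
  obtain ⟨a, b, hab⟩ := Ideal.mem_span_pair.1 (h ▸ Ideal.mem_span_singleton_self f :
    f ∈ Ideal.span {f * c, f * e})
  have h1 : a * c + b * e = 1 := mul_left_cancel₀ hf (by linear_combination hab)
  rcases IsLocalRing.isUnit_or_isUnit_of_add_one h1 with hu | hu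
  · exact .inl (Ideal.span_singleton_mul_right_unit (isUnit_of_mul_isUnit_right hu) f)
  · exact .inr (Ideal.span_singleton_mul_right_unit (isUnit_of_mul_isUnit_right hu) f)

variable {O S : Type} [CommRing O] [CommRing S] (φ : O →+* S)
  {x y : O} {v : S}

/-- Koszul exactness makes `y` a nonzerodivisor modulo `x`. -/
lemma IsKoszulExact.dvd_of_dvd_mul_pow (hxy : IsKoszulExact x y) (n : ℕ) (a : O)
    (h : x ∣ a * y ^ n) : x ∣ a := by
  induction n with
  | zero => simpa using h
  | succ n ih =>
    obtain ⟨u, hu⟩ := h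
    obtain ⟨c, -, hc⟩ := hxy u (a * y ^ n) (by linear_combination -hu)
    exact ih ⟨c, by rw [hc, mul_comm]⟩

/-- A polynomial relation of `y / x` has its coefficients in `(x, y)`. -/
lemma coeff_mem_of_eval₂_eq_zero (hφ : Function.Injective φ)
    (hxy : IsKoszulExact x y) (hv : φ y = φ x * v) (n : ℕ) (a : ℕ → O)
    (h : ∑ i ∈ Finset.range (n + 1), φ (a i) * v ^ i = 0) :
    ∀ i ≤ n, a i ∈ Ideal.span {x, y} := by
  induction n generalizing a with
  | zero =>
    intro i hi
    obtain rfl : i = 0 := by omega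
    have : a 0 = 0 := hφ (by simpa using h)
    rw [this]; exact zero_mem _
  | succ n ih =>
    -- Multiplying the relation by `x ^ (n + 1)` clears denominators; every term but the leading one
    -- keeps a factor `x`.
    have h1 : x ∣ a (n + 1) * y ^ (n + 1) := by
      refine ⟨-∑ i ∈ Finset.range (n + 1), a i * y ^ i * x ^ (n - i), hφ ?_⟩
      have h2 := congrArg (φ x ^ (n + 1) * ·) h
      simp only [mul_zero] at h2
      rw [Finset.sum_range_succ, mul_add, Finset.mul_sum] at h2
      have h3 : ∑ i ∈ Finset.range (n + 1), φ x ^ (n + 1) * (φ (a i) * v ^ i) =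
          φ x * ∑ i ∈ Finset.range (n + 1), φ (a i * y ^ i * x ^ (n - i)) := by
        rw [Finset.mul_sum]
        refine Finset.sum_congr rfl fun i hi => ?_
        have : n + 1 = 1 + i + (n - i) := by have := Finset.mem_range.1 hi; omega
        rw [this, pow_add, pow_add, map_mul, map_mul, map_pow, map_pow, hv]
        ring
      rw [h3, ← map_sum] at h2
      rw [map_mul, map_mul, map_neg, map_pow, hv]
      linear_combination h2
    obtain ⟨c, hc⟩ := hxy.dvd_of_dvd_mul_pow _ _ h1
    -- With leading coefficient `x * c`, the identity `x v = y` turns the leading term into `c y v ^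
    -- n`, which is absorbed in degree `n`.
    have h4 := ih (fun i => if i = n then a n + c * y else a i) (by
      rw [Finset.sum_range_succ, Finset.sum_congr rfl fun i hi => by
        rw [if_neg (Finset.mem_range.1 hi).ne], if_pos rfl]
      rw [Finset.sum_range_succ, Finset.sum_range_succ, hc, map_mul] at h
      rw [map_add, map_mul, hv]
      linear_combination h)
    have hxm : x ∈ Ideal.span {x, y} := Ideal.subset_span (by simp)
    have hym : y ∈ Ideal.span {x, y} := Ideal.subset_span (by simp)
    intro i hi
    rcases hi.lt_or_eq with hi | rfl
    · have h5 := h4 i (by omega)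
      split_ifs at h5 with h6
      · subst h6
        simpa using sub_mem h5 (Ideal.mul_mem_left _ c hym)
      · exact h5
    · rw [hc]; exact Ideal.mul_mem_right _ _ hxm

lemma mem_map_C_of_eval₂_eq_zero (hφ : Function.Injective φ)
    (hxy : IsKoszulExact x y) (hv : φ y = φ x * v) (P : O[X]) (h : P.eval₂ φ v = 0) :
    P ∈ (Ideal.span {x, y}).map C := by
  rw [eval₂_eq_sum_range] at h
  rw [Ideal.mem_map_C_iff]
  intro i
  by_cases hi : i ≤ P.natDegree
  · exact coeff_mem_of_eval₂_eq_zero φ hφ hxy hv P.natDegree P.coeff h i hi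
  · rw [coeff_eq_zero_of_natDegree_lt (by omega)]; exact zero_mem _

lemma eval₂_mem_of_mem_map_C (hv : φ y = φ x * v) (P : O[X])
    (h : P ∈ (Ideal.span {x, y}).map C) : P.eval₂ φ v ∈ Ideal.span {φ x} := by
  have : (Ideal.span {x, y}).map C ≤ (Ideal.span {φ x}).comap (eval₂RingHom φ v) := by
    rw [Ideal.map_span, Ideal.span_le]
    rintro _ ⟨a, (rfl | rfl), rfl⟩
    · simp
    · simp [hv, Ideal.mem_span_singleton]
  exact this h

/-- The exceptional divisor of the blow-up of a regular sequence of coordinates is reduced. -/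
lemma isPrime_span_of_fractions [IsLocalRing O] [IsLocalRing S] [IsLocalHom φ]
    (hφ : Function.Injective φ)
    (hm : Ideal.span {x, y} = IsLocalRing.maximalIdeal O)
    (hxy : IsKoszulExact x y) (hv : φ y = φ x * v)
    (hS : ∀ g : S, ∃ b s : O[X], IsUnit (s.eval₂ φ v) ∧ g * s.eval₂ φ v = b.eval₂ φ v) :
    (Ideal.span {φ x}).IsPrime := by
  have hxm : x ∈ IsLocalRing.maximalIdeal O := hm ▸ Ideal.subset_span (by simp)
  have hnu : ¬ IsUnit (φ x) := fun h => hxm (isUnit_of_map_unit φ x h)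
  have hprime : ((Ideal.span {x, y}).map (C : O →+* O[X])).IsPrime := by
    rw [hm]; exact Ideal.isPrime_map_C_of_isPrime
  -- If `b(v) = x g` with `g = c(v) / s(v)`, then `b s - x c` vanishes at `v`, so its coefficients
  -- lie in `(x, y)`. The factor `s` is not in the prime ideal, because `s(v)` is a unit and `φ x`
  -- is not. Primality of `(φ x)` is thereby inherited from that of the extension of the maximal
  -- ideal to `O[X]`.
  have key (b : O[X]) : b.eval₂ φ v ∈ Ideal.span {φ x} → b ∈ (Ideal.span {x, y}).map C := by
    intro h
    obtain ⟨g, hg⟩ := Ideal.mem_span_singleton.1 h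
    obtain ⟨c, s, hs, hgs⟩ := hS g
    have h1 : b * s - C x * c ∈ (Ideal.span {x, y}).map C := by
      refine mem_map_C_of_eval₂_eq_zero φ hφ hxy hv _ ?_
      rw [eval₂_sub, eval₂_mul, eval₂_mul, eval₂_C]
      linear_combination (s.eval₂ φ v) * hg + φ x * hgs
    have h2 : b * s ∈ (Ideal.span {x, y}).map C := by
      have : C x * c ∈ (Ideal.span {x, y}).map C :=
        Ideal.mul_mem_right _ _ (Ideal.mem_map_of_mem _ (Ideal.subset_span (by simp)))
      simpa using add_mem h1 this
    refine (hprime.mem_or_mem h2).resolve_right fun h3 => hnu ?_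
    have h4 := eval₂_mem_of_mem_map_C φ hv s h3
    exact isUnit_of_dvd_unit (Ideal.mem_span_singleton.1 h4) hs
  refine ⟨by rwa [Ne, Ideal.span_singleton_eq_top], fun {g h} hgh => ?_⟩
  obtain ⟨b, s, hs, hg⟩ := hS g
  obtain ⟨b', s', hs', hh⟩ := hS h
  have h1 := key (b * b') (by
    rw [eval₂_mul, ← hg, ← hh]
    have : g * eval₂ φ v s * (h * eval₂ φ v s') = g * h * (eval₂ φ v s * eval₂ φ v s') := by ring
    rw [this]
    exact Ideal.mul_mem_right _ _ hgh)
  refine (hprime.mem_or_mem h1).imp (fun h2 => ?_) fun h2 => ?_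
  · have := eval₂_mem_of_mem_map_C φ hv b h2
    rw [← hg] at this
    exact (Ideal.mul_unit_mem_iff_mem _ hs).1 this
  · have := eval₂_mem_of_mem_map_C φ hv b' h2
    rw [← hh] at this
    exact (Ideal.mul_unit_mem_iff_mem _ hs').1 this

/-- The fractions `b(v) / s(v)` with `s(v)` a unit. -/
def fractionsSubring (v : S) : Subring S where
  carrier := {g | ∃ b s : O[X], IsUnit (s.eval₂ φ v) ∧ g * s.eval₂ φ v = b.eval₂ φ v}
  one_mem' := ⟨1, 1, by simp, by simp⟩
  zero_mem' := ⟨0, 1, by simp, by simp⟩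
  mul_mem' := by
    rintro g h ⟨b, s, hs, hg⟩ ⟨b', s', hs', hh⟩
    refine ⟨b * b', s * s', by rw [eval₂_mul]; exact hs.mul hs', ?_⟩
    rw [eval₂_mul, eval₂_mul, ← hg, ← hh]; ring
  add_mem' := by
    rintro g h ⟨b, s, hs, hg⟩ ⟨b', s', hs', hh⟩
    refine ⟨b * s' + b' * s, s * s', by rw [eval₂_mul]; exact hs.mul hs', ?_⟩
    rw [eval₂_mul, eval₂_add, eval₂_mul, eval₂_mul, ← hg, ← hh]; ring
  neg_mem' := by
    rintro g ⟨b, s, hs, hg⟩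
    refine ⟨-b, s, hs, ?_⟩
    rw [eval₂_neg, ← hg]; ring

end StalkAlgebra

/-! ### Generation of the local rings of the blow-up -/

section BlowUpStalk

variable {X Y : Scheme.{0}} [IsIntegral Y] {η : Y ⟶ X} {I : X.IdealSheafData}

/-- A subring of the local ring of a blow-up which contains the local ring of the base, in which
the center becomes principal, and which contains the inverses of its units, is everything. -/
lemma IsBlowUp.subring_eq_top (hη : IsBlowUp η I) (y : Y) (S : Subring (Y.presheaf.stalk y))
    (hS : ∀ f, η.stalkMap y f ∈ S) (hunit : ∀ a ∈ S, ∀ b, a * b = 1 → b ∈ S)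
    (r : X.presheaf.stalk (η y)) (hr : r ∈ stalkIdeal I (η y)) (hr0 : η.stalkMap y r ≠ 0)
    (hI : ∀ a ∈ stalkIdeal I (η y), ∃ c ∈ S, η.stalkMap y a = η.stalkMap y r * c) : S = ⊤ := by
  -- Stability under inverses makes the inclusion local, so `S` is itself a local ring to which the
  -- universal property applies.
  have hloc : IsLocalHom S.subtype := ⟨fun a ha => by
    obtain ⟨b, hb⟩ := isUnit_iff_exists_inv.1 ha
    exact isUnit_iff_exists_inv.2 ⟨⟨b, hunit _ a.2 b hb⟩, Subtype.ext hb⟩⟩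
  have : IsLocalRing S := RingHom.domain_isLocalRing S.subtype
  let α : X.presheaf.stalk (η y) ⟶ CommRingCat.of S :=
    CommRingCat.ofHom ((η.stalkMap y).hom.codRestrict S hS)
  let β : CommRingCat.of S ⟶ Y.presheaf.stalk y := CommRingCat.ofHom S.subtype
  have : IsLocalRing (CommRingCat.of S) := inferInstanceAs (IsLocalRing S)
  have : IsLocalHom β.hom := hloc
  have hsurj := hη.surjective_of_stalkMap_eq y α β rfl (r := α r)
    (mem_nonZeroDivisors_of_ne_zero fun h => hr0 (congrArg Subtype.val h)) (by
      refine le_antisymm (Ideal.map_le_iff_le_comap.2 fun a ha => ?_) ?_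
      · obtain ⟨c, hc, h⟩ := hI a ha
        exact Ideal.mem_span_singleton.2 ⟨⟨c, hc⟩, Subtype.ext h⟩
      · rw [Ideal.span_singleton_le_iff_mem]
        exact Ideal.mem_map_of_mem _ hr)
  refine eq_top_iff.2 fun g _ => ?_
  obtain ⟨a, rfl⟩ := hsurj g
  exact a.2

end BlowUpStalk

/-! ### Stalks of ideals of reduced closed subsets and exceptional curves -/

section StalkIdeals

open Scheme.IdealSheafData

variable {X Y : Scheme.{0}}

lemma stalkIdeal_eq_top {I : X.IdealSheafData} {x : X} (hx : x ∉ I.support) :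
    stalkIdeal I x = ⊤ := by
  obtain ⟨U, -, hU⟩ := exists_affineOpens_le (show x ∈ (⊤ : X.Opens) from trivial)
  rw [mem_support_iff_of_mem hU, Scheme.mem_zeroLocus_iff] at hx
  push Not at hx
  obtain ⟨f, hf, hx⟩ := hx
  rw [stalkIdeal_eq I x U hU]
  exact Ideal.eq_top_of_isUnit_mem _ (Ideal.mem_map_of_mem _ hf)
    ((X.mem_basicOpen f x hU).1 hx)

lemma stalkIdeal_mul (I J : X.IdealSheafData) (x : X) :
    stalkIdeal (I * J) x = stalkIdeal I x * stalkIdeal J x := by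
  obtain ⟨U, -, hU⟩ := exists_affineOpens_le (show x ∈ (⊤ : X.Opens) from trivial)
  rw [stalkIdeal_eq _ x U hU, stalkIdeal_eq _ x U hU, stalkIdeal_eq _ x U hU, ideal_mul,
    Pi.mul_apply, Ideal.map_mul]

lemma stalkIdeal_prod {κ : Type} (s : Finset κ) (I : κ → X.IdealSheafData) (x : X) :
    stalkIdeal (∏ j ∈ s, I j) x = ∏ j ∈ s, stalkIdeal (I j) x := by
  classical
  induction s using Finset.induction_on with
  | empty =>
    rw [Finset.prod_empty, Finset.prod_empty, Ideal.one_eq_top]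
    exact stalkIdeal_eq_top (show x ∉ (⊥ : Closeds X) from fun h => h)
  | insert a s ha ih => rw [Finset.prod_insert ha, Finset.prod_insert ha, stalkIdeal_mul, ih]

lemma stalkIdeal_radical (I : X.IdealSheafData) (x : X) :
    stalkIdeal I.radical x = (stalkIdeal I x).radical := by
  obtain ⟨U, -, hU⟩ := exists_affineOpens_le (show x ∈ (⊤ : X.Opens) from trivial)
  rw [stalkIdeal_eq _ x U hU, stalkIdeal_eq _ x U hU, radical_ideal]
  let := TopCat.Presheaf.algebra_section_stalk X.presheaf (U := U.1) ⟨x, hU⟩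
  have : IsLocalization.AtPrime (X.presheaf.stalk x) (U.2.primeIdealOf ⟨x, hU⟩).asIdeal :=
    U.2.isLocalization_stalk ⟨x, hU⟩
  exact IsLocalization.map_radical (U.2.primeIdealOf ⟨x, hU⟩).asIdeal.primeCompl
    (X.presheaf.stalk x) (I.ideal U)

lemma stalkIdeal_vanishingIdeal_congr {T T' : Closeds X} {x : X} {U : X.Opens} (hx : x ∈ U)
    (h : ∀ z ∈ U, z ∈ T ↔ z ∈ T') :
    stalkIdeal (vanishingIdeal T) x = stalkIdeal (vanishingIdeal T') x := by
  obtain ⟨V, hVU, hV⟩ := exists_affineOpens_le hx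
  rw [stalkIdeal_eq _ x V hV, stalkIdeal_eq _ x V hV]
  have hVa : IsAffineOpen V.1 := V.2
  have : hVa.fromSpec ⁻¹' (T : Set X) = hVa.fromSpec ⁻¹' (T' : Set X) := by
    ext z
    exact h _ (hVU (hVa.range_fromSpec.subset (Set.mem_range_self z)))
  exact congrArg (fun t => (PrimeSpectrum.vanishingIdeal t).map
    (X.presheaf.germ V.1 x hV).hom) this

lemma stalkIdeal_vanishingIdeal_eq_top {T : Closeds X} {x : X} (hx : x ∉ T) :
    stalkIdeal (vanishingIdeal T) x = ⊤ := by
  refine stalkIdeal_eq_top fun h => hx ?_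
  rw [← SetLike.mem_coe, coe_support_vanishingIdeal] at h
  exact h

lemma stalkIdeal_vanishingIdeal_eq_maximalIdeal {T : Closeds X} {x : X} {U : X.Opens} (hx : x ∈ U)
    (h : ∀ z ∈ U, z ∈ T ↔ z = x) :
    stalkIdeal (vanishingIdeal T) x = IsLocalRing.maximalIdeal (X.presheaf.stalk x) := by
  obtain ⟨V, hVU, hV⟩ := exists_affineOpens_le hx
  have hVa : IsAffineOpen V.1 := V.2
  have h1 : hVa.fromSpec ⁻¹' (T : Set X) =
      ({hVa.primeIdealOf ⟨x, hV⟩} : Set (PrimeSpectrum Γ(X, V.1))) := by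
    ext z
    have h2 : hVa.fromSpec z ∈ V.1 := hVa.range_fromSpec.subset (Set.mem_range_self z)
    refine (h _ (hVU h2)).trans ⟨fun h3 => hVa.fromSpec.isOpenEmbedding.injective ?_, fun h3 => ?_⟩
    · exact h3.trans (hVa.fromSpec_primeIdealOf ⟨x, hV⟩).symm
    · exact (congrArg hVa.fromSpec h3).trans (hVa.fromSpec_primeIdealOf ⟨x, hV⟩)
  let := TopCat.Presheaf.algebra_section_stalk X.presheaf (U := V.1) ⟨x, hV⟩
  have : IsLocalization.AtPrime (X.presheaf.stalk x) (hVa.primeIdealOf ⟨x, hV⟩).asIdeal :=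
    hVa.isLocalization_stalk ⟨x, hV⟩
  have h2 : (vanishingIdeal T).ideal V = (hVa.primeIdealOf ⟨x, hV⟩).asIdeal :=
    (congrArg PrimeSpectrum.vanishingIdeal h1).trans (PrimeSpectrum.vanishingIdeal_singleton _)
  rw [stalkIdeal_eq _ x V hV, h2]
  exact IsLocalization.AtPrime.map_eq_maximalIdeal (hVa.primeIdealOf ⟨x, hV⟩).asIdeal
    (X.presheaf.stalk x)

/-- The preimage is the support of the inverse image ideal, and the vanishing ideal of a support is
the radical. -/
lemma stalkIdeal_vanishingIdeal_preimage (η : Y ⟶ X) (T : Closeds X) (y : Y) :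
    stalkIdeal (vanishingIdeal (T.preimage η.continuous)) y =
      ((stalkIdeal (vanishingIdeal T) (η y)).map (η.stalkMap y).hom).radical := by
  have h1 : T.preimage η.continuous = ((vanishingIdeal T).comap η).support := by
    rw [support_comap]
    exact congrArg (Closeds.preimage · η.continuous)
      (SetLike.coe_injective (coe_support_vanishingIdeal T).symm)
  rw [h1, vanishingIdeal_support, stalkIdeal_radical, stalkIdeal_comap]

lemma isRadical_stalkIdeal_vanishingIdeal (T : Closeds X) (x : X) :
    (stalkIdeal (vanishingIdeal T) x).IsRadical := by
  have h1 : T = (vanishingIdeal T).support := SetLike.coe_injective (coe_support_vanishingIdeal T).symm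
  rw [h1, vanishingIdeal_support, stalkIdeal_radical]
  exact Ideal.radical_isRadical _

/-- An isomorphism of stalks carries radical ideals to radical ideals, so no radical has to be
taken. -/
lemma stalkIdeal_vanishingIdeal_preimage_of_isIso (η : Y ⟶ X) (T : Closeds X) (y : Y)
    [IsIso (η.stalkMap y)] :
    stalkIdeal (vanishingIdeal (T.preimage η.continuous)) y =
      (stalkIdeal (vanishingIdeal T) (η y)).map (η.stalkMap y).hom := by
  rw [stalkIdeal_vanishingIdeal_preimage, Ideal.radical_eq_iff]
  have hb := ConcreteCategory.bijective_of_isIso (η.stalkMap y)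
  rw [← Ideal.radical_eq_iff, ← Ideal.map_radical_of_surjective hb.2,
    (isRadical_stalkIdeal_vanishingIdeal T (η y)).radical]
  rw [(RingHom.injective_iff_ker_eq_bot (η.stalkMap y).hom).1 hb.1]
  exact bot_le

variable (η : Y ⟶ X) (Z : Finset X)

lemma strictTransform_eq (C : Closeds X) (hC : ∀ p ∈ Z, p ∉ C) :
    strictTransform η Z C = C.preimage η.continuous := by
  have h : (C : Set X) \ Z = C := Set.ext fun p =>
    ⟨fun h => h.1, fun h => ⟨h, fun hp => hC p hp h⟩⟩
  refine SetLike.coe_injective ?_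
  change closure (η ⁻¹' _) = _
  rw [h]
  exact (C.preimage η.continuous).isClosed.closure_eq

lemma stalkIdeal_vanishingIdeal_pointsClosed (hZ : ∀ p ∈ Z, IsClosed ({p} : Set X)) {p : X}
    (hp : p ∈ Z) : stalkIdeal (vanishingIdeal (pointsClosed Z hZ)) p =
      IsLocalRing.maximalIdeal (X.presheaf.stalk p) := by
  classical
  let T : Closeds X := pointsClosed (Z.erase p) fun q hq => hZ q (Finset.mem_of_mem_erase hq)
  refine stalkIdeal_vanishingIdeal_eq_maximalIdeal (U := T.compl)
    (show p ∉ ((Z.erase p : Finset X) : Set X) by simp) fun z hz => ?_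
  have hz' : z ∉ ((Z.erase p : Finset X) : Set X) := hz
  change z ∈ (Z : Set X) ↔ _
  rw [Finset.mem_coe, Finset.mem_erase] at hz'
  rw [Finset.mem_coe]
  constructor
  · intro h; by_contra h'; exact hz' ⟨h', h⟩
  · rintro rfl; exact hp

lemma stalkIdeal_divisorIdeal_of_notMem (hZ : ∀ p ∈ Z, IsClosed ({p} : Set X)) {y : Y}
    (hy : η y ∉ Z) : stalkIdeal (divisorIdeal (exceptional η Z hZ)) y = ⊤ := by
  rw [divisorIdeal, stalkIdeal_prod]
  refine (Finset.prod_eq_one fun q _ => ?_).trans Ideal.one_eq_top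
  rw [Ideal.one_eq_top]
  refine stalkIdeal_vanishingIdeal_eq_top fun h => hy ?_
  have : η y = q.1 := h
  exact this ▸ q.2

/-- Distinct exceptional curves are disjoint, so only one factor of the product is nontrivial at
`y`. -/
lemma stalkIdeal_divisorIdeal_of_mem (hZ : ∀ p ∈ Z, IsClosed ({p} : Set X)) {y : Y}
    (hy : η y ∈ Z) : stalkIdeal (divisorIdeal (exceptional η Z hZ)) y =
      stalkIdeal (vanishingIdeal (exceptional η Z hZ ⟨η y, hy⟩)) y := by
  rw [divisorIdeal, stalkIdeal_prod]
  refine Finset.prod_eq_single_of_mem _ (Finset.mem_univ _) fun q _ hq => ?_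
  rw [Ideal.one_eq_top]
  refine stalkIdeal_vanishingIdeal_eq_top fun h => hq ?_
  have : η y = q.1 := h
  exact Subtype.ext this.symm

/-- Removing the fibres over the other points of `Z` leaves a neighbourhood of `y` in which the
exceptional curve is the preimage of all of `Z`. -/
lemma stalkIdeal_exceptional (hZ : ∀ p ∈ Z, IsClosed ({p} : Set X)) {y : Y}
    (hy : η y ∈ Z) : stalkIdeal (vanishingIdeal (exceptional η Z hZ ⟨η y, hy⟩)) y =
      ((stalkIdeal (vanishingIdeal (pointsClosed Z hZ)) (η y)).map (η.stalkMap y).hom).radical := by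
  classical
  rw [← stalkIdeal_vanishingIdeal_preimage]
  let T : Closeds X := pointsClosed (Z.erase (η y)) fun q hq => hZ q (Finset.mem_of_mem_erase hq)
  refine stalkIdeal_vanishingIdeal_congr (U := η ⁻¹ᵁ T.compl)
    (show η y ∉ ((Z.erase (η y) : Finset X) : Set X) by simp) fun z hz => ?_
  have hz' : η z ∉ ((Z.erase (η y) : Finset X) : Set X) := hz
  change η z = η y ↔ η z ∈ (Z : Set X)
  rw [Finset.mem_coe, Finset.mem_erase] at hz'
  rw [Finset.mem_coe]
  constructor
  · intro h; rw [h]; exact hy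
  · intro h; by_contra h'; exact hz' ⟨h', h⟩

end StalkIdeals

/-! ### Coordinates on the blow-up above the center -/

section BlowUpCoordinates

open Scheme.IdealSheafData

lemma IsKoszulExact.symm {R : Type} [CommRing R] {x y : R} (h : IsKoszulExact x y) :
    IsKoszulExact y x := fun u v huv => by
  obtain ⟨c, hv, hu⟩ := h v u huv.symm
  exact ⟨c, hu, hv⟩

variable {X Y : Scheme.{0}} [IsIntegral X] {s : X ⟶ SpecC}

lemma d_zero : d s 0 = 0 := by
  let := functionFieldAlgebra s
  exact map_zero (KaehlerDifferential.D ℂ X.functionField)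

/-- At the generic point the maximal ideal is zero, so the coordinates and their differentials would
vanish, against linear independence. -/
lemma IsChart.ne_genericPoint {p : X} {V : X.Opens} {t : Fin 2 → Γ(X, V)} (h : IsChart s p V t) :
    p ≠ genericPoint X := by
  rintro rfl
  refine (h.linearIndependent ⟨_, h.mem⟩).ne_zero 0 ?_
  have h1 : X.presheaf.germ V (genericPoint X) h.mem (t 0) ∈ IsLocalRing.maximalIdeal _ := by
    rw [← h.span_eq]
    exact Ideal.subset_span ⟨0, rfl⟩
  have h2 : X.presheaf.germ V (genericPoint X) h.mem (t 0) = 0 := by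
    by_contra h3
    exact h1 (isUnit_iff_ne_zero.2 (show (_ : X.functionField) ≠ 0 from h3))
  rw [← algebraMap_functionField_germ, h2, map_zero, d_zero]

variable [IsIntegral Y] {η : Y ⟶ X}

lemma stalkMap_injective (hgen : η (genericPoint Y) = genericPoint X) (y : Y) :
     Function.Injective (η.stalkMap y) := fun a b hab => by
  apply IsFractionRing.injective (X.presheaf.stalk (η y)) X.functionField
  apply (functionFieldMap η hgen).injective
  rw [functionFieldMap_algebraMap, functionFieldMap_algebraMap, hab]

/-- Coordinates on the blow-up of a surface at a point `y` above the center. -/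
structure IsBlowUpChart (η : Y ⟶ X) (y : Y) (x₁ x₂ : X.presheaf.stalk (η y))
    (v : Y.presheaf.stalk y) : Prop where
  eq_mul : η.stalkMap y x₂ = η.stalkMap y x₁ * v
  isPrime : (Ideal.span {η.stalkMap y x₁}).IsPrime
  ne_zero : η.stalkMap y x₁ ≠ 0
  map_eq : (IsLocalRing.maximalIdeal (X.presheaf.stalk (η y))).map (η.stalkMap y).hom =
    Ideal.span {η.stalkMap y x₁}
  eq_top : ∀ S : Subring (Y.presheaf.stalk y), (∀ f, η.stalkMap y f ∈ S) → v ∈ S →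
    (∀ a ∈ S, ∀ b, a * b = 1 → b ∈ S) → S = ⊤

/-- A subring containing the stalk of `X`, `v` and inverses of its units already makes the center
principal, so it is everything. Applied to the fractions `b(v) / s(v)`, this writes each element of
the stalk as such a fraction, whence primality. -/
lemma isBlowUpChart_of_span_eq (hgen : η (genericPoint Y) = genericPoint X)
    {I : X.IdealSheafData} (hη : IsBlowUp η I) {y : Y}
    {x₁ x₂ : X.presheaf.stalk (η y)}
    (hI : stalkIdeal I (η y) = IsLocalRing.maximalIdeal (X.presheaf.stalk (η y)))
    (hm : Ideal.span {x₁, x₂} = IsLocalRing.maximalIdeal (X.presheaf.stalk (η y)))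
    (hx : IsKoszulExact x₁ x₂) (h0 : η.stalkMap y x₁ ≠ 0)
    (h1 : Ideal.span {η.stalkMap y x₁, η.stalkMap y x₂} = Ideal.span {η.stalkMap y x₁}) :
    ∃ v, IsBlowUpChart η y x₁ x₂ v := by
  obtain ⟨v, hv⟩ := Ideal.mem_span_singleton.1 (h1 ▸ Ideal.subset_span (by simp) :
    η.stalkMap y x₂ ∈ Ideal.span {η.stalkMap y x₁})
  have hmap : (IsLocalRing.maximalIdeal (X.presheaf.stalk (η y))).map (η.stalkMap y).hom =
      Ideal.span {η.stalkMap y x₁} := by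
    rw [← h1, ← hm, Ideal.map_span, Set.image_pair]
  have htop (S : Subring (Y.presheaf.stalk y)) (hS : ∀ f, η.stalkMap y f ∈ S) (hvS : v ∈ S)
      (hunit : ∀ a ∈ S, ∀ b, a * b = 1 → b ∈ S) : S = ⊤ := by
    refine hη.subring_eq_top y S hS hunit x₁ ?_ h0 fun a ha => ?_
    · rw [hI, ← hm]; exact Ideal.subset_span (by simp)
    · rw [hI, ← hm] at ha
      obtain ⟨b, c, rfl⟩ := Ideal.mem_span_pair.1 ha
      refine ⟨η.stalkMap y b + η.stalkMap y c * v, S.add_mem (hS _) (S.mul_mem (hS _) hvS), ?_⟩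
      rw [map_add, map_mul, map_mul, hv]
      ring
  refine ⟨v, hv, ?_, h0, hmap, htop⟩
  refine isPrime_span_of_fractions (η.stalkMap y).hom (stalkMap_injective hgen y) hm hx hv ?_
  · have := htop (fractionsSubring (η.stalkMap y).hom v)
      (fun f => ⟨.C f, 1, by simp, by simp⟩) ⟨.X, 1, by simp, by simp⟩
      (fun a ⟨b, c, hc, h⟩ a' ha => ⟨c, b, h ▸ (isUnit_iff_exists_inv.2 ⟨a', ha⟩).mul hc, by
        rw [← h]; linear_combination (c.eval₂ (η.stalkMap y).hom v) * ha⟩)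
    intro g
    have hg : g ∈ fractionsSubring (η.stalkMap y).hom v := this ▸ Subring.mem_top g
    exact hg

/-- The maximal ideal at `η y` becomes principal in a local domain, so one of its two generators
generates the extension; `i` is the index of that coordinate. -/
lemma IsChart.exists_isBlowUpChart (hgen : η (genericPoint Y) = genericPoint X)
    {I : X.IdealSheafData} (hη : IsBlowUp η I) {y : Y}
    (hI : stalkIdeal I (η y) = IsLocalRing.maximalIdeal (X.presheaf.stalk (η y)))
    {V : X.Opens} {t : Fin 2 → Γ(X, V)} (h : IsChart s (η y) V t)
    (hx : IsKoszulExact (X.presheaf.germ V (η y) h.mem (t 0))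
      (X.presheaf.germ V (η y) h.mem (t 1))) :
    ∃ (i j : Fin 2) (v : _), i ≠ j ∧ IsBlowUpChart η y (X.presheaf.germ V (η y) h.mem (t i))
      (X.presheaf.germ V (η y) h.mem (t j)) v := by
  set x := fun i => X.presheaf.germ V (η y) h.mem (t i) with hx'
  have hm : Ideal.span {x 0, x 1} = IsLocalRing.maximalIdeal (X.presheaf.stalk (η y)) := by
    rw [← h.span_eq]
    congr 1
    ext z
    simp [x, eq_comm]
  obtain ⟨f, hf, hfI⟩ := hη.invertible.exists_stalkIdeal_eq y
  rw [stalkIdeal_comap, hI, ← hm, Ideal.map_span, Set.image_pair] at hfI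
  have hf0 : f ≠ 0 := nonZeroDivisors.ne_zero hf
  rcases span_pair_eq_span_singleton hf0 hfI with h1 | h1
  · have h0 : η.stalkMap y (x 0) ≠ 0 := fun h2 => hf0 (by
      erw [h2] at h1
      rw [← Ideal.span_singleton_eq_bot, ← h1, Ideal.span_singleton_eq_bot])
    obtain ⟨v, hv⟩ := isBlowUpChart_of_span_eq hgen hη hI hm hx h0 (hfI.trans h1.symm)
    exact ⟨0, 1, v, by simp, hv⟩
  · have h0 : η.stalkMap y (x 1) ≠ 0 := fun h2 => hf0 (by
      erw [h2] at h1
      rw [← Ideal.span_singleton_eq_bot, ← h1, Ideal.span_singleton_eq_bot])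
    obtain ⟨v, hv⟩ := isBlowUpChart_of_span_eq hgen hη hI ((Ideal.span_pair_comm ..).trans hm)
      hx.symm h0 (((Ideal.span_pair_comm ..).trans hfI).trans h1.symm)
    exact ⟨1, 0, v, by simp, hv⟩

end BlowUpCoordinates

/-! ### Pullback of rational forms -/

section Forms

open Scheme.IdealSheafData

variable {X Y : Scheme.{0}} [IsIntegral X] [IsIntegral Y] (s : X ⟶ SpecC)

lemma d_add (f g : X.functionField) : d s (f + g) = d s f + d s g := by
  let := functionFieldAlgebra s
  exact map_add (KaehlerDifferential.D ℂ X.functionField) f g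

lemma d_neg (f : X.functionField) : d s (-f) = -d s f := by
  let := functionFieldAlgebra s
  exact map_neg (KaehlerDifferential.D ℂ X.functionField) f

lemma d_mul (f g : X.functionField) : d s (f * g) = f • d s g + g • d s f := by
  let := functionFieldAlgebra s
  exact Derivation.leibniz (KaehlerDifferential.D ℂ X.functionField) f g

lemma d_one : d s (1 : X.functionField) = 0 := by
  let := functionFieldAlgebra s
  exact Derivation.map_one_eq_zero (KaehlerDifferential.D ℂ X.functionField)

lemma span_range_d : Submodule.span X.functionField (Set.range (d s)) = ⊤ := by
  let := functionFieldAlgebra s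
  exact KaehlerDifferential.span_range_derivation ℂ X.functionField

lemma d_of_mul_eq_one {f g : X.functionField} (h : f * g = 1) : d s g = -(g * g) • d s f := by
  have h1 := congrArg (d s) h
  rw [d_mul, d_one] at h1
  have h2 := congrArg (g • ·) h1
  simp only [smul_add, smul_smul, smul_zero] at h2
  rw [mul_comm g f, h, one_smul] at h2
  rw [neg_smul]
  exact eq_neg_of_add_eq_zero_left h2

lemma dlog_mul {f g : X.functionField} (hf : f ≠ 0) (hg : g ≠ 0) :
    dlog s (f * g) = dlog s f + dlog s g := by
  simp only [dlog, d_mul, smul_add, smul_smul]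
  rw [add_comm]
  congr 2
  · field_simp
  · field_simp

variable (η : Y ⟶ X) (hgen : η (genericPoint Y) = genericPoint X)

/-- The map of rational forms induced by a dominant morphism. -/
def formsMap : RationalForms s →+ RationalForms (η ≫ s) :=
  letI := functionFieldAlgebra s
  letI := functionFieldAlgebra (η ≫ s)
  letI := (functionFieldMap η hgen).toAlgebra
  haveI : IsScalarTower ℂ X.functionField Y.functionField :=
    .of_algebraMap_eq fun c => (functionFieldMap_functionFieldAlgebra η hgen s c).symm
  (KaehlerDifferential.map ℂ ℂ X.functionField Y.functionField).toAddMonoidHom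

lemma formsMap_smul (k : X.functionField) (ω : RationalForms s) :
    formsMap s η hgen (k • ω) = functionFieldMap η hgen k • formsMap s η hgen ω := by
  let := functionFieldAlgebra s
  let := functionFieldAlgebra (η ≫ s)
  let := (functionFieldMap η hgen).toAlgebra
  have : IsScalarTower ℂ X.functionField Y.functionField :=
    .of_algebraMap_eq fun c => (functionFieldMap_functionFieldAlgebra η hgen s c).symm
  exact ((KaehlerDifferential.map ℂ ℂ X.functionField Y.functionField).map_smul k ω).trans
    (algebraMap_smul Y.functionField k _).symm

lemma formsMap_d (f : X.functionField) :
    formsMap s η hgen (d s f) = d (η ≫ s) (functionFieldMap η hgen f) := by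
  let := functionFieldAlgebra s
  let := functionFieldAlgebra (η ≫ s)
  let := (functionFieldMap η hgen).toAlgebra
  have : IsScalarTower ℂ X.functionField Y.functionField :=
    .of_algebraMap_eq fun c => (functionFieldMap_functionFieldAlgebra η hgen s c).symm
  exact KaehlerDifferential.map_D ℂ ℂ X.functionField Y.functionField f

lemma formsMap_dlog (f : X.functionField) :
    formsMap s η hgen (dlog s f) = dlog (η ≫ s) (functionFieldMap η hgen f) := by
  rw [dlog, formsMap_smul, formsMap_d, map_inv₀, dlog]

lemma formsMap_surjective (hb : Function.Bijective (functionFieldMap η hgen)) :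
    Function.Surjective (formsMap s η hgen) := by
  intro ω
  have hω : ω ∈ Submodule.span Y.functionField (Set.range (d (η ≫ s))) := by
    rw [span_range_d]; trivial
  induction hω using Submodule.span_induction with
  | mem ω hω =>
    obtain ⟨f, rfl⟩ := hω
    obtain ⟨f, rfl⟩ := hb.2 f
    exact ⟨_, formsMap_d s η hgen f⟩
  | zero => exact ⟨0, map_zero _⟩
  | add a b _ _ ha hb =>
    obtain ⟨a, rfl⟩ := ha
    obtain ⟨b, rfl⟩ := hb
    exact ⟨a + b, map_add _ _ _⟩
  | smul c a _ ha =>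
    obtain ⟨a, rfl⟩ := ha
    obtain ⟨c, rfl⟩ := hb.2 c
    exact ⟨c • a, formsMap_smul s η hgen c a⟩

/-- An isomorphism of fields is étale, so differentials are compatible with this base change; and a
field extension is faithfully flat. -/
lemma formsMap_injective (hb : Function.Bijective (functionFieldMap η hgen)) :
    Function.Injective (formsMap s η hgen) := by
  let := functionFieldAlgebra s
  let := functionFieldAlgebra (η ≫ s)
  let := (functionFieldMap η hgen).toAlgebra
  have : IsScalarTower ℂ X.functionField Y.functionField :=
    .of_algebraMap_eq fun c => (functionFieldMap_functionFieldAlgebra η hgen s c).symm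
  have : Algebra.Etale X.functionField Y.functionField :=
    RingHom.etale_algebraMap.1 (RingHom.Etale.of_bijective hb)
  have h1 : Function.Injective fun ω : RationalForms s =>
      (1 : Y.functionField) ⊗ₜ[X.functionField] ω :=
    Module.FaithfullyFlat.tensorProduct_mk_injective (A := X.functionField) (B := Y.functionField)
      (RationalForms s)
  intro a b hab
  refine h1 ((KaehlerDifferential.tensorKaehlerEquivOfFormallyEtale ℂ X.functionField
    Y.functionField).injective ?_)
  simp only [KaehlerDifferential.tensorKaehlerEquivOfFormallyEtale_apply,
    KaehlerDifferential.mapBaseChange_tmul, one_smul]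
  exact hab

end Forms

/-! ### Logarithmic forms off the divisor -/

section Lattices

open Scheme.IdealSheafData

variable {X : Scheme.{0}} [IsIntegral X] {M : Type} [AddCommGroup M] [Module X.functionField M]

lemma algebraMap_smul_mem {x : X} (P : Submodule (localRing X x) M) (a : X.presheaf.stalk x)
    {m : M} (hm : m ∈ P) : algebraMap _ X.functionField a • m ∈ P :=
  P.smul_mem (⟨_, a, rfl⟩ : localRing X x) hm

variable (s : X ⟶ SpecC)

lemma dlog_mem_of_isUnit {x : X} (P : Submodule (localRing X x) (RationalForms s))
    (hd : ∀ f : X.presheaf.stalk x, d s (algebraMap _ X.functionField f) ∈ P)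
    {z : X.presheaf.stalk x} (hz : IsUnit z) : dlog s (algebraMap _ X.functionField z) ∈ P := by
  obtain ⟨z, rfl⟩ := hz
  have h : (algebraMap (X.presheaf.stalk x) X.functionField z)⁻¹ =
      algebraMap (X.presheaf.stalk x) X.functionField (z⁻¹ : (X.presheaf.stalk x)ˣ) := by
    refine inv_eq_of_mul_eq_one_right ?_
    rw [← map_mul, Units.mul_inv, map_one]
  rw [dlog, h]
  exact algebraMap_smul_mem P _ (hd _)

/-- Logarithmic forms are regular outside the divisor, where they are generated by the
differentials of coordinates. -/
lemma IsChart.logForms_eq {p : X} {V : X.Opens} {n : ℕ} {t : Fin n → Γ(X, V)}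
    (h : IsChart s p V t) {ι : Type} {C : ι → Closeds X} (x : V) (hx : ∀ i, x.1 ∉ C i) :
    logForms s C x.1 =
      Submodule.span (localRing X x.1) (Set.range fun i => d s (rationalValue x (t i))) := by
  have hd (f : X.presheaf.stalk x.1) : d s (algebraMap _ X.functionField f) ∈
      Submodule.span (localRing X x.1) (Set.range fun i => d s (rationalValue x (t i))) := by
    obtain ⟨a, ha⟩ := h.exists_d_eq x f
    rw [ha]
    exact Submodule.sum_mem _ fun i _ =>
      algebraMap_smul_mem _ _ (Submodule.subset_span ⟨i, rfl⟩)
  refine le_antisymm (Submodule.span_le.2 ?_) (Submodule.span_le.2 ?_)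
  · rintro _ (⟨f, rfl⟩ | ⟨i, z, hz, rfl⟩)
    · exact hd f
    · refine dlog_mem_of_isUnit s _ hd ?_
      rwa [stalkIdeal_vanishingIdeal_eq_top (hx i), Ideal.span_singleton_eq_top] at hz
  · rintro _ ⟨i, rfl⟩
    exact Submodule.subset_span (.inl ⟨_, rfl⟩)

end Lattices

/-! ### Fractional ideals of ideal sheaves -/

section Products

variable {X : Scheme.{0}} [IsIntegral X] {M : Type} [AddCommGroup M] [Module X.functionField M]

/-- The fractional ideals of an ideal sheaf. -/
def idealLattice (I : X.IdealSheafData) (x : X) : Submodule (localRing X x) X.functionField :=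
  Submodule.span (localRing X x)
    (algebraMap (X.presheaf.stalk x) X.functionField '' (stalkIdeal I x : Set _))

lemma idealLattice_eq_span {I : X.IdealSheafData} {x : X} {f : X.presheaf.stalk x}
    (h : stalkIdeal I x = Ideal.span {f}) :
    idealLattice I x = Submodule.span _ {algebraMap _ X.functionField f} := by
  rw [idealLattice, h]
  refine le_antisymm (Submodule.span_le.2 ?_) (Submodule.span_le.2 ?_)
  · rintro _ ⟨a, ha, rfl⟩
    obtain ⟨c, rfl⟩ := Ideal.mem_span_singleton'.1 ha
    rw [map_mul]
    exact algebraMap_smul_mem _ c (Submodule.mem_span_singleton_self _)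
  · rintro _ rfl
    exact Submodule.subset_span ⟨f, Ideal.mem_span_singleton_self f, rfl⟩

/-- Only stalks of `I'` enter its lattices, so the equation of `I` on a neighbourhood serves for
`I'`. It is applied with `I` the inverse image of the center and `I'` the product of the ideals of
the exceptional curves. -/
lemma isLocallyPrincipal_idealLattice {I I' : X.IdealSheafData} (hI : IsInvertibleIdeal I)
    (h : ∀ x, stalkIdeal I' x = stalkIdeal I x) : IsLocallyPrincipal (idealLattice I') := by
  intro x
  obtain ⟨U, hxU, f, hf, hfU⟩ := hI x
  have : Nonempty U.1 := ⟨⟨x, hxU⟩⟩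
  refine ⟨U.1, hxU, rationalValue ⟨x, hxU⟩ f, fun h0 => ?_, fun z hz => ?_⟩
  · rw [← map_zero (rationalValue ⟨x, hxU⟩)] at h0
    exact nonZeroDivisors.ne_zero hf (rationalValue_injective _ h0)
  · rw [rationalValue_eq _ ⟨z, hz⟩]
    refine idealLattice_eq_span ?_
    rw [h, stalkIdeal_eq I z U hz, hfU, Ideal.map_span, Set.image_singleton]

lemma mem_mulLattice_iff {L : ∀ x : X, Submodule (localRing X x) M}
    {J : ∀ x : X, Submodule (localRing X x) X.functionField} {x : X} {e : X.functionField}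
    (hJ : J x = Submodule.span _ {e}) {m : M} :
    m ∈ mulLattice L J x ↔ ∃ ω ∈ L x, m = e • ω := by
  constructor
  · intro h
    induction h using Submodule.span_induction with
    | mem m hm =>
      obtain ⟨j, hj, ω, hω, rfl⟩ := hm
      rw [hJ, Submodule.mem_span_singleton] at hj
      obtain ⟨a, rfl⟩ := hj
      refine ⟨a • ω, (L x).smul_mem a hω, ?_⟩
      rw [Subring.smul_def, Subring.smul_def, smul_smul, smul_eq_mul, mul_comm]
    | zero => exact ⟨0, zero_mem _, (smul_zero _).symm⟩
    | add a b _ _ ha hb =>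
      obtain ⟨ω, hω, rfl⟩ := ha
      obtain ⟨ω', hω', rfl⟩ := hb
      exact ⟨ω + ω', add_mem hω hω', (smul_add _ _ _).symm⟩
    | smul c a _ ha =>
      obtain ⟨ω, hω, rfl⟩ := ha
      exact ⟨c • ω, (L x).smul_mem c hω, by rw [Subring.smul_def, Subring.smul_def, smul_comm]⟩
  · rintro ⟨ω, hω, rfl⟩
    exact Submodule.subset_span ⟨e, hJ ▸ Submodule.mem_span_singleton_self e, ω, hω, rfl⟩

end Products

/-! ### Comparison of the lattices of logarithmic forms -/

section Comparison

open Scheme.IdealSheafData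

section Twist

variable {X Y : Scheme.{0}} [IsIntegral Y] (s : X ⟶ SpecC) (η : Y ⟶ X)
  {Z : Finset X} (hZ : ∀ p ∈ Z, IsClosed ({p} : Set X)) {ι : Type} (C : ι → Closeds X)

/-- The lattices of the twist by the exceptional divisor of the logarithmic sheaf
of the blow-up. -/
def twistedLattice : ∀ y : Y, Submodule (localRing Y y) (RationalForms (η ≫ s)) :=
  mulLattice (logForms (η ≫ s) (totalArrangement η Z C hZ))
    (idealLattice (divisorIdeal (exceptional η Z hZ)))

variable {s η hZ C} in
lemma mem_twistedLattice_iff {y : Y} {e : Y.functionField}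
    (h : idealLattice (divisorIdeal (exceptional η Z hZ)) y = Submodule.span _ {e})
    {ω : RationalForms (η ≫ s)} : ω ∈ twistedLattice s η hZ C y ↔
      ∃ ω' ∈ logForms (η ≫ s) (totalArrangement η Z C hZ) y, ω = e • ω' :=
  mem_mulLattice_iff h

lemma mem_twistedLattice_of_notMem {y : Y} (hy : η y ∉ Z) {ω : RationalForms (η ≫ s)} :
    ω ∈ twistedLattice s η hZ C y ↔ ω ∈ logForms (η ≫ s) (totalArrangement η Z C hZ) y := by
  have h1 := idealLattice_eq_span (I := divisorIdeal (exceptional η Z hZ)) (x := y) (f := 1)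
    ((stalkIdeal_divisorIdeal_of_notMem η Z hZ hy).trans Ideal.span_singleton_one.symm)
  rw [map_one] at h1
  rw [mem_twistedLattice_iff h1]
  simp

end Twist

variable {X Y : Scheme.{0}} [IsIntegral X] [IsIntegral Y] (s : X ⟶ SpecC) (η : Y ⟶ X)
  (hgen : η (genericPoint Y) = genericPoint X)
  {Z : Finset X} (hZ : ∀ p ∈ Z, IsClosed ({p} : Set X))
  {ι : Type} (C : ι → Closeds X)

lemma formsMap_mem_logForms {y : Y} [IsIso (η.stalkMap y)] (hZC : ∀ i, ∀ p ∈ Z, p ∉ C i)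
    {ω : RationalForms s} (hω : ω ∈ logForms s C (η y)) :
    formsMap s η hgen ω ∈ logForms (η ≫ s) (totalArrangement η Z C hZ) y := by
  induction hω using Submodule.span_induction with
  | mem ω hω =>
    obtain ⟨f, rfl⟩ | ⟨i, z, hz, rfl⟩ := hω
    · rw [formsMap_d, functionFieldMap_algebraMap]
      exact Submodule.subset_span (.inl ⟨_, rfl⟩)
    · rw [formsMap_dlog, functionFieldMap_algebraMap]
      refine Submodule.subset_span (.inr ⟨.inl i, _, ?_, rfl⟩)
      change _ = stalkIdeal (vanishingIdeal (strictTransform η Z (C i))) y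
      rw [strictTransform_eq η Z (C i) (hZC i), stalkIdeal_vanishingIdeal_preimage_of_isIso, ← hz,
        Ideal.map_span, Set.image_singleton]
  | zero => rw [map_zero]; exact zero_mem _
  | add a b _ _ ha hb => rw [map_add]; exact add_mem ha hb
  | smul c a _ ha =>
    obtain ⟨_, c, rfl⟩ := c
    change formsMap s η hgen (algebraMap _ X.functionField c • a) ∈ _
    rw [formsMap_smul, functionFieldMap_algebraMap]
    exact algebraMap_smul_mem _ _ ha

/-- Off the center, strict transforms are preimages, so their equations come from `X`; exceptional
curves miss `y`, and their equations there are units with regular `dlog`. -/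
lemma exists_formsMap_eq {y : Y} (hy : η y ∉ Z) [IsIso (η.stalkMap y)]
    (hZC : ∀ i, ∀ p ∈ Z, p ∉ C i) {ω : RationalForms (η ≫ s)}
    (hω : ω ∈ logForms (η ≫ s) (totalArrangement η Z C hZ) y) :
    ∃ ω₀ ∈ logForms s C (η y), formsMap s η hgen ω₀ = ω := by
  have hb := ConcreteCategory.bijective_of_isIso (η.stalkMap y)
  induction hω using Submodule.span_induction with
  | mem ω hω =>
    obtain ⟨f, rfl⟩ | ⟨i, z, hz, rfl⟩ := hω
    · obtain ⟨f, rfl⟩ := hb.2 f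
      exact ⟨_, Submodule.subset_span (.inl ⟨f, rfl⟩), by
        rw [formsMap_d, functionFieldMap_algebraMap]⟩
    · obtain ⟨z, rfl⟩ := hb.2 z
      refine ⟨dlog s (algebraMap _ X.functionField z), ?_, by
        rw [formsMap_dlog, functionFieldMap_algebraMap]⟩
      rcases i with i | q
      · refine Submodule.subset_span (.inr ⟨i, z, ?_, rfl⟩)
        change _ = stalkIdeal (vanishingIdeal (strictTransform η Z (C i))) y at hz
        rw [strictTransform_eq η Z (C i) (hZC i), stalkIdeal_vanishingIdeal_preimage_of_isIso] at hz
        have h1 : (Ideal.span {z}).map (η.stalkMap y).hom =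
            (stalkIdeal (vanishingIdeal (C i)) (η y)).map (η.stalkMap y).hom := by
          rw [← hz, Ideal.map_span, Set.image_singleton]
        have h2 := congrArg (Ideal.comap (η.stalkMap y).hom) h1
        rwa [Ideal.comap_map_of_bijective _ hb, Ideal.comap_map_of_bijective _ hb] at h2
      · refine dlog_mem_of_isUnit s _ (fun f => Submodule.subset_span (.inl ⟨f, rfl⟩)) ?_
        change _ = stalkIdeal (vanishingIdeal (exceptional η Z hZ q)) y at hz
        rw [stalkIdeal_vanishingIdeal_eq_top, Ideal.span_singleton_eq_top] at hz
        · exact isUnit_of_map_unit (η.stalkMap y).hom z hz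
        · intro h
          have : η y = q.1 := h
          exact hy (this ▸ q.2)
  | zero => exact ⟨0, zero_mem _, map_zero _⟩
  | add a b _ _ ha hb =>
    obtain ⟨a, ha, rfl⟩ := ha
    obtain ⟨b, hb, rfl⟩ := hb
    exact ⟨a + b, add_mem ha hb, map_add _ _ _⟩
  | smul c a _ ha =>
    obtain ⟨_, c, rfl⟩ := c
    obtain ⟨c, rfl⟩ := hb.2 c
    obtain ⟨a, ha, rfl⟩ := ha
    refine ⟨algebraMap _ X.functionField c • a, algebraMap_smul_mem _ c ha, ?_⟩
    rw [formsMap_smul, functionFieldMap_algebraMap]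
    rfl

lemma formsMap_mem_twistedLattice_iff {y : Y} (hy : η y ∉ Z) [IsIso (η.stalkMap y)]
    (hZC : ∀ i, ∀ p ∈ Z, p ∉ C i) (hb : Function.Bijective (functionFieldMap η hgen))
    {ω : RationalForms s} :
    formsMap s η hgen ω ∈ twistedLattice s η hZ C y ↔ ω ∈ logForms s C (η y) := by
  rw [mem_twistedLattice_of_notMem s η hZ C hy]
  refine ⟨fun h => ?_, formsMap_mem_logForms s η hgen hZ C hZC⟩
  obtain ⟨ω₀, h0, h1⟩ := exists_formsMap_eq s η hgen hZ C hy hZC h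
  rwa [← formsMap_injective s η hgen hb h1]

/-- The heart of the theorem. Near `y` the only divisor is the exceptional curve, with equation `x
i`. Multiplying by `x i` turns its `dlog` into `d (x i)`, and `x j = x i * v` trades `x i • dv` for
`d (x j)` modulo `d (x i)`. -/
lemma twistedLattice_eq_of_mem {y : Y} (hy : η y ∈ Z) (hZC : ∀ i, ∀ p ∈ Z, p ∉ C i)
    {V : X.Opens} {t : Fin 2 → Γ(X, V)} (h : IsChart s (η y) V t) {i j : Fin 2}
    (hij : i ≠ j) {v : Y.presheaf.stalk y}
    (hv : IsBlowUpChart η y (X.presheaf.germ V (η y) h.mem (t i))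
      (X.presheaf.germ V (η y) h.mem (t j)) v) :
    twistedLattice s η hZ C y = Submodule.span (localRing Y y)
      (Set.range fun i => formsMap s η hgen (d s (rationalValue ⟨η y, h.mem⟩ (t i)))) := by
  set x := fun i => η.stalkMap y (X.presheaf.germ V (η y) h.mem (t i)) with hx
  set P := Submodule.span (localRing Y y)
      (Set.range fun i => formsMap s η hgen (d s (rationalValue ⟨η y, h.mem⟩ (t i)))) with hP
  let a : Y.presheaf.stalk y →+* Y.functionField := algebraMap _ _
  have hform (k) : formsMap s η hgen (d s (rationalValue ⟨η y, h.mem⟩ (t k))) =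
      d (η ≫ s) (a (x k)) := by
    rw [formsMap_d, ← functionFieldMap_algebraMap η hgen]
    rfl
  have hxP (k) : d (η ≫ s) (a (x k)) ∈ P := Submodule.subset_span ⟨k, hform k⟩
  have hE : stalkIdeal (vanishingIdeal (exceptional η Z hZ ⟨η y, hy⟩)) y = Ideal.span {x i} := by
    rw [stalkIdeal_exceptional, stalkIdeal_vanishingIdeal_pointsClosed Z hZ hy, hv.map_eq,
      hv.isPrime.isRadical.radical]
  have hJ := idealLattice_eq_span (I := divisorIdeal (exceptional η Z hZ)) (x := y) (f := x i)
    ((stalkIdeal_divisorIdeal_of_mem η Z hZ hy).trans hE)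
  have hx0 : x i ≠ 0 := hv.ne_zero
  have ha0 {z : Y.presheaf.stalk y} (hz : z ≠ 0) : a z ≠ 0 := fun h0 =>
    hz (IsFractionRing.injective (Y.presheaf.stalk y) Y.functionField (h0.trans (map_zero _).symm))
  have hj : d (η ≫ s) (a (x j)) = a (x i) • d (η ≫ s) (a v) + a v • d (η ≫ s) (a (x i)) := by
    rw [← d_mul, ← map_mul]
    exact congrArg (fun z => d (η ≫ s) (a z)) hv.eq_mul
  -- The `f` with `x i • df ∈ P` form a subring by the Leibniz rule. It contains the stalk of `X`,
  -- contains `v`, and is closed under inverses since `dg = -g² df` when `f g = 1`; so it is the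
  -- whole stalk.
  have hd (f : Y.presheaf.stalk y) : a (x i) • d (η ≫ s) (a f) ∈ P := by
    let S : Subring (Y.presheaf.stalk y) :=
      { carrier := {f | a (x i) • d (η ≫ s) (a f) ∈ P}
        one_mem' := by
          change _ • _ ∈ P
          rw [map_one, d_one, smul_zero]; exact zero_mem _
        zero_mem' := by
          change _ • _ ∈ P
          rw [map_zero, d_zero, smul_zero]; exact zero_mem _
        add_mem' := fun {f g} hf hg => by
          change _ • _ ∈ P
          rw [map_add, d_add, smul_add]; exact add_mem hf hg
        neg_mem' := fun {f} hf => by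
          change _ • _ ∈ P
          rw [map_neg, d_neg, smul_neg]; exact neg_mem hf
        mul_mem' := fun {f g} hf hg => by
          change _ • _ ∈ P
          rw [map_mul, d_mul, smul_add, smul_comm, smul_comm (a (x i))]
          exact add_mem (algebraMap_smul_mem P f hg) (algebraMap_smul_mem P g hf) }
    have hS : S = ⊤ := by
      refine hv.eq_top S (fun f => ?_) ?_ fun f hf g hfg => ?_
      · obtain ⟨c, hc⟩ := h.exists_d_eq ⟨η y, h.mem⟩ f
        change a (x i) • d (η ≫ s) (a (η.stalkMap y f)) ∈ P
        rw [← functionFieldMap_algebraMap η hgen y f, ← formsMap_d, hc, map_sum]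
        refine algebraMap_smul_mem P _ (Submodule.sum_mem _ fun k _ => ?_)
        rw [formsMap_smul]
        erw [functionFieldMap_algebraMap]
        exact algebraMap_smul_mem P _ (Submodule.subset_span ⟨k, rfl⟩)
      · change a (x i) • d (η ≫ s) (a v) ∈ P
        rw [eq_sub_of_add_eq hj.symm]
        exact sub_mem (hxP j) (algebraMap_smul_mem P v (hxP i))
      · change a (x i) • d (η ≫ s) (a g) ∈ P
        rw [d_of_mul_eq_one (η ≫ s) (f := a f) (g := a g) (by rw [← map_mul, hfg, map_one]),
          smul_comm, ← map_mul, ← map_neg]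
        exact algebraMap_smul_mem P _ hf
    exact (hS ▸ Subring.mem_top f : f ∈ S)
  have hdlog {z : Y.presheaf.stalk y} (hz : IsUnit z) : a (x i) • dlog (η ≫ s) (a z) ∈ P := by
    obtain ⟨z, rfl⟩ := hz
    have h : (a z)⁻¹ = a (z⁻¹ : (Y.presheaf.stalk y)ˣ) := by
      refine inv_eq_of_mul_eq_one_right ?_
      rw [← map_mul, Units.mul_inv, map_one]
    rw [dlog, h, smul_comm]
    exact algebraMap_smul_mem P _ (hd _)
  have hdlog' : a (x i) • dlog (η ≫ s) (a (x i)) = d (η ≫ s) (a (x i)) := by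
    rw [dlog, smul_smul, mul_inv_cancel₀ (ha0 hx0), one_smul]
  refine le_antisymm (fun ω hω => ?_) (Submodule.span_le.2 ?_)
  · rw [mem_twistedLattice_iff hJ] at hω
    obtain ⟨ω, hω, rfl⟩ := hω
    induction hω using Submodule.span_induction with
    | mem ω hω =>
      obtain ⟨f, rfl⟩ | ⟨k, z, hz, rfl⟩ := hω
      · exact hd f
      · by_cases hk : k = .inr ⟨η y, hy⟩
        -- Any equation of the exceptional curve is `x i` times a unit, and `dlog` is additive.
        · subst hk
          rw [show totalArrangement η Z C hZ (.inr ⟨η y, hy⟩) = exceptional η Z hZ ⟨η y, hy⟩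
            from rfl, hE, Ideal.span_singleton_eq_span_singleton] at hz
          obtain ⟨u, hu⟩ := hz.symm
          rw [← hu, map_mul]
          change a (x i) • dlog (η ≫ s) (a (x i) * a u) ∈ P
          rw [dlog_mul (η ≫ s) (ha0 hx0) (ha0 u.ne_zero), smul_add, hdlog']
          exact add_mem (hxP i) (hdlog u.isUnit)
        · refine hdlog ?_
          rw [stalkIdeal_vanishingIdeal_eq_top, Ideal.span_singleton_eq_top] at hz
          · exact hz
          · rcases k with k | q
            · change y ∉ strictTransform η Z (C k)
              rw [strictTransform_eq η Z (C k) (hZC k)]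
              exact fun h => hZC k _ hy h
            · intro h
              exact hk (congrArg Sum.inr (Subtype.ext (show η y = q.1 from h).symm))
    | zero => rw [smul_zero]; exact zero_mem _
    | add a b _ _ ha hb => rw [smul_add]; exact add_mem ha hb
    | smul c b _ hb => exact (congrArg (· ∈ P) (smul_comm (a (x i)) c.1 b)).mpr (P.smul_mem c hb)
  -- Conversely, `d (x i)` is `x i` times the logarithmic form `dlog (x i)`, and `d (x j) = x i • dv
  -- + v • d (x i)`.
  · have hi : d (η ≫ s) (a (x i)) ∈ twistedLattice s η hZ C y := by
      rw [mem_twistedLattice_iff hJ]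
      exact ⟨_, Submodule.subset_span (.inr ⟨.inr ⟨η y, hy⟩, x i, hE.symm, rfl⟩), hdlog'.symm⟩
    have hj' : d (η ≫ s) (a (x j)) ∈ twistedLattice s η hZ C y := by
      rw [hj]
      refine add_mem ?_ (algebraMap_smul_mem _ v hi)
      rw [mem_twistedLattice_iff hJ]
      exact ⟨_, Submodule.subset_span (.inl ⟨v, rfl⟩), rfl⟩
    rintro _ ⟨k, rfl⟩
    change formsMap s η hgen (d s (rationalValue ⟨η y, h.mem⟩ (t k))) ∈ twistedLattice s η hZ C y
    rw [hform]
    have : k = i ∨ k = j := by omega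
    rcases this with rfl | rfl
    · exact hi
    · exact hj'

end Comparison

/-! ### Coordinates of sections in a lattice basis -/

section Coefficients

open Scheme.Modules

variable {X : Scheme.{0}} [IsIntegral X] {M : Type} [AddCommGroup M] [Module X.functionField M]
  {L : ∀ x : X, Submodule (localRing X x) M}

lemma val_sum {U : X.Opens} {κ : Type} (S : Finset κ) (f : κ → Γ(latticeSheaf L, U)) (x : U) :
    val (∑ k ∈ S, f k) x = ∑ k ∈ S, val (f k) x := by
  classical
  induction S using Finset.induction_on with
  | empty => simp
  | insert a S ha ih => rw [Finset.sum_insert ha, Finset.sum_insert ha, val_add, ih]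

/-- Linear independence over the function field forces the coefficients found at the various points
to agree, so each is regular on all of `U`. -/
lemma exists_eq_sum_smul {n : ℕ} {e : Fin n → M} (he : LinearIndependent X.functionField e)
    {U : X.Opens} (hL : ∀ x ∈ U, L x = Submodule.span _ (Set.range e))
    (he' : ∀ k, ∀ x ∈ U, e k ∈ L x) (σ : Γ(latticeSheaf L, U)) :
    ∃ c : Fin n → Γ(X, U), σ = ∑ k, c k • const L U (e k) (he' k) := by
  by_cases hU : ∃ x, x ∈ U
  · obtain ⟨x, hx⟩ := hU
    let x₀ : U := ⟨x, hx⟩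
    have h1 (x : U) : ∃ a : Fin n → localRing X x.1, ∑ k, (a k).1 • e k = val σ x₀ := by
      have h2 := val_mem σ x
      rw [hL x.1 x.2, val_eq σ x x₀] at h2
      obtain ⟨a, ha⟩ := (Submodule.mem_span_range_iff_exists_fun _).1 h2
      exact ⟨a, ha⟩
    choose a ha using h1
    have h3 (x : U) (k : Fin n) : (a x₀ k).1 = (a x k).1 := by
      have := Fintype.linearIndependent_iff.1 he (fun k => (a x₀ k).1 - (a x k).1) (by
        simp only [sub_smul, Finset.sum_sub_distrib]
        rw [ha, ha, sub_self]) k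
      exact sub_eq_zero.1 this
    choose c hc using fun k => exists_rationalValue_eq U (a x₀ k).1 fun x hx => by
      rw [h3 ⟨x, hx⟩ k]; exact (a ⟨x, hx⟩ k).2
    refine ⟨c, val_ext_of_mem x₀ ?_⟩
    rw [val_sum, ← ha x₀]
    refine Finset.sum_congr rfl fun k _ => ?_
    rw [val_smul, hc, val_const]
  · exact ⟨0, val_ext fun x => (hU ⟨x.1, x.2⟩).elim⟩

end Coefficients

/-! ### Pullback of lattice sheaves -/

section LatticePullback

open Scheme.Modules

variable {X Y : Scheme.{0}} [IsIntegral X] [IsIntegral Y] {η : Y ⟶ X}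
  (hgen : η (genericPoint Y) = genericPoint X)
  {M M' : Type} [AddCommGroup M] [Module X.functionField M]
  [AddCommGroup M'] [Module Y.functionField M']
  (L : ∀ x : X, Submodule (localRing X x) M) (L' : ∀ y : Y, Submodule (localRing Y y) M')
  (Θ : M →+ M') (hΘ : ∀ k m, Θ (k • m) = functionFieldMap η hgen k • Θ m)
  (hL : ∀ y, ∀ m ∈ L (η y), Θ m ∈ L' y)

/-- The image of a section of a lattice sheaf under a semilinear map. -/
def mapSection {U : X.Opens} (σ : Γ(latticeSheaf L, U)) : Γ(latticeSheaf L', η ⁻¹ᵁ U) :=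
  show latticeSections L' (η ⁻¹ᵁ U) from
    ⟨fun y => Θ (val σ ⟨η y.1, y.2⟩), fun y => hL y.1 _ (val_mem σ ⟨η y.1, y.2⟩),
      fun y y' => congrArg Θ (val_eq σ ⟨η y.1, y.2⟩ ⟨η y'.1, y'.2⟩)⟩

/-- The morphism of lattice sheaves induced by a semilinear map. -/
def latticeHom : latticeSheaf L ⟶ (pushforward η).obj (latticeSheaf L') :=
  homMk (fun U σ => mapSection L L' Θ hL σ)
    (fun U σ τ => val_ext (L := L') fun y => map_add Θ _ _)
    (fun U c σ => val_ext (L := L') fun y => by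
      refine (hΘ _ _).trans (congrArg (· • Θ (val σ ⟨η y.1, y.2⟩)) ?_)
      refine (functionFieldMap_rationalValue η hgen le_rfl y c).trans ?_
      rw [Scheme.Hom.appLE_eq_app]
      rfl)
    (fun W V h σ => rfl)

lemma val_pull_latticeHom {U : X.Opens} {W : Y.Opens} (h : W ≤ η ⁻¹ᵁ U)
    (σ : Γ(latticeSheaf L, U)) (y : W) :
    val (pull η (latticeHom hgen L L' Θ hΘ hL) h σ) y = Θ (val σ ⟨η y.1, h y.2⟩) := rfl

variable (η) in
/-- Near `y` the morphism `η` is an open immersion which identifies the lattices. -/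
def IsLatticeIsoAt (y : Y) : Prop :=
  ∃ W₀ : Y.Opens, y ∈ W₀ ∧ (∀ W ≤ W₀, IsOpen (η '' (W : Set Y))) ∧
    (∀ z ∈ W₀, Function.Surjective (η.stalkMap z)) ∧
    ∀ z ∈ W₀, ∀ m, Θ m ∈ L' z → m ∈ L (η z)

variable (η) in
/-- Near `y` the lattices have corresponding bases. -/
def HasLatticeBasisAt (y : Y) : Prop :=
  ∃ U₀ : X.Opens, η y ∈ U₀ ∧ ∃ (n : ℕ) (e : Fin n → M), LinearIndependent X.functionField e ∧
    LinearIndependent Y.functionField (Θ ∘ e) ∧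
    (∀ x ∈ U₀, L x = Submodule.span _ (Set.range e)) ∧
    (∀ z, η z ∈ U₀ → L' z = Submodule.span _ (Set.range (Θ ∘ e)))

variable {L L' Θ}

lemma IsLatticeIsoAt.exists_section {y : Y} (h : IsLatticeIsoAt η L L' Θ y)
    (hsurj : Function.Surjective Θ)
    {V : Y.Opens} (hy : y ∈ V) (ω : Γ(latticeSheaf L', V)) :
    ∃ (W : Y.Opens) (h : W ≤ V), y ∈ W ∧
      res _ h ω ∈ imageSpan η (latticeHom hgen L L' Θ hΘ hL) W := by
  obtain ⟨W₀, hyW, hopen, -, hm⟩ := h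
  refine ⟨V ⊓ W₀, inf_le_left, ⟨hy, hyW⟩, ?_⟩
  obtain ⟨m, hmω⟩ := hsurj (val ω ⟨y, hy⟩)
  let U' : X.Opens := ⟨η '' (V ⊓ W₀ : Y.Opens), hopen _ inf_le_right⟩
  have hU' : V ⊓ W₀ ≤ η ⁻¹ᵁ U' := fun z hz => ⟨z, hz, rfl⟩
  refine Submodule.subset_span ⟨U', hU', const L U' m ?_, val_ext fun z => ?_⟩
  · rintro _ ⟨z, hz, rfl⟩
    refine hm z hz.2 m ?_
    rw [hmω, val_eq ω _ ⟨z, hz.1⟩]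
    exact val_mem ω ⟨z, hz.1⟩
  · rw [val_pull_latticeHom, val_const, hmω, val_res]
    exact val_eq ω _ _

lemma HasLatticeBasisAt.exists_section {y : Y} (h : HasLatticeBasisAt η L L' Θ y)
    {V : Y.Opens} (hy : y ∈ V) (ω : Γ(latticeSheaf L', V)) :
    ∃ (W : Y.Opens) (h : W ≤ V), y ∈ W ∧
      res _ h ω ∈ imageSpan η (latticeHom hgen L L' Θ hΘ hL) W := by
  obtain ⟨U₀, hyU, n, e, he, heΘ, hLe, hLe'⟩ := h
  refine ⟨V ⊓ η ⁻¹ᵁ U₀, inf_le_left, ⟨hy, hyU⟩, ?_⟩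
  obtain ⟨c, hc⟩ := exists_eq_sum_smul heΘ (U := V ⊓ η ⁻¹ᵁ U₀) (fun z hz => hLe' z hz.2)
    (fun k z hz => by rw [hLe' z hz.2]; exact Submodule.subset_span ⟨k, rfl⟩) (res _ inf_le_left ω)
  rw [hc]
  refine Submodule.sum_mem _ fun k _ => Submodule.smul_mem _ _ (Submodule.subset_span
    ⟨U₀, inf_le_right, const L U₀ (e k) fun x hx => ?_, ?_⟩)
  · rw [hLe x hx]; exact Submodule.subset_span ⟨k, rfl⟩
  · exact val_ext fun z => rfl

variable {G : Y.Modules} (φ : latticeSheaf L ⟶ (pushforward η).obj G)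

/-- Functions on `W` all come from its open image `U'`, so every pair in the span is the pair of
images of a single section over `U'`. That section vanishes if its image under the injective `Θ`
does. -/
lemma IsLatticeIsoAt.relationsLift {y : Y} (h : IsLatticeIsoAt η L L' Θ y)
    (hb : Function.Bijective (functionFieldMap η hgen)) (hinj : Function.Injective Θ) :
    ∃ W₀ : Y.Opens, y ∈ W₀ ∧ ∀ W ≤ W₀, ∀ g : Γ(G, W),
      (0, g) ∈ pairSpan η (latticeHom hgen L L' Θ hΘ hL) φ W → g = 0 := by
  obtain ⟨W₀, hyW, hopen, hst, hm⟩ := h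
  refine ⟨W₀, hyW, fun W hW g hg => ?_⟩
  let U' : X.Opens := ⟨η '' (W : Set Y), hopen _ hW⟩
  have hU' : W ≤ η ⁻¹ᵁ U' := fun z hz => ⟨z, hz, rfl⟩
  have hc (c : Γ(Y, W)) : ∃ c' : Γ(X, U'), η.appLE U' W hU' c' = c := by
    by_cases hWne : ∃ z, z ∈ W
    · obtain ⟨z, hz⟩ := hWne
      let z₀ : W := ⟨z, hz⟩
      obtain ⟨k, hk⟩ := hb.2 (rationalValue z₀ c)
      obtain ⟨c', hc'⟩ := exists_rationalValue_eq U' k (by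
        rintro _ ⟨z, hz, rfl⟩
        obtain ⟨a, ha⟩ := hst z (hW hz) (Y.presheaf.germ W z hz c)
        refine ⟨a, hb.1 ?_⟩
        rw [functionFieldMap_algebraMap, ha, hk]
        exact rationalValue_eq ⟨z, hz⟩ z₀ c)
      refine ⟨c', rationalValue_injective z₀ ?_⟩
      rw [← functionFieldMap_rationalValue η hgen hU' z₀, hc', hk]
    · refine ⟨0, ?_⟩
      rw [map_zero]
      exact (eq_zero_of_germ_eq_zero c fun z hz => (hWne ⟨z, hz⟩).elim).symm
  have key (p) (hp : p ∈ pairSpan η (latticeHom hgen L L' Θ hΘ hL) φ W) :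
      ∃ σ, p = (pull η (latticeHom hgen L L' Θ hΘ hL) hU' σ, pull η φ hU' σ) := by
    induction hp using Submodule.span_induction with
    | mem p hp =>
      obtain ⟨U, h, σ, rfl⟩ := hp
      have hle : U' ≤ U := by
        rintro _ ⟨z, hz, rfl⟩
        exact h hz
      exact ⟨res _ hle σ, by rw [pull_res, pull_res]⟩
    | zero =>
      refine ⟨0, ?_⟩
      have h0 := pull_add η (latticeHom hgen L L' Θ hΘ hL) hU' 0 0
      have h1 := pull_add η φ hU' 0 0
      rw [add_zero, left_eq_add] at h0 h1
      rw [h0, h1]; rfl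
    | add p q _ _ hp hq =>
      obtain ⟨σ, rfl⟩ := hp
      obtain ⟨τ, rfl⟩ := hq
      exact ⟨σ + τ, by rw [pull_add, pull_add]; rfl⟩
    | smul c p _ hp =>
      obtain ⟨σ, rfl⟩ := hp
      obtain ⟨c', rfl⟩ := hc c
      exact ⟨c' • σ, by rw [pull_smul, pull_smul]; rfl⟩
  obtain ⟨σ, hσ⟩ := key _ hg
  rw [Prod.mk.injEq] at hσ
  have h0 : σ = 0 := by
    refine val_ext fun x => ?_
    obtain ⟨z, hz, hzx⟩ := x.2
    have h1 := val_pull_latticeHom hgen L L' Θ hΘ hL hU' σ ⟨z, hz⟩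
    rw [← hσ.1, val_zero] at h1
    rw [val_eq σ x ⟨η z, hU' hz⟩, val_zero]
    exact hinj (h1.symm.trans (map_zero Θ).symm)
  rw [hσ.2, h0]
  have h1 := pull_add η φ hU' 0 0
  rwa [add_zero, left_eq_add] at h1

/-- Expanding sections of the source in the basis `e` writes each pair in the span with one common
family of coefficients `A k`. Independence of the images of `e` makes them zero when the first
component is zero. -/
lemma HasLatticeBasisAt.relationsLift {y : Y} (h : HasLatticeBasisAt η L L' Θ y) :
    ∃ W₀ : Y.Opens, y ∈ W₀ ∧ ∀ W ≤ W₀, ∀ g : Γ(G, W),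
      (0, g) ∈ pairSpan η (latticeHom hgen L L' Θ hΘ hL) φ W → g = 0 := by
  obtain ⟨U₀, hyU, n, e, he, heΘ, hLe, hLe'⟩ := h
  refine ⟨η ⁻¹ᵁ U₀, hyU, fun W hW g hg => ?_⟩
  have hmem (k) : ∀ x ∈ U₀, e k ∈ L x := fun x hx => by
    rw [hLe x hx]; exact Submodule.subset_span ⟨k, rfl⟩
  let E (k) : Γ(latticeSheaf L, U₀) := const L U₀ (e k) (hmem k)
  let u := latticeHom hgen L L' Θ hΘ hL
  have pull_sum {N : Y.Modules} (ψ : latticeSheaf L ⟶ (pushforward η).obj N) {U : X.Opens}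
      (h : W ≤ η ⁻¹ᵁ U) (f : Fin n → Γ(latticeSheaf L, U)) :
      pull η ψ h (∑ k, f k) = ∑ k, pull η ψ h (f k) :=
    map_sum (AddMonoidHom.mk' (pull η ψ h) (pull_add η ψ h)) f _
  have key (p) (hp : p ∈ pairSpan η u φ W) : ∃ A : Fin n → Γ(Y, W),
      p = (∑ k, A k • pull η u hW (E k), ∑ k, A k • pull η φ hW (E k)) := by
    induction hp using Submodule.span_induction with
    | mem p hp =>
      obtain ⟨U, h, σ, rfl⟩ := hp
      have hle : W ≤ η ⁻¹ᵁ (U ⊓ U₀) := fun z hz => ⟨h hz, hW hz⟩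
      obtain ⟨c, hc⟩ := exists_eq_sum_smul he (U := U ⊓ U₀) (fun x hx => hLe x hx.2)
        (fun k x hx => hmem k x hx.2) (res _ inf_le_left σ)
      have hE (k) : const L (U ⊓ U₀) (e k) (fun x hx => hmem k x hx.2) =
          res _ inf_le_right (E k) := val_ext fun x => rfl
      simp only [hE] at hc
      have main {N : Y.Modules} (ψ : latticeSheaf L ⟶ (pushforward η).obj N) :
          pull η ψ h σ = ∑ k, η.appLE _ W hle (c k) • pull η ψ hW (E k) := by
        rw [← pull_res η ψ hle inf_le_left, hc, pull_sum]
        refine Finset.sum_congr rfl fun k _ => ?_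
        rw [pull_smul, pull_res]
      exact ⟨fun k => η.appLE _ W hle (c k), by rw [main, main]⟩
    | zero => exact ⟨0, by
        simp only [Pi.zero_apply, zero_smul, Finset.sum_const_zero]; rfl⟩
    | add p q _ _ hp hq =>
      obtain ⟨A, rfl⟩ := hp
      obtain ⟨B, rfl⟩ := hq
      exact ⟨A + B, by simp [add_smul, Finset.sum_add_distrib]⟩
    | smul c p _ hp =>
      obtain ⟨A, rfl⟩ := hp
      exact ⟨c • A, by simp [mul_smul, Finset.smul_sum]⟩
  obtain ⟨A, hA⟩ := key _ hg
  rw [Prod.mk.injEq] at hA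
  have hA0 (k) : A k = 0 := by
    by_cases hWne : ∃ z, z ∈ W
    · obtain ⟨z, hz⟩ := hWne
      let z₀ : W := ⟨z, hz⟩
      apply rationalValue_injective z₀
      rw [map_zero]
      refine Fintype.linearIndependent_iff.1 heΘ (fun k => rationalValue z₀ (A k)) ?_ k
      have h1 := congrArg (val · z₀) hA.1
      simp only [val_zero, val_sum, val_smul] at h1
      exact h1.symm
    · exact eq_zero_of_germ_eq_zero _ fun z hz => (hWne ⟨z, hz⟩).elim
  rw [hA.2]
  exact Finset.sum_eq_zero fun k _ => by rw [hA0, zero_smul]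

/-- A semilinear bijection of rational modules which is compatible with lattices exhibits one
lattice sheaf as the pullback of the other. -/
theorem nonempty_pullback_latticeSheaf_iso
    (hΘ : ∀ k m, Θ (k • m) = functionFieldMap η hgen k • Θ m)
    (hL : ∀ y, ∀ m ∈ L (η y), Θ m ∈ L' y)
    (hb : Function.Bijective (functionFieldMap η hgen)) (hΘb : Function.Bijective Θ)
    (h : ∀ y, IsLatticeIsoAt η L L' Θ y ∨ HasLatticeBasisAt η L L' Θ y) :
    Nonempty ((pullback η).obj (latticeSheaf L) ≅ latticeSheaf L') :=
  nonempty_pullback_iso (u := latticeHom hgen L L' Θ hΘ hL)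
    (fun _ ω y hy => (h y).elim
      (fun h => h.exists_section hgen hΘ hL hΘb.2 hy ω)
      (fun h => h.exists_section hgen hΘ hL hy ω))
    (fun _ φ y => (h y).elim
      (fun h => h.relationsLift hgen hΘ hL φ hb hΘb.1)
      (fun h => h.relationsLift hgen hΘ hL φ))

end LatticePullback

/-! ### The local comparison along the blow-up -/

open Scheme.IdealSheafData

lemma IsBlowUp.isOpen_image {X Y : Scheme.{0}} {η : Y ⟶ X} {I : X.IdealSheafData}
    (hη : IsBlowUp η I) {W : Y.Opens} (hW : ∀ z ∈ W, η z ∉ I.support) :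
    IsOpen (η '' (W : Set Y)) := by
  let U : X.Opens := I.support.compl
  have : IsIso (η ∣_ U) := hη.isIso_morphismRestrict U fun x hx => hx
  have h : IsOpenImmersion ((η ⁻¹ᵁ U).ι ≫ η) := by
    rw [← morphismRestrict_ι]
    infer_instance
  have hWU : (W : Set Y) = (η ⁻¹ᵁ U).ι '' ((η ⁻¹ᵁ U).ι ⁻¹' (W : Set Y)) := by
    rw [Set.image_preimage_eq_inter_range, eq_comm, Set.inter_eq_left, Scheme.Opens.range_ι]
    exact fun z hz => hW z hz
  rw [hWU, ← Set.image_comp]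
  have h2 := ((η ⁻¹ᵁ U).ι ≫ η).isOpenEmbedding.isOpenMap _
    (W.isOpen.preimage (η ⁻¹ᵁ U).ι.continuous)
  simpa using h2

lemma mem_support_vanishingIdeal_pointsClosed {X : Scheme.{0}} {Z : Finset X}
    (hZ : ∀ p ∈ Z, IsClosed ({p} : Set X)) {x : X} :
    x ∈ (vanishingIdeal (pointsClosed Z hZ)).support ↔ x ∈ Z :=
  Set.ext_iff.1 (coe_support_vanishingIdeal (pointsClosed Z hZ)) x

section

lemma IsBlowUp.isIso_stalkMap_of_notMem {X Y : Scheme.{0}} {η : Y ⟶ X}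
    {Z : Finset X} {hZ : ∀ p ∈ Z, IsClosed ({p} : Set X)}
    (hη : IsBlowUp η (vanishingIdeal (pointsClosed Z hZ)))
    {y : Y} (hy : η y ∉ Z) : IsIso (η.stalkMap y) :=
  hη.isIso_stalkMap y fun h => hy ((mem_support_vanishingIdeal_pointsClosed hZ).1 h)

variable {X Y : Scheme.{0}} [IsIntegral X] [IsIntegral Y] {s : X ⟶ SpecC} {η : Y ⟶ X}
  {Z : Finset X} {hZ : ∀ p ∈ Z, IsClosed ({p} : Set X)}
  {ι : Type} {C : ι → Closeds X}

/-- The generating coordinate may vary with `y` in the fibre, but the resulting span is symmetric in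
the two coordinates, so one basis serves the whole fibre. -/
lemma twistedLattice_eq_span_of_eq (hη : IsBlowUp η (vanishingIdeal (pointsClosed Z hZ)))
    (hgen : η (genericPoint Y) = genericPoint X) (hZC : ∀ i, ∀ p ∈ Z, p ∉ C i)
    {p : X} (hp : p ∈ Z) {V : X.Opens} {t : Fin 2 → Γ(X, V)} (h : IsChart s p V t)
    (hk : IsKoszulExact (X.presheaf.germ V p h.mem (t 0)) (X.presheaf.germ V p h.mem (t 1)))
    {y : Y} (hy : η y = p) :
    twistedLattice s η hZ C y = Submodule.span (localRing Y y)
      (Set.range fun i => formsMap s η hgen (d s (rationalValue ⟨p, h.mem⟩ (t i)))) := by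
  subst hy
  obtain ⟨i, j, v, hij, hv⟩ := h.exists_isBlowUpChart hgen hη
    (stalkIdeal_vanishingIdeal_pointsClosed Z hZ hp) hk
  exact twistedLattice_eq_of_mem s η hgen hZ C hp hZC h hij hv

lemma twistedLattice_eq_span_of_notMem (hη : IsBlowUp η (vanishingIdeal (pointsClosed Z hZ)))
    (hgen : η (genericPoint Y) = genericPoint X) (hZC : ∀ i, ∀ p ∈ Z, p ∉ C i)
    {y : Y} (hy : η y ∉ Z) {n : ℕ} {e : Fin n → RationalForms s}
    (he : logForms s C (η y) = Submodule.span (localRing X (η y)) (Set.range e)) :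
    twistedLattice s η hZ C y = Submodule.span (localRing Y y)
      (Set.range (formsMap s η hgen ∘ e)) := by
  have := hη.isIso_stalkMap_of_notMem hy
  refine le_antisymm (fun ω hω => ?_) (Submodule.span_le.2 ?_)
  · rw [mem_twistedLattice_of_notMem s η hZ C hy] at hω
    obtain ⟨ω, hω₀, rfl⟩ := exists_formsMap_eq s η hgen hZ C hy hZC hω
    clear hω
    rw [he] at hω₀
    induction hω₀ using Submodule.span_induction with
    | mem ω hω =>
      obtain ⟨i, rfl⟩ := hω
      exact Submodule.subset_span ⟨i, rfl⟩
    | zero => rw [map_zero]; exact zero_mem _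
    | add a b _ _ ha hb => rw [map_add]; exact add_mem ha hb
    | smul c a _ ha =>
      obtain ⟨_, c, rfl⟩ := c
      change formsMap s η hgen (algebraMap _ X.functionField c • a) ∈ _
      rw [formsMap_smul, functionFieldMap_algebraMap]
      exact algebraMap_smul_mem _ _ ha
  · rintro _ ⟨i, rfl⟩
    refine (mem_twistedLattice_of_notMem s η hZ C hy).2
      (formsMap_mem_logForms s η hgen hZ C hZC ?_)
    rw [he]
    exact Submodule.subset_span ⟨i, rfl⟩

lemma isLatticeIsoAt_of_notMem (hη : IsBlowUp η (vanishingIdeal (pointsClosed Z hZ)))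
    (hgen : η (genericPoint Y) = genericPoint X) (hZC : ∀ i, ∀ p ∈ Z, p ∉ C i)
    (hb : Function.Bijective (functionFieldMap η hgen)) {y : Y} (hy : η y ∉ Z) :
    IsLatticeIsoAt η (logForms s C) (twistedLattice s η hZ C) (formsMap s η hgen) y := by
  refine ⟨η ⁻¹ᵁ (pointsClosed Z hZ).compl, hy, fun W hW => hη.isOpen_image fun z hz h => ?_,
    fun z hz => ?_, fun z hz m hm => ?_⟩
  · exact hW hz ((mem_support_vanishingIdeal_pointsClosed hZ).1 h)
  · have := hη.isIso_stalkMap_of_notMem hz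
    exact (ConcreteCategory.bijective_of_isIso (η.stalkMap z)).2
  · have := hη.isIso_stalkMap_of_notMem hz
    exact (formsMap_mem_twistedLattice_iff s η hgen hZ C hz hZC hb).1 hm

/-- The neighbourhood of `η y` is a coordinate chart shrunk to avoid all the curves and all other
points of `Z`; over it the coordinate differentials span both lattices, on and off the fibre of `η
y`. -/
lemma hasLatticeBasisAt_of_mem [Finite ι] (hs : SmoothOfRelativeDimension 2 s)
    (hη : IsBlowUp η (vanishingIdeal (pointsClosed Z hZ)))
    (hgen : η (genericPoint Y) = genericPoint X) (hZC : ∀ i, ∀ p ∈ Z, p ∉ C i)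
    (hb : Function.Bijective (functionFieldMap η hgen)) {y : Y} (hy : η y ∈ Z) :
    HasLatticeBasisAt η (logForms s C) (twistedLattice s η hZ C) (formsMap s η hgen) y := by
  obtain ⟨V, t, h, hk⟩ := exists_chart s hs (η y) (hZ _ hy)
  have hCo : IsOpen (⋂ i, (C i : Set X)ᶜ) :=
    isOpen_iInter_of_finite fun i => (C i).isClosed.isOpen_compl
  have hZo : IsOpen (⋂ p ∈ {p ∈ (Z : Set X) | p ≠ η y}, ({p} : Set X)ᶜ) :=
    (Z.finite_toSet.subset fun p hp => hp.1).isOpen_biInter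
      fun p hp => (hZ p hp.1).isOpen_compl
  let e : Fin 2 → RationalForms s := fun i => d s (rationalValue ⟨η y, h.mem⟩ (t i))
  have hli : LinearIndependent X.functionField e := h.linearIndependent ⟨η y, h.mem⟩
  have hspan (x : X) (hxV : x ∈ V) (hx : ∀ i, x ∉ C i) :
      logForms s C x = Submodule.span (localRing X x) (Set.range e) := by
    rw [h.logForms_eq s ⟨x, hxV⟩ hx]
    congr 2
    exact funext fun i => congrArg (d s) (rationalValue_eq _ _ _)
  refine ⟨V ⊓ ⟨_, hCo⟩ ⊓ ⟨_, hZo⟩, ⟨⟨h.mem, ?_⟩, ?_⟩, 2, e, hli, ?_, fun x hx => ?_, fun z hz => ?_⟩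
  · exact Set.mem_iInter.2 fun i => hZC i _ hy
  · exact Set.mem_iInter₂.2 fun p hp => hp.2.symm
  · exact hli.map_of_surjective_injectiveₛ (functionFieldMap η hgen) (formsMap s η hgen) hb.2
      (formsMap_injective s η hgen hb) (formsMap_smul s η hgen)
  · exact hspan x hx.1.1 fun i => Set.mem_iInter.1 hx.1.2 i
  · by_cases hzZ : η z ∈ Z
    · refine twistedLattice_eq_span_of_eq hη hgen hZC hy h hk (by_contra fun hne => ?_)
      exact Set.mem_iInter₂.1 hz.2 (η z) ⟨hzZ, hne⟩ rfl
    · exact twistedLattice_eq_span_of_notMem hη hgen hZC hzZ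
        (hspan _ hz.1.1 fun i => Set.mem_iInter.1 hz.1.2 i)

/-- Above the center the inverse image ideal is prime, hence equal to its radical. The reduced
exceptional divisor thus inherits invertibility from the definition of the blow-up. -/
lemma stalkIdeal_divisorIdeal_exceptional (hs : SmoothOfRelativeDimension 2 s)
    (hη : IsBlowUp η (vanishingIdeal (pointsClosed Z hZ)))
    (hgen : η (genericPoint Y) = genericPoint X) (y : Y) :
    stalkIdeal (divisorIdeal (exceptional η Z hZ)) y =
      stalkIdeal ((vanishingIdeal (pointsClosed Z hZ)).comap η) y := by
  by_cases hy : η y ∈ Z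
  · obtain ⟨V, t, h, hk⟩ := exists_chart s hs (η y) (hZ _ hy)
    obtain ⟨i, j, v, hij, hv⟩ := h.exists_isBlowUpChart hgen hη
      (stalkIdeal_vanishingIdeal_pointsClosed Z hZ hy) hk
    rw [stalkIdeal_divisorIdeal_of_mem η Z hZ hy, stalkIdeal_exceptional, stalkIdeal_comap,
      stalkIdeal_vanishingIdeal_pointsClosed Z hZ hy, hv.map_eq, hv.isPrime.isRadical.radical]
  · rw [stalkIdeal_divisorIdeal_of_notMem η Z hZ hy, stalkIdeal_comap, stalkIdeal_eq_top,
      Ideal.map_top]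
    exact fun h => hy ((mem_support_vanishingIdeal_pointsClosed hZ).1 h)

lemma formsMap_mem_twistedLattice (hs : SmoothOfRelativeDimension 2 s)
    (hη : IsBlowUp η (vanishingIdeal (pointsClosed Z hZ)))
    (hgen : η (genericPoint Y) = genericPoint X) (hZC : ∀ i, ∀ p ∈ Z, p ∉ C i)
    (y : Y) {ω : RationalForms s} (hω : ω ∈ logForms s C (η y)) :
    formsMap s η hgen ω ∈ twistedLattice s η hZ C y := by
  by_cases hy : η y ∈ Z
  · obtain ⟨V, t, h, hk⟩ := exists_chart s hs (η y) (hZ _ hy)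
    rw [h.logForms_eq s ⟨η y, h.mem⟩ fun i => hZC i _ hy] at hω
    rw [twistedLattice_eq_span_of_eq hη hgen hZC hy h hk rfl]
    induction hω using Submodule.span_induction with
    | mem ω hω =>
      obtain ⟨i, rfl⟩ := hω
      exact Submodule.subset_span ⟨i, rfl⟩
    | zero => rw [map_zero]; exact zero_mem _
    | add a b _ _ ha hb => rw [map_add]; exact add_mem ha hb
    | smul c a _ ha =>
      obtain ⟨_, c, rfl⟩ := c
      change formsMap s η hgen (algebraMap _ X.functionField c • a) ∈ _
      rw [formsMap_smul, functionFieldMap_algebraMap]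
      exact algebraMap_smul_mem _ _ ha
  · have := hη.isIso_stalkMap_of_notMem hy
    exact (mem_twistedLattice_of_notMem s η hZ C hy).2
      (formsMap_mem_logForms s η hgen hZ C hZC hω)

end

end

end LogBlowUp

/-! ### The pullback formula -/

theorem theorem2p2 {X X' : AlgebraicGeometry.Scheme.{0}} (s : X ⟶ LogBlowUp.SpecC)
    [AlgebraicGeometry.IsIntegral X] (hs : LogBlowUp.IsSmoothProjectiveSurface s)
    (Z : Finset X) (hZ : ∀ p ∈ Z, IsClosed ({p} : Set X))
    (η : X' ⟶ X)
    (hη : LogBlowUp.IsBlowUp η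
      (Scheme.IdealSheafData.vanishingIdeal (LogBlowUp.pointsClosed Z hZ)))
    (m : ℕ) (C : Fin m → Closeds X) (hC : LogBlowUp.IsSNCArrangement s C)
    (hZC : ∀ i, ∀ p ∈ Z, p ∉ C i) :
    ∃ _ : AlgebraicGeometry.IsIntegral X',
      Nonempty ((Scheme.Modules.pullback η).obj (LogBlowUp.logSheaf s C) ≅
        LogBlowUp.twistNeg
          (LogBlowUp.logSheaf (η ≫ s) (LogBlowUp.totalArrangement η Z C hZ))
          (LogBlowUp.exceptional η Z hZ)) := by
  -- Closed points of the surface carry two independent coordinates, so none of them is generic.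
  have hI : genericPoint X ∉
      (Scheme.IdealSheafData.vanishingIdeal (LogBlowUp.pointsClosed Z hZ)).support := fun h => by
    have hg := (LogBlowUp.mem_support_vanishingIdeal_pointsClosed hZ).1 h
    obtain ⟨V, t, h, -⟩ := LogBlowUp.exists_chart s hs.smooth _ (hZ _ hg)
    exact h.ne_genericPoint rfl
  have hX' := hη.isIntegral hI
  have hgen := hη.map_genericPoint hI
  have hb := LogBlowUp.IsBlowUp.bijective_functionFieldMap η hgen hη hI
  obtain ⟨e₁⟩ := LogBlowUp.nonempty_pullback_latticeSheaf_iso hgen (LogBlowUp.formsMap_smul s η hgen)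
    (fun y ω hω => LogBlowUp.formsMap_mem_twistedLattice hs.smooth hη hgen hZC y hω) hb
    ⟨LogBlowUp.formsMap_injective s η hgen hb, LogBlowUp.formsMap_surjective s η hgen hb⟩ fun y => by
      by_cases hy : η y ∈ Z
      · exact .inr (LogBlowUp.hasLatticeBasisAt_of_mem hs.smooth hη hgen hZC hb hy)
      · exact .inl (LogBlowUp.isLatticeIsoAt_of_notMem hη hgen hZC hb hy)
  -- The product lattice obtained here is by definition `twistedLattice`, the target of `e₁`.
  obtain ⟨e₂⟩ := LogBlowUp.nonempty_tensorProduct_iso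
    (L := LogBlowUp.logForms (η ≫ s) (LogBlowUp.totalArrangement η Z C hZ))
    (LogBlowUp.isLocallyPrincipal_idealLattice hη.invertible
      (LogBlowUp.stalkIdeal_divisorIdeal_exceptional hs.smooth hη hgen))
  exact ⟨hX', ⟨e₁ ≪≫ e₂.symm⟩⟩
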